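/- **Setting.** Let $I\subseteq(0,\infty)$ have $0$ as a limit point. A perturbation $p$ is a family $(p_\epsilon)_{\epsilon\in I}$ of transition matrices of Markov chains on one finite state space $S$. A state $x$ is *stochastically stable* if there are stationary distributions $\mu_\epsilon$ of $p_\epsilon$ $(\epsilon\in I)$ with $\liminf_{\epsilon\to0}\mu_\epsilon(x)>0$. For $f,g:I\to[0,1]$ write $f\precsim g$ if there are $b,\epsilon_0>0$ with $f(\epsilon)\le b\,g(\epsilon)$ for all $\epsilon\in I$, $\epsilon<\epsilon_0$; write $f\cong g$ if $f\precsim g$ and $g\precsim f$, and $[f]$ for the $\cong$-class of $f$. The classes carry $0=[0]$, $1=[1]$, the order $[f]\le[g]\iff f\precsim g$, the operations $[f]\cdot[g]=[fg]$ and $\max([f],[g])=[\max(f,g)]$, and, for $[f]\le[g]$, the ordered division $[f]\div[g]=[h]$, where $h=\min(1,f/g)$ where $g>0$ and $h=1$ where $g=0$ (so $([f]\div[g])\cdot[g]=[f]$). Let $[p](x,y)=[\epsilon\mapsto p_\epsilon(x,y)]$. **Algorithm.** $\mathrm{Hub}(S,P)$, for a matrix $P$ of classes indexed by $S\times S$,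 calls the recursive procedure below on the vertex set $\{\{s\}: s\in S\}$ with weights $P(\{x\},\{y\})=P(x,y)$. On a vertex set $V$ (a set of disjoint nonempty sets of states) with weights $P$, the procedure does the following. (1) $M:=\max\{P(x,y): x\ne y\}$ (with $\max\emptyset=0$); if $M=0$, return $\bigcup V$. (2) Outgoing scaling: replace $P(x,y)$ by $P(x,y)\div M$ for all $x\ne y$. (3) Shrinking: let $E_1,\dots,E_k$ be the sink strongly connected components of the digraph on $V$ with arcs $\{(x,y): x\neq y,\ P(x,y)=1\}$, let $T=V\setminus\bigcup_iE_i$, and let $P'(\bigcup E_i,\bigcup E_j)$ be the maximum of the products of the weights along the paths from a vertex of $E_i$ to a vertex of $E_j$ whose intermediate vertices are pairwise distinct and in $T$. (4) Call the procedure on $\{\bigcup E_1,\dots,\bigcup E_k\}$ and $P'$ and return its result. **Theorem.** Consider perturbations $p$ such that the multiplicative closure of the maps $\epsilon\mapsto p_\epsilon(x,y)$, $x\ne y$, is totally preordered by $\precsim$. 1. For every such $p$, $\mathrm{Hub}(S,[p])$ terminates, and a state is stochastically stable if and only if it belongs to $\mathrm{Hub}(S,[p])$. 2. Stability can be decided in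 time $O(n^3)$, where $n\ge1$ is the number of states, if inequality, multiplication and ordered division of classes take constant time. Precisely: there are one random-access program (with integer registers and arrays, registers and arrays of classes, and unit cost for every instruction and test, including $\le$, $\cdot$, and $\div$ on classes, the latter being applied only to $[f]\le[g]$) and one constant $C$ such that for all $n\ge1$, all $I$ and all such $p$ with $S=\{0,\dots,n-1\}$, the program started on $n$ and the matrix $[p]$ halts after at most $Cn^3$ steps and outputs the set of stochastically stable states. -/

import Mathlib

open Filter Topology

namespace StochStab

/-! ### Perturbations and stochastic stability -/

/-- A perturbation: a family, indexed by a set `I` of positive reals accumulating at `0`, of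
Markov chains (given by their transition matrices) on one finite state space `S`. -/
structure Perturbation (I : Set ℝ) (S : Type*) [Fintype S] [DecidableEq S] where
  pos : ∀ ε ∈ I, 0 < ε
  accPt : AccPt (0 : ℝ) (𝓟 I)
  mat : I → Matrix S S ℝ
  stoch : ∀ ε, mat ε ∈ Matrix.rowStochastic ℝ S

/-- `ε → 0` inside `I`. -/
def toZero (I : Set ℝ) : Filter I := comap Subtype.val (𝓝 0)

/-- `μ` is a stationary distribution of the chain with transition matrix `A`. -/
def IsStationary {S : Type*} [Fintype S] (A : Matrix S S ℝ) (μ : S → ℝ) : Prop :=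
  μ ∈ stdSimplex ℝ S ∧ Matrix.vecMul μ A = μ

/-- `x` is stochastically stable: some family of stationary distributions has positive limit
inferior at `x`. -/
def Perturbation.Stable {I : Set ℝ} {S : Type*} [Fintype S] [DecidableEq S]
    (p : Perturbation I S) (x : S) : Prop :=
  ∃ μ : I → S → ℝ, (∀ ε, IsStationary (p.mat ε) (μ ε)) ∧ 0 < liminf (fun ε => μ ε x) (toZero I)

/-- The map `ε ↦ p_ε(x, y)` from `I` to `[0, 1]`. -/
def Perturbation.entry {I : Set ℝ} {S : Type*} [Fintype S] [DecidableEq S]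
    (p : Perturbation I S) (x y : S) : I → unitInterval := fun ε =>
  ⟨p.mat ε x y, Matrix.nonneg_of_mem_rowStochastic (p.stoch ε),
    Matrix.le_one_of_mem_rowStochastic (p.stoch ε)⟩

/-- `f ≾ g`: `f` is `O(g)` as `ε → 0`. -/
def Precsim {I : Set ℝ} (f g : I → unitInterval) : Prop :=
  ∃ b : ℝ, 0 < b ∧ ∃ ε₀ : ℝ, 0 < ε₀ ∧
    ∀ ε : I, (ε : ℝ) < ε₀ → (f ε : ℝ) ≤ b * (g ε : ℝ)

/-- The multiplicative closure of the maps `ε ↦ p_ε(x, y)` with `x ≠ y` is totally preordered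
by `≾`. -/
def Perturbation.Comparable {I : Set ℝ} {S : Type*} [Fintype S] [DecidableEq S]
    (p : Perturbation I S) : Prop :=
  ∀ f ∈ Subsemigroup.closure {f : I → unitInterval | ∃ x y : S, x ≠ y ∧ f = p.entry x y},
  ∀ g ∈ Subsemigroup.closure {f : I → unitInterval | ∃ x y : S, x ≠ y ∧ f = p.entry x y},
    Precsim f g ∨ Precsim g f

/-! ### Maps up to `≅`, with their multiplication, order, maximum and ordered division -/

section Precsim

variable {I : Set ℝ}

theorem Precsim.of_le {f g : I → unitInterval} (h : ∀ ε, f ε ≤ g ε) : Precsim f g :=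
  ⟨1, one_pos, 1, one_pos, fun ε _ => by rw [one_mul]; exact h ε⟩

theorem Precsim.refl (f : I → unitInterval) : Precsim f f := Precsim.of_le fun _ => le_rfl

theorem Precsim.trans {f g h : I → unitInterval} (h₁ : Precsim f g) (h₂ : Precsim g h) :
    Precsim f h := by
  obtain ⟨b, hb, e, he, H⟩ := h₁
  obtain ⟨c, hc, d, hd, K⟩ := h₂
  refine ⟨b * c, by positivity, min e d, lt_min he hd, fun ε hε => ?_⟩
  have h1 := H ε (hε.trans_le (min_le_left _ _))
  have h2 := K ε (hε.trans_le (min_le_right _ _))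
  calc (f ε : ℝ) ≤ b * g ε := h1
    _ ≤ b * (c * h ε) := by gcongr
    _ = b * c * h ε := by ring

theorem Precsim.mul {f f' g g' : I → unitInterval} (h₁ : Precsim f f') (h₂ : Precsim g g') :
    Precsim (f * g) (f' * g') := by
  obtain ⟨b, hb, e, he, H⟩ := h₁
  obtain ⟨c, hc, d, hd, K⟩ := h₂
  refine ⟨b * c, by positivity, min e d, lt_min he hd, fun ε hε => ?_⟩
  have h1 := H ε (hε.trans_le (min_le_left _ _))
  have h2 := K ε (hε.trans_le (min_le_right _ _))
  calc ((f ε : ℝ) * (g ε : ℝ)) ≤ (b * f' ε) * (c * g' ε) :=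
        mul_le_mul h1 h2 (g ε).2.1 (mul_nonneg hb.le (f' ε).2.1)
    _ = b * c * ((f' ε : ℝ) * (g' ε : ℝ)) := by ring

theorem Precsim.sup_le {f g h : I → unitInterval} (h₁ : Precsim f h) (h₂ : Precsim g h) :
    Precsim (f ⊔ g) h := by
  obtain ⟨b, hb, e, he, H⟩ := h₁
  obtain ⟨c, hc, d, hd, K⟩ := h₂
  refine ⟨max b c, lt_max_of_lt_left hb, min e d, lt_min he hd, fun ε hε => ?_⟩
  have h1 := H ε (hε.trans_le (min_le_left _ _))
  have h2 := K ε (hε.trans_le (min_le_right _ _))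
  have h0 := (h ε).2.1
  rcases le_total (f ε) (g ε) with hl | hl
  · have : (f ⊔ g) ε = g ε := sup_eq_right.2 hl
    rw [this]
    exact h2.trans (mul_le_mul_of_nonneg_right (le_max_right _ _) h0)
  · have : (f ⊔ g) ε = f ε := sup_eq_left.2 hl
    rw [this]
    exact h1.trans (mul_le_mul_of_nonneg_right (le_max_left _ _) h0)

/-- Ordered division of maps: the pointwise quotient where `g` is positive, and `1` where `g`
vanishes. The quotient is cut off at `1` in order to stay in `[0, 1]`; since it is bounded
near `0` when `f ≾ g`, this does not change its class in that case. -/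
noncomputable def ordDiv (f g : I → unitInterval) : I → unitInterval := fun ε =>
  if 0 < (g ε : ℝ) then
    ⟨min 1 ((f ε : ℝ) / (g ε : ℝ)),
      le_min zero_le_one (div_nonneg (f ε).2.1 (g ε).2.1), min_le_left _ _⟩
  else 1

theorem Precsim.div {f f' g g' : I → unitInterval} (h₁ : Precsim f f') (h₂ : Precsim g' g) :
    Precsim (ordDiv f g) (ordDiv f' g') := by
  obtain ⟨b, hb, e, he, H⟩ := h₁
  obtain ⟨c, hc, d, hd, K⟩ := h₂
  refine ⟨max 1 (b * c), lt_max_of_lt_left one_pos, min e d, lt_min he hd, fun ε hε => ?_⟩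
  have h1 := H ε (hε.trans_le (min_le_left _ _))
  have h2 := K ε (hε.trans_le (min_le_right _ _))
  have hm : (1 : ℝ) ≤ max 1 (b * c) := le_max_left _ _
  by_cases hg' : 0 < (g' ε : ℝ)
  · have hg : 0 < (g ε : ℝ) := by
      by_contra hn
      have : (g ε : ℝ) = 0 := le_antisymm (not_lt.1 hn) (g ε).2.1
      rw [this, mul_zero] at h2
      exact absurd hg' (not_lt.2 h2)
    simp only [ordDiv, if_pos hg, if_pos hg']
    rcases le_total 1 ((f' ε : ℝ) / (g' ε : ℝ)) with hl | hl
    · rw [min_eq_left hl, mul_one]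
      exact (min_le_left _ _).trans hm
    · rw [min_eq_right hl]
      refine (min_le_right _ _).trans ?_
      have hq : 0 ≤ (f' ε : ℝ) / (g' ε : ℝ) := div_nonneg (f' ε).2.1 (g' ε).2.1
      refine le_trans ?_ (mul_le_mul_of_nonneg_right (le_max_right 1 (b * c)) hq)
      rw [div_le_iff₀ hg]
      have hf' : (f' ε : ℝ) = (f' ε : ℝ) / (g' ε : ℝ) * (g' ε : ℝ) :=
        (div_mul_cancel₀ _ hg'.ne').symm
      calc (f ε : ℝ) ≤ b * f' ε := h1
        _ = b * ((f' ε : ℝ) / (g' ε : ℝ)) * (g' ε : ℝ) := by rw [mul_assoc, ← hf']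
        _ ≤ b * ((f' ε : ℝ) / (g' ε : ℝ)) * (c * g ε) := by gcongr
        _ = b * c * ((f' ε : ℝ) / (g' ε : ℝ)) * (g ε : ℝ) := by ring
  · have : ordDiv f' g' ε = 1 := if_neg hg'
    rw [this, Set.Icc.coe_one, mul_one]
    exact (ordDiv f g ε).2.2.trans hm

end Precsim

/-- `f ≅ g` iff `f ≾ g` and `g ≾ f`. -/
def congSetoid (I : Set ℝ) : Setoid (I → unitInterval) where
  r f g := Precsim f g ∧ Precsim g f
  iseqv := ⟨fun f => ⟨Precsim.refl f, Precsim.refl f⟩, fun h => ⟨h.2, h.1⟩,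
    fun h k => ⟨h.1.trans k.1, k.2.trans h.2⟩⟩

/-- The `≅`-classes of maps `I → [0, 1]`. -/
def OrderClass (I : Set ℝ) : Type := Quotient (congSetoid I)

namespace OrderClass

variable {I : Set ℝ}

/-- The class `[f]` of a map `f`. -/
def mk (f : I → unitInterval) : OrderClass I := Quotient.mk (congSetoid I) f

/-- `[f] ≤ [g]` iff `f ≾ g`. -/
instance : PartialOrder (OrderClass I) where
  le := Quotient.lift₂ Precsim fun _ _ _ _ h k =>
    propext ⟨fun H => h.2.trans (H.trans k.1), fun H => h.1.trans (H.trans k.2)⟩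
  le_refl a := Quotient.inductionOn a Precsim.refl
  le_trans a b c := Quotient.inductionOn₃ a b c fun _ _ _ => Precsim.trans
  le_antisymm a b := Quotient.inductionOn₂ a b fun _ _ h k => Quotient.sound ⟨h, k⟩

/-- `max [f] [g] = [max f g]`; it is the larger one of the two classes when they are
comparable. -/
instance : SemilatticeSup (OrderClass I) where
  sup := Quotient.map₂ (· ⊔ ·) fun _ _ h _ _ k =>
    ⟨(h.1.trans (.of_le fun _ => le_sup_left)).sup_le (k.1.trans (.of_le fun _ => le_sup_right)),
      (h.2.trans (.of_le fun _ => le_sup_left)).sup_le (k.2.trans (.of_le fun _ => le_sup_right))⟩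
  le_sup_left a b := Quotient.inductionOn₂ a b fun _ _ => .of_le fun _ => le_sup_left
  le_sup_right a b := Quotient.inductionOn₂ a b fun _ _ => .of_le fun _ => le_sup_right
  sup_le a b c := Quotient.inductionOn₃ a b c fun _ _ _ => Precsim.sup_le

/-- `[f] · [g] = [f · g]`. -/
instance : CommMonoidWithZero (OrderClass I) where
  zero := mk 0
  one := mk 1
  mul := Quotient.map₂ (· * ·) fun _ _ h _ _ k => ⟨h.1.mul k.1, h.2.mul k.2⟩
  mul_assoc a b c := Quotient.inductionOn₃ a b c fun f g h => congrArg mk (mul_assoc f g h)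
  mul_comm a b := Quotient.inductionOn₂ a b fun f g => congrArg mk (mul_comm f g)
  one_mul a := Quotient.inductionOn a fun f => congrArg mk (one_mul f)
  mul_one a := Quotient.inductionOn a fun f => congrArg mk (mul_one f)
  zero_mul a := Quotient.inductionOn a fun f => congrArg mk (zero_mul f)
  mul_zero a := Quotient.inductionOn a fun f => congrArg mk (mul_zero f)

/-- `[0]` is the least and `[1]` the greatest class. -/
instance : BoundedOrder (OrderClass I) where
  bot := 0
  bot_le a := Quotient.inductionOn a fun f => .of_le fun ε => (f ε).2.1
  top := 1
  le_top a := Quotient.inductionOn a fun f => .of_le fun ε => (f ε).2.2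

/-- Ordered division of classes, `[f] ÷ [g] = [f ÷ g]`. -/
noncomputable instance : Div (OrderClass I) where
  div := Quotient.map₂ ordDiv fun _ _ h _ _ k => ⟨h.1.div k.2, h.2.div k.1⟩

end OrderClass

/-- The matrix `[p]` of the classes of the transition maps. -/
def Perturbation.classes {I : Set ℝ} {S : Type*} [Fintype S] [DecidableEq S]
    (p : Perturbation I S) (x y : S) : OrderClass I := OrderClass.mk (p.entry x y)

/-! ### The recursive algorithm `Hub`

The vertices of the weighted digraphs are sets of states; a digraph is a finite set `V` of
vertices together with a weight function `P`. Only the values of `P` on `V` matter. -/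

section Hub

open Classical

variable {I : Set ℝ} {S : Type*}

/-- The maximal weight `M` of the arcs between distinct vertices (`0` if there are none). -/
noncomputable def maxLabel (V : Finset (Finset S)) (P : Finset S → Finset S → OrderClass I) :
    OrderClass I :=
  V.offDiag.sup fun e => P e.1 e.2

/-- Outgoing scaling: the weights of the arcs between distinct vertices are divided by `M`. -/
noncomputable def outScale (V : Finset (Finset S)) (P : Finset S → Finset S → OrderClass I) :
    Finset S → Finset S → OrderClass I :=
  fun x y => if x = y then P x y else P x y / maxLabel V P

/-- The arcs of the essential graph: those of weight `1` between distinct vertices. -/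
def EssArc (V : Finset (Finset S)) (P : Finset S → Finset S → OrderClass I)
    (x y : Finset S) : Prop :=
  x ∈ V ∧ y ∈ V ∧ x ≠ y ∧ P x y = 1

/-- Reachability in the essential graph. -/
def EssReach (V : Finset (Finset S)) (P : Finset S → Finset S → OrderClass I) :
    Finset S → Finset S → Prop :=
  Relation.ReflTransGen (EssArc V P)

/-- `x` lies in a sink strongly connected component of the essential graph. -/
def IsEssential (V : Finset (Finset S)) (P : Finset S → Finset S → OrderClass I)
    (x : Finset S) : Prop :=
  x ∈ V ∧ ∀ y, EssReach V P x y → EssReach V P y x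

/-- The strongly connected component of `x` in the essential graph. -/
noncomputable def scc (V : Finset (Finset S)) (P : Finset S → Finset S → OrderClass I)
    (x : Finset S) : Finset (Finset S) :=
  V.filter fun y => EssReach V P x y ∧ EssReach V P y x

/-- The essential classes `E₁, …, E_k`: the sink strongly connected components. -/
noncomputable def essClasses (V : Finset (Finset S)) (P : Finset S → Finset S → OrderClass I) :
    Finset (Finset (Finset S)) :=
  (V.filter (IsEssential V P)).image (scc V P)

/-- The set `T` of transient vertices, those outside all essential classes. -/
noncomputable def transients (V : Finset (Finset S))
    (P : Finset S → Finset S → OrderClass I) : Finset (Finset S) :=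
  V.filter fun x => ¬ IsEssential V P x

/-- The weight of a path: the product of the weights of its arcs. -/
def pathWeight (P : Finset S → Finset S → OrderClass I) : List (Finset S) → OrderClass I
  | x :: y :: γ => P x y * pathWeight P (y :: γ)
  | _ => 1

/-- The maximal weight of a path from `x` to `y` whose intermediate vertices are pairwise
distinct elements of `T`. -/
noncomputable def maxPath (P : Finset S → Finset S → OrderClass I) (T : Finset (Finset S))
    (x y : Finset S) : OrderClass I :=
  Finset.univ.sup fun γ : {l : List T // l.Nodup} =>
    pathWeight P (x :: (γ.1.map Subtype.val ++ [y]))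

/-- The vertices `⋃E₁, …, ⋃E_k` of the shrunk graph. -/
noncomputable def shrinkVerts (V : Finset (Finset S))
    (P : Finset S → Finset S → OrderClass I) : Finset (Finset S) :=
  (essClasses V P).image fun E => E.biUnion id

/-- The weights of the shrunk graph: the weight from `a = ⋃Eᵢ` to `b = ⋃Eⱼ` is the maximal
weight of a simple path from `Eᵢ` to `Eⱼ` through transient vertices. (The vertices being
nonempty and disjoint, `Eᵢ` consists of the vertices contained in `⋃Eᵢ`.) -/
noncomputable def shrinkWeight (V : Finset (Finset S))
    (P : Finset S → Finset S → OrderClass I) : Finset S → Finset S → OrderClass I :=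
  fun a b => (V.filter (· ⊆ a) ×ˢ V.filter (· ⊆ b)).sup fun e =>
    maxPath P (transients V P) e.1 e.2

/-- `HubRec V P H`: the recursive call with arguments `V` and `P` terminates and returns `H`. -/
inductive HubRec : Finset (Finset S) → (Finset S → Finset S → OrderClass I) → Finset S → Prop
  | base (V : Finset (Finset S)) (P : Finset S → Finset S → OrderClass I)
      (hM : maxLabel V P = 0) : HubRec V P (V.biUnion id)
  | step (V : Finset (Finset S)) (P : Finset S → Finset S → OrderClass I) (H : Finset S)
      (hM : maxLabel V P ≠ 0)
      (hrec : HubRec (shrinkVerts V (outScale V P)) (shrinkWeight V (outScale V P)) H) :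
      HubRec V P H

/-- `Hub P H`: the algorithm `Hub`, on the digraph with vertex set `S` and weights `P`,
terminates and returns `H`. It starts the recursion on the isomorphic digraph whose vertices
are the singletons, the weight from `{x}` to `{y}` being `P x y`. -/
def Hub [Fintype S] (P : S → S → OrderClass I) (H : Finset S) : Prop :=
  HubRec (Finset.univ.image fun s : S => ({s} : Finset S))
    (fun a b => (a ×ˢ b).sup fun e => P e.1 e.2) H

end Hub

/-! ### Random access machines over classes, with unit-cost operations -/

/-- Memory: integer registers, weight registers, and two-dimensional arrays of integers and of
weights. -/
structure Mem (F : Type*) where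
  reg : ℕ → ℕ
  wreg : ℕ → F
  arr : ℕ → ℕ → ℕ → ℕ
  warr : ℕ → ℕ → ℕ → F

/-- `a[i][j] := v` for the array number `a` of a family `A` of arrays. -/
def setCell {α : Type*} (A : ℕ → ℕ → ℕ → α) (a i j : ℕ) (v : α) : ℕ → ℕ → ℕ → α :=
  Function.update A a (Function.update (A a) i (Function.update (A a i) j v))

/-- Programs. Array indices are the contents of integer registers. -/
inductive Prog
  | const (r k : ℕ)
  | copy (r s : ℕ)
  | succ (r : ℕ)
  | pred (r : ℕ)
  | load (r a i j : ℕ)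
  | store (a i j r : ℕ)
  | wzero (r : ℕ)
  | wone (r : ℕ)
  | wcopy (r s : ℕ)
  | wmul (r s t : ℕ)
  | wdiv (r s t : ℕ)
  | wload (r a i j : ℕ)
  | wstore (a i j r : ℕ)
  | seq (c d : Prog)
  | iflt (r s : ℕ) (c d : Prog)
  | ifwle (r s : ℕ) (c d : Prog)
  | whilelt (r s : ℕ) (c : Prog)

/-- `Exec c m t m'`: started in memory `m`, the program `c` halts after `t` steps in memory
`m'`. Every instruction and every evaluation of a test counts one step. In particular the
operations on weights (comparison, multiplication, ordered division) have unit cost; the ordered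
division of `f` by `g` is available only if `f ≤ g`. -/
inductive Exec {F : Type*} [Zero F] [One F] [Mul F] [Div F] [LE F] :
    Prog → Mem F → ℕ → Mem F → Prop
  | const (m : Mem F) (r k : ℕ) :
      Exec (.const r k) m 1 { m with reg := Function.update m.reg r k }
  | copy (m : Mem F) (r s : ℕ) :
      Exec (.copy r s) m 1 { m with reg := Function.update m.reg r (m.reg s) }
  | succ (m : Mem F) (r : ℕ) :
      Exec (.succ r) m 1 { m with reg := Function.update m.reg r (m.reg r + 1) }
  | pred (m : Mem F) (r : ℕ) :
      Exec (.pred r) m 1 { m with reg := Function.update m.reg r (m.reg r - 1) }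
  | load (m : Mem F) (r a i j : ℕ) :
      Exec (.load r a i j) m 1
        { m with reg := Function.update m.reg r (m.arr a (m.reg i) (m.reg j)) }
  | store (m : Mem F) (a i j r : ℕ) :
      Exec (.store a i j r) m 1
        { m with arr := setCell m.arr a (m.reg i) (m.reg j) (m.reg r) }
  | wzero (m : Mem F) (r : ℕ) :
      Exec (.wzero r) m 1 { m with wreg := Function.update m.wreg r 0 }
  | wone (m : Mem F) (r : ℕ) :
      Exec (.wone r) m 1 { m with wreg := Function.update m.wreg r 1 }
  | wcopy (m : Mem F) (r s : ℕ) :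
      Exec (.wcopy r s) m 1 { m with wreg := Function.update m.wreg r (m.wreg s) }
  | wmul (m : Mem F) (r s t : ℕ) :
      Exec (.wmul r s t) m 1
        { m with wreg := Function.update m.wreg r (m.wreg s * m.wreg t) }
  | wdiv (m : Mem F) (r s t : ℕ) (h : m.wreg s ≤ m.wreg t) :
      Exec (.wdiv r s t) m 1
        { m with wreg := Function.update m.wreg r (m.wreg s / m.wreg t) }
  | wload (m : Mem F) (r a i j : ℕ) :
      Exec (.wload r a i j) m 1
        { m with wreg := Function.update m.wreg r (m.warr a (m.reg i) (m.reg j)) }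
  | wstore (m : Mem F) (a i j r : ℕ) :
      Exec (.wstore a i j r) m 1
        { m with warr := setCell m.warr a (m.reg i) (m.reg j) (m.wreg r) }
  | seq (c d : Prog) (m₁ m₂ m₃ : Mem F) (t u : ℕ)
      (hc : Exec c m₁ t m₂) (hd : Exec d m₂ u m₃) : Exec (.seq c d) m₁ (t + u) m₃
  | iflt_true (r s : ℕ) (c d : Prog) (m m' : Mem F) (t : ℕ)
      (h : m.reg r < m.reg s) (hc : Exec c m t m') : Exec (.iflt r s c d) m (t + 1) m'
  | iflt_false (r s : ℕ) (c d : Prog) (m m' : Mem F) (t : ℕ)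
      (h : ¬ m.reg r < m.reg s) (hd : Exec d m t m') : Exec (.iflt r s c d) m (t + 1) m'
  | ifwle_true (r s : ℕ) (c d : Prog) (m m' : Mem F) (t : ℕ)
      (h : m.wreg r ≤ m.wreg s) (hc : Exec c m t m') : Exec (.ifwle r s c d) m (t + 1) m'
  | ifwle_false (r s : ℕ) (c d : Prog) (m m' : Mem F) (t : ℕ)
      (h : ¬ m.wreg r ≤ m.wreg s) (hd : Exec d m t m') : Exec (.ifwle r s c d) m (t + 1) m'
  | whilelt_true (r s : ℕ) (c : Prog) (m₁ m₂ m₃ : Mem F) (t u : ℕ)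
      (h : m₁.reg r < m₁.reg s) (hc : Exec c m₁ t m₂)
      (hw : Exec (.whilelt r s c) m₂ u m₃) : Exec (.whilelt r s c) m₁ (t + u + 1) m₃
  | whilelt_false (r s : ℕ) (c : Prog) (m : Mem F)
      (h : ¬ m.reg r < m.reg s) : Exec (.whilelt r s c) m 1 m

/-- Initial memory on input an `n × n` matrix `P` of weights: integer register `0` holds `n`,
weight array `0` holds `P`, and everything else is `0`. -/
def Mem.input {F : Type*} [Zero F] (n : ℕ) (P : Fin n → Fin n → F) : Mem F where
  reg := Function.update (fun _ => 0) 0 n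
  wreg := fun _ => 0
  arr := fun _ _ _ => 0
  warr := fun a i j => if h : a = 0 ∧ i < n ∧ j < n then P ⟨i, h.2.1⟩ ⟨j, h.2.2⟩ else 0

/-- On input `P` the program halts within `t` steps and outputs the set `A`, as the set of those
`i < n` for which cell `[i][0]` of integer array `0` holds `1`. -/
def Prog.ComputesWithin {F : Type*} [Zero F] [One F] [Mul F] [Div F] [LE F] (c : Prog) {n : ℕ}
    (P : Fin n → Fin n → F) (t : ℕ) (A : Set (Fin n)) : Prop :=
  ∃ (s : ℕ) (m : Mem F), Exec c (Mem.input n P) s m ∧ s ≤ t ∧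
    ∀ i : Fin n, m.arr 0 i 0 = 1 ↔ i ∈ A

end StochStab

/-! A stationary distribution `μ` of `p_ε` is a circulation: `φ x y = μ x * p_ε(x, y)` has equal
inflow and outflow at every vertex. The proof uses no exact formula for `μ`. It works with pairs
(`ν`, `φ`) of a mass distribution and a circulation such that `φ x y` agrees with `ν x` times the
rate of the arc up to a constant factor (`IsFlow`). This notion survives every operation of the
algorithm, at the price of a worse constant: replacing rates by others of the same order, dividing
all rates by `M`, eliminating a vertex and merging vertices of comparable mass.

The chains may be reducible, so a stationary distribution may have to be chosen. To this end a
background rate `δ > 0` is added to every arc. All flows with small `δ` then charge the right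
vertices, and `δ → 0` at fixed `ε` yields, by compactness, a stationary distribution that does so
too (`exists_isStationary_of_background`). Conversely, a class different from `1` only becomes small
along some sequence of parameters, so loss of mass is proved frequently as `ε → 0`, which is enough
to refute a positive limit inferior. `Correct` records both halves, and `Correct.stable_iff`
translates it into stability.

Four reductions carry `Correct` from a smaller digraph back to a larger one. Without arcs, the
background rate spreads the mass evenly (`Correct.of_zero`). Division by `M` is a change of time
scale (`Correct.of_div`). A vertex `z` with an outgoing arc of weight `1` releases its mass at a
rate bounded from below, so its throughput is comparable to its mass and the arcs through `z` can be
replaced by products (`Correct.of_eliminate`); such a `z` is charged exactly if a charged vertex has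
an arc of weight `1` to it. Vertices strongly connected by arcs of weight `1` have comparable masses
and can be merged (`Correct.of_merge`).

Comparability is needed to select maxima. It is kept through the recursion by carrying a totally
ordered monoid of classes, which may be replaced by another one after each division
(`IsTotalMonoid.exists_div`).

A round of `Hub` is a division, the elimination of the transient vertices one at a time and a
merger; it loses a vertex because the maximal arc gets weight `1` (`exists_hubRec`). The cubic
program does not simulate `Hub`. It performs at most `n` rounds of quadratic cost, each dividing by
`M` and eliminating the source of one maximal arc, until no arc is left; all remaining vertices are
then stable. The eliminated vertices are decided in reverse order from the stored columns of
weights, in linear time each. -/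

namespace StochStab

/-! ### Representatives of classes -/

section Classes

variable {I : Set ℝ}

theorem eventually_toZero_of_lt {p : I → Prop} {ε₀ : ℝ} (h₀ : 0 < ε₀)
    (h : ∀ ε : I, (ε : ℝ) < ε₀ → p ε) : ∀ᶠ ε in toZero I, p ε := by
  have : ∀ᶠ x : ℝ in 𝓝 0, x < ε₀ := eventually_lt_nhds h₀
  exact (this.comap Subtype.val).mono h

theorem eventually_toZero_iff (hI : ∀ ε ∈ I, 0 < ε) {p : I → Prop} :
    (∀ᶠ ε in toZero I, p ε) ↔ ∃ ε₀ : ℝ, 0 < ε₀ ∧ ∀ ε : I, (ε : ℝ) < ε₀ → p ε := by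
  refine ⟨fun h => ?_, fun ⟨ε₀, h₀, h⟩ => eventually_toZero_of_lt h₀ h⟩
  rw [toZero, eventually_comap, Metric.eventually_nhds_iff] at h
  obtain ⟨r, hr, h⟩ := h
  refine ⟨r, hr, fun ε hε => h ?_ ε rfl⟩
  rw [Real.dist_eq, sub_zero, abs_of_pos (hI ε ε.2)]
  exact hε

/-- `A` is bounded by a constant multiple of `B` near `0`. -/
def Dom (A B : I → ℝ) : Prop := ∃ b : ℝ, 1 ≤ b ∧ ∀ᶠ ε in toZero I, A ε ≤ b * B ε

theorem Precsim.dom {f g : I → unitInterval} (h : Precsim f g) :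
    Dom (fun ε => (f ε : ℝ)) (fun ε => (g ε : ℝ)) := by
  obtain ⟨b, hb, e, he, h⟩ := h
  refine ⟨max 1 b, le_max_left _ _, eventually_toZero_of_lt he fun ε hε => ?_⟩
  exact (h ε hε).trans (mul_le_mul_of_nonneg_right (le_max_right _ _) (g ε).2.1)

theorem Dom.precsim (hI : ∀ ε ∈ I, 0 < ε) {f g : I → unitInterval}
    (h : Dom (fun ε => (f ε : ℝ)) (fun ε => (g ε : ℝ))) : Precsim f g := by
  obtain ⟨b, hb, h⟩ := h
  obtain ⟨e, he, h⟩ := (eventually_toZero_iff hI).1 h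
  exact ⟨b, by linarith, e, he, h⟩

/-- A representative of a class. -/
noncomputable def OrderClass.out (c : OrderClass I) : I → unitInterval := Quotient.out c

/-- The values of a representative of a class. -/
noncomputable def rep (c : OrderClass I) (ε : I) : ℝ := c.out ε

theorem rep_nonneg (c : OrderClass I) (ε : I) : 0 ≤ rep c ε := (c.out ε).2.1

theorem rep_le_one (c : OrderClass I) (ε : I) : rep c ε ≤ 1 := (c.out ε).2.2

namespace OrderClass

theorem mk_out (c : OrderClass I) : mk c.out = c := Quotient.out_eq c

theorem mk_le_mk {f g : I → unitInterval} : mk f ≤ mk g ↔ Precsim f g := Iff.rfl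

theorem mk_mul_mk (f g : I → unitInterval) : mk f * mk g = mk (f * g) := rfl

theorem mk_sup_mk (f g : I → unitInterval) : mk f ⊔ mk g = mk (f ⊔ g) := rfl

theorem mk_div_mk (f g : I → unitInterval) : mk f / mk g = mk (ordDiv f g) := rfl

theorem bot_eq_zero : (⊥ : OrderClass I) = 0 := rfl

theorem zero_le (c : OrderClass I) : 0 ≤ c := bot_le (a := c)

theorem le_one (c : OrderClass I) : c ≤ 1 := le_top (a := c)

theorem eq_one_of_le {c : OrderClass I} (h : 1 ≤ c) : c = 1 := le_antisymm (le_one c) h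

theorem mul_le_mul' {a b c d : OrderClass I} (h₁ : a ≤ b) (h₂ : c ≤ d) : a * c ≤ b * d := by
  induction a using Quotient.inductionOn
  induction b using Quotient.inductionOn
  induction c using Quotient.inductionOn
  induction d using Quotient.inductionOn
  exact Precsim.mul h₁ h₂

theorem mul_le_left (a b : OrderClass I) : a * b ≤ a := by
  simpa using mul_le_mul' (le_refl a) (le_one b)

theorem mul_le_right (a b : OrderClass I) : a * b ≤ b := by
  simpa using mul_le_mul' (le_one a) (le_refl b)

theorem div_le_div {a b c d : OrderClass I} (h₁ : a ≤ b) (h₂ : d ≤ c) : a / c ≤ b / d := by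
  induction a using Quotient.inductionOn
  induction b using Quotient.inductionOn
  induction c using Quotient.inductionOn
  induction d using Quotient.inductionOn
  exact Precsim.div h₁ h₂

theorem mul_sup (a b c : OrderClass I) : a * (b ⊔ c) = a * b ⊔ a * c := by
  refine le_antisymm ?_ (sup_le (mul_le_mul' le_rfl le_sup_left) (mul_le_mul' le_rfl le_sup_right))
  induction a using Quotient.inductionOn with | _ f
  induction b using Quotient.inductionOn with | _ g
  induction c using Quotient.inductionOn with | _ h
  refine Precsim.of_le fun ε => ?_
  change f ε * (g ε ⊔ h ε) ≤ f ε * g ε ⊔ f ε * h ε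
  rcases le_total (g ε) (h ε) with hl | hl
  · rw [sup_eq_right.2 hl]; exact le_sup_right
  · rw [sup_eq_left.2 hl]; exact le_sup_left

theorem mul_finset_sup {ι : Type*} (s : Finset ι) (a : OrderClass I) (f : ι → OrderClass I) :
    a * s.sup f = s.sup fun i => a * f i := by
  classical
  induction s using Finset.induction_on with
  | empty => rw [Finset.sup_empty, Finset.sup_empty, bot_eq_zero, mul_zero]
  | insert i s hi ih => rw [Finset.sup_insert, Finset.sup_insert, mul_sup, ih]

end OrderClass

open OrderClass

theorem dom_of_le {c d : OrderClass I} (h : c ≤ d) : Dom (rep c) (rep d) := by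
  rw [← mk_out c, ← mk_out d, mk_le_mk] at h
  exact h.dom

theorem le_of_dom (hI : ∀ ε ∈ I, 0 < ε) {c d : OrderClass I} (h : Dom (rep c) (rep d)) :
    c ≤ d := by
  rw [← mk_out c, ← mk_out d, mk_le_mk]
  exact Dom.precsim hI h

theorem rep_mk_dom (f : I → unitInterval) : Dom (rep (mk f)) (fun ε => (f ε : ℝ)) := by
  have : mk (out (OrderClass.mk f)) ≤ mk f := (mk_out (mk f)).le
  exact Precsim.dom (mk_le_mk.1 this)

theorem dom_rep_mk (f : I → unitInterval) : Dom (fun ε => (f ε : ℝ)) (rep (mk f)) := by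
  have : mk f ≤ mk (out (OrderClass.mk f)) := (mk_out (mk f)).ge
  exact Precsim.dom (mk_le_mk.1 this)

theorem rep_mul_dom (c d : OrderClass I) : Dom (rep (c * d)) (fun ε => rep c ε * rep d ε) := by
  have h := rep_mk_dom (out c * out d)
  rwa [← mk_mul_mk, mk_out, mk_out] at h

theorem dom_rep_mul (c d : OrderClass I) : Dom (fun ε => rep c ε * rep d ε) (rep (c * d)) := by
  have h := dom_rep_mk (out c * out d)
  rwa [← mk_mul_mk, mk_out, mk_out] at h

/-- Maximum and sum agree up to a factor `2`; the sum is the form that suits flows. -/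
theorem rep_sup_dom (c d : OrderClass I) : Dom (rep (c ⊔ d)) (fun ε => rep c ε + rep d ε) := by
  have h := rep_mk_dom (out c ⊔ out d)
  rw [← mk_sup_mk, mk_out, mk_out] at h
  obtain ⟨b, hb, h⟩ := h
  refine ⟨b, hb, h.mono fun ε h => h.trans (mul_le_mul_of_nonneg_left ?_ (by linarith))⟩
  change ((out c ⊔ out d) ε : ℝ) ≤ rep c ε + rep d ε
  have h1 := rep_nonneg c ε
  have h2 := rep_nonneg d ε
  rcases le_total (out c ε) (out d ε) with hl | hl
  · have : (out c ⊔ out d) ε = out d ε := sup_eq_right.2 hl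
    rw [this]; change rep d ε ≤ _; linarith
  · have : (out c ⊔ out d) ε = out c ε := sup_eq_left.2 hl
    rw [this]; change rep c ε ≤ _; linarith

theorem rep_zero : ∀ᶠ ε in toZero I, rep (0 : OrderClass I) ε = 0 := by
  obtain ⟨b, -, h⟩ := rep_mk_dom (0 : I → unitInterval)
  refine h.mono fun ε h => le_antisymm ?_ (rep_nonneg _ _)
  change rep (OrderClass.mk 0) ε ≤ 0
  simpa using h

theorem rep_one : ∃ b : ℝ, 1 ≤ b ∧ ∀ᶠ ε in toZero I, 1 ≤ b * rep (1 : OrderClass I) ε := by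
  obtain ⟨b, hb, h⟩ := dom_rep_mk (1 : I → unitInterval)
  exact ⟨b, hb, h.mono fun ε h => by
    change 1 ≤ b * rep (OrderClass.mk 1) ε
    simpa using h⟩

/-- A class is `1` as soon as a representative is eventually bounded away from `0`. A class other
than `1` need not tend to `0`, so smallness along some sequence is the most that can be had. -/
theorem frequently_rep_lt (hI : ∀ ε ∈ I, 0 < ε) {c : OrderClass I} (hc : c ≠ 1) {η : ℝ}
    (hη : 0 < η) : ∃ᶠ ε in toZero I, rep c ε < η := by
  intro h
  apply hc
  refine eq_one_of_le (le_of_dom hI ⟨max 1 η⁻¹, le_max_left _ _, h.mono fun ε h => ?_⟩)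
  have h' : η ≤ rep c ε := not_lt.1 h
  calc rep 1 ε ≤ 1 := rep_le_one _ _
    _ = η⁻¹ * η := (inv_mul_cancel₀ hη.ne').symm
    _ ≤ max 1 η⁻¹ * rep c ε := mul_le_mul (le_max_right _ _) h' hη.le (by positivity)

theorem ordDiv_of_zero {f g : I → unitInterval} {ε : I} (h : (g ε : ℝ) = 0) :
    ordDiv f g ε = 1 := if_neg (by rw [h]; exact lt_irrefl _)

theorem ordDiv_of_pos {f g : I → unitInterval} {ε : I} (h : 0 < (g ε : ℝ)) :
    (ordDiv f g ε : ℝ) = min 1 ((f ε : ℝ) / (g ε : ℝ)) := by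
  simp only [ordDiv, if_pos h]

/-- Near `0`, the representative of `c ÷ M` is bounded from below where that of `M` vanishes, and
is comparable to the quotient of the representatives elsewhere. -/
theorem rep_div {c M : OrderClass I} (h : c ≤ M) : ∃ b : ℝ, 1 ≤ b ∧ ∀ᶠ ε in toZero I,
    (rep M ε = 0 → 1 ≤ b * rep (c / M) ε) ∧
    rep c ε ≤ b * (rep M ε * rep (c / M) ε) ∧ rep M ε * rep (c / M) ε ≤ b * rep c ε := by
  obtain ⟨b₁, hb₁, h₁⟩ := dom_of_le h
  have hq : mk (ordDiv (out c) (out M)) = c / M := by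
    rw [← mk_div_mk, mk_out, mk_out]
  obtain ⟨b₂, hb₂, h₂⟩ := rep_mk_dom (ordDiv (out c) (out M))
  obtain ⟨b₃, hb₃, h₃⟩ := dom_rep_mk (ordDiv (out c) (out M))
  rw [hq] at h₂ h₃
  have hb : b₁ ≤ b₁ * b₂ * b₃ := by
    have := one_le_mul_of_one_le_of_one_le hb₂ hb₃
    nlinarith
  have hb' : b₂ ≤ b₁ * b₂ * b₃ := by
    have := one_le_mul_of_one_le_of_one_le hb₁ hb₃
    nlinarith
  have hb'' : b₃ ≤ b₁ * b₂ * b₃ := by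
    have := one_le_mul_of_one_le_of_one_le hb₁ hb₂
    nlinarith
  refine ⟨b₁ * b₂ * b₃, hb₁.trans hb, ?_⟩
  filter_upwards [h₁, h₂, h₃] with ε h₁ h₂ h₃
  have hc0 := rep_nonneg c ε
  have hr0 := rep_nonneg (c / M) ε
  rcases (rep_nonneg M ε).eq_or_lt with h0 | h0
  · rw [ordDiv_of_zero h0.symm] at h₃
    refine ⟨fun _ => ?_, ?_, ?_⟩
    · calc (1 : ℝ) ≤ b₃ * rep (c / M) ε := by simpa using h₃
        _ ≤ _ := mul_le_mul_of_nonneg_right hb'' hr0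
    · rw [← h0] at h₁ ⊢; simpa using h₁
    · rw [← h0, zero_mul]; positivity
  · have h0' : 0 < ((out M ε : unitInterval) : ℝ) := h0
    rw [ordDiv_of_pos h0'] at h₂ h₃
    change rep (c / M) ε ≤ b₂ * min 1 (rep c ε / rep M ε) at h₂
    change min 1 (rep c ε / rep M ε) ≤ b₃ * rep (c / M) ε at h₃
    refine ⟨fun h => absurd h h0.ne', ?_, ?_⟩
    · have : rep c ε / rep M ε ≤ b₁ * min 1 (rep c ε / rep M ε) := by
        have h4 : rep c ε / rep M ε ≤ b₁ := by rwa [div_le_iff₀ h0]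
        have h5 : 0 ≤ rep c ε / rep M ε := by positivity
        rcases min_cases 1 (rep c ε / rep M ε) with ⟨h, -⟩ | ⟨h, -⟩ <;> rw [h] <;> nlinarith
      calc rep c ε = rep M ε * (rep c ε / rep M ε) := by field_simp
        _ ≤ rep M ε * (b₁ * (b₃ * rep (c / M) ε)) := by gcongr; exact this.trans (by gcongr)
        _ = b₁ * 1 * b₃ * (rep M ε * rep (c / M) ε) := by ring
        _ ≤ _ := by gcongr
    · calc rep M ε * rep (c / M) ε ≤ rep M ε * (b₂ * (rep c ε / rep M ε)) := by
            gcongr; exact h₂.trans (by gcongr; exact min_le_right _ _)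
        _ = b₂ * rep c ε := by field_simp
        _ ≤ _ := by gcongr

/-- Near `0`, `c` vanishes wherever `M` does because `c ≤ M`, so the value `1` of the quotient at
the zeros of `M` does no harm. -/
theorem div_mul_cancel_of_le (hI : ∀ ε ∈ I, 0 < ε) {c M : OrderClass I} (h : c ≤ M) :
    c / M * M = c := by
  obtain ⟨b, hb, h⟩ := rep_div h
  obtain ⟨b₁, hb₁, h₁⟩ := rep_mul_dom (c / M) M
  obtain ⟨b₂, hb₂, h₂⟩ := dom_rep_mul (c / M) M
  apply le_antisymm
  · refine le_of_dom hI ⟨b₁ * b, one_le_mul_of_one_le_of_one_le hb₁ hb, ?_⟩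
    filter_upwards [h, h₁] with ε h h₁
    calc _ ≤ b₁ * (rep (c / M) ε * rep M ε) := h₁
      _ ≤ b₁ * (b * rep c ε) :=
        mul_le_mul_of_nonneg_left (by linarith [h.2.2]) (by linarith)
      _ = _ := by ring
  · refine le_of_dom hI ⟨b * b₂, one_le_mul_of_one_le_of_one_le hb hb₂, ?_⟩
    filter_upwards [h, h₂] with ε h h₂
    calc _ ≤ b * (rep (c / M) ε * rep M ε) := by linarith [h.2.1]
      _ ≤ b * (b₂ * rep (c / M * M) ε) := by gcongr
      _ = _ := by ring

theorem le_div_self (c M : OrderClass I) : c ≤ c / M := by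
  have h : c ≤ c / 1 := by
    induction c using Quotient.inductionOn with | _ f
    refine Precsim.of_le fun ε => ?_
    have h1 : (ordDiv f 1 ε : ℝ) = min 1 ((f ε : ℝ) / ((1 : I → unitInterval) ε : ℝ)) :=
      ordDiv_of_pos (by simp)
    have : ((f ε : ℝ)) ≤ ordDiv f 1 ε := by
      rw [h1]; simpa using (f ε).2.2
    exact this
  exact h.trans (div_le_div le_rfl (le_one M))

/-- The convention at the zeros of the denominator makes this true for every `M`. It is the source
of all arcs of weight `1`: a maximal arc becomes one. -/
theorem div_self_eq_one (M : OrderClass I) : M / M = 1 := by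
  apply eq_one_of_le
  induction M using Quotient.inductionOn with | _ f
  refine Precsim.of_le fun ε => ?_
  have : (1 : ℝ) ≤ ordDiv f f ε := by
    rcases (f ε).2.1.eq_or_lt with h | h
    · rw [ordDiv_of_zero h.symm]; simp
    · rw [ordDiv_of_pos h, div_self h.ne', min_self]
  exact this

/-- Cancellation of a factor `M` against a class that does not vanish where `M` does. -/
theorem le_of_mul_le_mul_of_zero_div_le (hI : ∀ ε ∈ I, 0 < ε) {c d M : OrderClass I}
    (h : c * M ≤ d * M) (hd : 0 / M ≤ d) : c ≤ d := by
  obtain ⟨b, hb, h⟩ := dom_of_le h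
  obtain ⟨b₁, hb₁, h₁⟩ := dom_rep_mul c M
  obtain ⟨b₂, hb₂, h₂⟩ := rep_mul_dom d M
  obtain ⟨b₃, hb₃, h₃⟩ := dom_of_le hd
  obtain ⟨b₄, hb₄, h₄⟩ := rep_div (zero_le M)
  refine le_of_dom hI ⟨(b₁ * b * b₂) * (b₄ * b₃), ?_, ?_⟩
  · exact one_le_mul_of_one_le_of_one_le (one_le_mul_of_one_le_of_one_le
      (one_le_mul_of_one_le_of_one_le hb₁ hb) hb₂) (one_le_mul_of_one_le_of_one_le hb₄ hb₃)
  filter_upwards [h, h₁, h₂, h₃, h₄] with ε h h₁ h₂ h₃ h₄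
  have hA : 1 ≤ b₁ * b * b₂ :=
    one_le_mul_of_one_le_of_one_le (one_le_mul_of_one_le_of_one_le hb₁ hb) hb₂
  have hB : 1 ≤ b₄ * b₃ := one_le_mul_of_one_le_of_one_le hb₄ hb₃
  have hd0 := rep_nonneg d ε
  -- Where `M` vanishes, `h` says nothing. There `0 / M` is bounded from below, hence so is `d`,
  -- while `c` is at most `1`.
  rcases (rep_nonneg M ε).eq_or_lt with h0 | h0
  · calc rep c ε ≤ 1 := rep_le_one _ _
      _ ≤ b₄ * rep (0 / M) ε := h₄.1 h0.symm
      _ ≤ b₄ * (b₃ * rep d ε) := by gcongr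
      _ = 1 * (b₄ * b₃) * rep d ε := by ring
      _ ≤ _ := by gcongr
  · have : rep c ε * rep M ε ≤ (b₁ * b * b₂ * rep d ε) * rep M ε := by
      calc rep c ε * rep M ε ≤ b₁ * rep (c * M) ε := h₁
        _ ≤ b₁ * (b * rep (d * M) ε) := by gcongr
        _ ≤ b₁ * (b * (b₂ * (rep d ε * rep M ε))) := by gcongr
        _ = _ := by ring
    calc rep c ε ≤ b₁ * b * b₂ * rep d ε := le_of_mul_le_mul_right this h0
      _ = b₁ * b * b₂ * 1 * rep d ε := by ring
      _ ≤ _ := by gcongr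

theorem OrderClass.mk_pow (f : I → unitInterval) (k : ℕ) :
    OrderClass.mk f ^ k = OrderClass.mk (f ^ k) := by
  induction k with
  | zero => rfl
  | succ k ih => rw [pow_succ, pow_succ, ih, mk_mul_mk]

/-- The class `0 / M` is that of the indicator function of the zero set of `M`. Positive powers of
`M` have the same zero set, and for `k = 0` the left side is `0`. Being the class of an indicator,
`0 / M` is also idempotent, which is used below. -/
theorem zero_div_pow_le (M : OrderClass I) (k : ℕ) : 0 / M ^ k ≤ 0 / M := by
  rw [← mk_out M, mk_pow]
  refine (Precsim.of_le fun ε => ?_ : Precsim (ordDiv 0 (out M ^ k)) (ordDiv 0 (out M)))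
  rcases (out M ε).2.1.eq_or_lt with h | h
  · rw [ordDiv_of_zero h.symm]
    exact (ordDiv 0 (out M ^ k) ε).2.2
  · have : ordDiv 0 (out M ^ k) ε = 0 := by
      refine Subtype.ext ?_
      rw [ordDiv_of_pos (by simpa using pow_pos h k)]
      simp
    rw [this]
    exact (ordDiv 0 (out M) ε).2.1

theorem zero_div_mul_self (M : OrderClass I) : 0 / M ≤ 0 / M * (0 / M) := by
  rw [← mk_out M]
  refine (Precsim.of_le fun ε => ?_ :
    Precsim (ordDiv 0 (out M)) (ordDiv 0 (out M) * ordDiv 0 (out M)))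
  change ordDiv 0 (out M) ε ≤ ordDiv 0 (out M) ε * ordDiv 0 (out M) ε
  rcases (out M ε).2.1.eq_or_lt with h | h
  · rw [ordDiv_of_zero h.symm, mul_one]
  · have : ordDiv 0 (out M) ε = 0 := Subtype.ext (by rw [ordDiv_of_pos h]; simp)
    rw [this, mul_zero]

/-! ### Totally ordered submonoids of classes -/

/-- `Γ` contains `0` and `1`, is closed under multiplication, and is totally ordered. -/
structure IsTotalMonoid (Γ : Set (OrderClass I)) : Prop where
  zero_mem : 0 ∈ Γ
  one_mem : 1 ∈ Γ
  mul_mem : ∀ {a b}, a ∈ Γ → b ∈ Γ → a * b ∈ Γ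
  total : ∀ {a b}, a ∈ Γ → b ∈ Γ → a ≤ b ∨ b ≤ a

namespace IsTotalMonoid

variable {Γ : Set (OrderClass I)}

theorem sup_eq (h : IsTotalMonoid Γ) {a b : OrderClass I} (ha : a ∈ Γ) (hb : b ∈ Γ) :
    a ⊔ b = a ∨ a ⊔ b = b := by
  rcases h.total ha hb with hl | hl
  · exact Or.inr (sup_eq_right.2 hl)
  · exact Or.inl (sup_eq_left.2 hl)

theorem sup_mem (h : IsTotalMonoid Γ) {a b : OrderClass I} (ha : a ∈ Γ) (hb : b ∈ Γ) :
    a ⊔ b ∈ Γ := by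
  rcases h.sup_eq ha hb with he | he <;> rwa [he]

theorem pow_mem (h : IsTotalMonoid Γ) {a : OrderClass I} (ha : a ∈ Γ) (k : ℕ) : a ^ k ∈ Γ := by
  induction k with
  | zero => rw [pow_zero]; exact h.one_mem
  | succ k ih => rw [pow_succ]; exact h.mul_mem ih ha

theorem finset_sup_mem (h : IsTotalMonoid Γ) {ι : Type*} {s : Finset ι} {f : ι → OrderClass I}
    (hf : ∀ i ∈ s, f i ∈ Γ) : s.sup f ∈ Γ := by
  classical
  induction s using Finset.induction_on with
  | empty => exact h.zero_mem
  | insert i s hi ih =>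
    rw [Finset.sup_insert]
    exact h.sup_mem (hf i (Finset.mem_insert_self _ _))
      (ih fun j hj => hf j (Finset.mem_insert_of_mem hj))

theorem exists_max (h : IsTotalMonoid Γ) {ι : Type*} {s : Finset ι} {f : ι → OrderClass I}
    (hf : ∀ i ∈ s, f i ∈ Γ) (hs : s.Nonempty) : ∃ i ∈ s, ∀ j ∈ s, f j ≤ f i := by
  classical
  induction s using Finset.induction_on with
  | empty => exact absurd hs Finset.not_nonempty_empty
  | insert i s hi ih =>
    have hi' := hf i (Finset.mem_insert_self _ _)
    rcases s.eq_empty_or_nonempty with rfl | hs'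
    · exact ⟨i, Finset.mem_insert_self _ _, by simp⟩
    · obtain ⟨k, hk, hmax⟩ := ih (fun j hj => hf j (Finset.mem_insert_of_mem hj)) hs'
      rcases h.total hi' (hf k (Finset.mem_insert_of_mem hk)) with hl | hl
      · refine ⟨k, Finset.mem_insert_of_mem hk, fun j hj => ?_⟩
        rcases Finset.mem_insert.1 hj with rfl | hj
        exacts [hl, hmax j hj]
      · refine ⟨i, Finset.mem_insert_self _ _, fun j hj => ?_⟩
        rcases Finset.mem_insert.1 hj with rfl | hj
        exacts [le_rfl, (hmax j hj).trans hl]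

/-- Dividing by `M` leads from a totally ordered monoid of classes to another one. -/
theorem exists_div (hI : ∀ ε ∈ I, 0 < ε) (h : IsTotalMonoid Γ) {M : OrderClass I} (hM : M ∈ Γ) :
    ∃ Γ' : Set (OrderClass I), IsTotalMonoid Γ' ∧ ∀ a ∈ Γ, a ≤ M → a / M ∈ Γ' := by
  -- Besides `0`, the new monoid consists of the classes that a power of `M` brings back into `Γ`.
  -- The bound `0 / M ≤ c` makes powers of `M` cancellable, so two such classes can be compared in
  -- `Γ` after multiplication by a common power.
  refine ⟨{c | c = 0 ∨ (0 / M ≤ c ∧ ∃ k : ℕ, c * M ^ k ∈ Γ)}, ⟨Or.inl rfl, ?_, ?_, ?_⟩, ?_⟩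
  · exact Or.inr ⟨le_one _, 0, by simpa using h.one_mem⟩
  · rintro a b (rfl | ⟨ha, k, hk⟩) (rfl | ⟨hb, l, hl⟩)
    · exact Or.inl (by simp)
    · exact Or.inl (by simp)
    · exact Or.inl (by simp)
    · refine Or.inr ⟨(zero_div_mul_self M).trans (mul_le_mul' ha hb), k + l, ?_⟩
      rw [pow_add, mul_mul_mul_comm]
      exact h.mul_mem hk hl
  · rintro a b (rfl | ⟨ha, k, hk⟩) (rfl | ⟨hb, l, hl⟩)
    · exact Or.inl le_rfl
    · exact Or.inl (zero_le _)
    · exact Or.inr (zero_le _)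
    · have e₁ : a * M ^ (k + l) = a * M ^ k * M ^ l := by rw [pow_add, mul_assoc]
      have e₂ : b * M ^ (k + l) = b * M ^ l * M ^ k := by rw [add_comm, pow_add, mul_assoc]
      have := h.total (h.mul_mem hk (h.pow_mem hM l)) (h.mul_mem hl (h.pow_mem hM k))
      rw [← e₁, ← e₂] at this
      refine this.imp (fun H => ?_) (fun H => ?_)
      · exact le_of_mul_le_mul_of_zero_div_le hI H ((zero_div_pow_le M _).trans hb)
      · exact le_of_mul_le_mul_of_zero_div_le hI H ((zero_div_pow_le M _).trans ha)
  · intro a ha hle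
    refine Or.inr ⟨div_le_div (zero_le a) le_rfl, 1, ?_⟩
    rwa [pow_one, div_mul_cancel_of_le hI hle]

end IsTotalMonoid

/-- The classes of the transition maps of a comparable perturbation lie in a totally ordered
monoid. -/
theorem Perturbation.Comparable.exists_total {S : Type*} [Fintype S] [DecidableEq S]
    {p : Perturbation I S} (hp : p.Comparable) :
    ∃ Γ : Set (OrderClass I), IsTotalMonoid Γ ∧ ∀ x y, x ≠ y → p.classes x y ∈ Γ := by
  set G := Subsemigroup.closure {f : I → unitInterval | ∃ x y : S, x ≠ y ∧ f = p.entry x y}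
  refine ⟨{c | c = 0 ∨ c = 1 ∨ ∃ f ∈ G, c = OrderClass.mk f},
    ⟨Or.inl rfl, Or.inr (Or.inl rfl), ?_, ?_⟩, ?_⟩
  · rintro a b (rfl | rfl | ⟨f, hf, rfl⟩) (rfl | rfl | ⟨g, hg, rfl⟩)
    · simp
    · simp
    · simp
    · simp
    · simp
    · rw [one_mul]; exact Or.inr (Or.inr ⟨g, hg, rfl⟩)
    · simp
    · rw [mul_one]; exact Or.inr (Or.inr ⟨f, hf, rfl⟩)
    · exact Or.inr (Or.inr ⟨f * g, mul_mem hf hg, rfl⟩)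
  · rintro a b (rfl | rfl | ⟨f, hf, rfl⟩) hb
    · exact Or.inl (zero_le _)
    · exact Or.inr (le_one _)
    · rcases hb with (rfl | rfl | ⟨g, hg, rfl⟩)
      · exact Or.inr (zero_le _)
      · exact Or.inl (le_one _)
      · exact hp f hf g hg
  · exact fun x y hxy => Or.inr (Or.inr ⟨_, Subsemigroup.subset_closure ⟨x, y, hxy, rfl⟩, rfl⟩)

end Classes

end StochStab

namespace StochStab

open OrderClass

/-! ### Circulations with prescribed orders of magnitude -/

section Flow

variable {α : Type*}

/-- `φ` is a circulation on `V`, and between distinct vertices it agrees up to the factor `c` with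
the flow that a chain with rates `w x y + δ` and mass distribution `ν` has. -/
structure IsFlow (V : Finset α) (w : α → α → ℝ) (δ c : ℝ) (ν : α → ℝ) (φ : α → α → ℝ) : Prop where
  nonneg : ∀ x ∈ V, 0 ≤ ν x
  balance : ∀ y ∈ V, ∑ x ∈ V, φ x y = ∑ x ∈ V, φ y x
  lower : ∀ x ∈ V, ∀ y ∈ V, x ≠ y → ν x * (w x y + δ) ≤ c * φ x y
  upper : ∀ x ∈ V, ∀ y ∈ V, x ≠ y → φ x y ≤ c * (ν x * (w x y + δ))

namespace IsFlow

variable {V : Finset α} {w w' : α → α → ℝ} {δ c : ℝ} {ν : α → ℝ} {φ : α → α → ℝ}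

theorem flow_nonneg (h : IsFlow V w δ c ν φ) (hc : 0 < c) (hδ : 0 ≤ δ)
    (hw : ∀ x y, 0 ≤ w x y) {x y : α} (hx : x ∈ V) (hy : y ∈ V) (hxy : x ≠ y) : 0 ≤ φ x y := by
  have h1 := h.lower x hx y hy hxy
  have h2 : 0 ≤ ν x * (w x y + δ) := mul_nonneg (h.nonneg x hx) (add_nonneg (hw x y) hδ)
  exact nonneg_of_mul_nonneg_right (h2.trans h1) hc

theorem sum_nonneg (h : IsFlow V w δ c ν φ) : 0 ≤ ∑ x ∈ V, ν x := Finset.sum_nonneg h.nonneg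

/-- The flow may be compared with other weights. -/
theorem mono_weight (h : IsFlow V w δ c ν φ) {b : ℝ} (hb : 1 ≤ b) (hc : 0 < c) (hδ : 0 ≤ δ)
    (h₁ : ∀ x ∈ V, ∀ y ∈ V, x ≠ y → w x y ≤ b * w' x y)
    (h₂ : ∀ x ∈ V, ∀ y ∈ V, x ≠ y → w' x y ≤ b * w x y) : IsFlow V w' δ (b * c) ν φ where
  nonneg := h.nonneg
  balance := h.balance
  lower x hx y hy hxy := by
    have hν := h.nonneg x hx
    calc ν x * (w' x y + δ) ≤ ν x * (b * w x y + b * δ) := by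
          gcongr
          · exact h₂ x hx y hy hxy
          · nlinarith
      _ = b * (ν x * (w x y + δ)) := by ring
      _ ≤ b * (c * φ x y) := mul_le_mul_of_nonneg_left (h.lower x hx y hy hxy) (by linarith)
      _ = _ := by ring
  upper x hx y hy hxy := by
    have hν := h.nonneg x hx
    calc φ x y ≤ c * (ν x * (w x y + δ)) := h.upper x hx y hy hxy
      _ ≤ c * (ν x * (b * w' x y + b * δ)) := by
          gcongr
          · exact h₁ x hx y hy hxy
          · nlinarith
      _ = _ := by ring

theorem div_const (h : IsFlow V w δ c ν φ) {M : ℝ} (hM : 0 < M) :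
    IsFlow V (fun x y => w x y / M) (δ / M) c ν (fun x y => φ x y / M) where
  nonneg := h.nonneg
  balance y hy := by rw [← Finset.sum_div, ← Finset.sum_div, h.balance y hy]
  lower x hx y hy hxy := by
    have := div_le_div_of_nonneg_right (h.lower x hx y hy hxy) hM.le
    calc _ = ν x * (w x y + δ) / M := by ring
      _ ≤ _ := this
      _ = _ := by ring
  upper x hx y hy hxy := by
    have := div_le_div_of_nonneg_right (h.upper x hx y hy hxy) hM.le
    calc φ x y / M ≤ _ := this
      _ = _ := by ring

section DecidableEq

variable [DecidableEq α]

/-- A loop counts as both inflow and outflow and cancels. It has to be removed because `IsFlow`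
bounds `φ` off the diagonal only. -/
theorem balance_erase (h : IsFlow V w δ c ν φ) {y : α} (hy : y ∈ V) :
    ∑ x ∈ V.erase y, φ x y = ∑ x ∈ V.erase y, φ y x := by
  have h1 := h.balance y hy
  rw [← Finset.add_sum_erase V _ hy, ← Finset.add_sum_erase V (fun x => φ y x) hy] at h1
  linarith

/-- Flow in and out of a set of vertices. -/
theorem balance_cut (h : IsFlow V w δ c ν φ) {A : Finset α} (hA : A ⊆ V) :
    ∑ x ∈ A, ∑ y ∈ V \ A, φ x y = ∑ x ∈ A, ∑ y ∈ V \ A, φ y x := by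
  have h1 : ∑ x ∈ A, ∑ y ∈ V, φ x y = ∑ x ∈ A, ∑ y ∈ V, φ y x :=
    Finset.sum_congr rfl fun x hx => (h.balance x (hA hx)).symm
  have h2 : ∑ x ∈ A, ∑ y ∈ A, φ x y = ∑ x ∈ A, ∑ y ∈ A, φ y x := Finset.sum_comm
  simp only [← Finset.sum_sdiff hA, Finset.sum_add_distrib] at h1
  linarith

/-- An arc whose weight is bounded from below bounds the mass at its source. -/
theorem mass_le (h : IsFlow V w δ c ν φ) (hc : 1 ≤ c) (hδ : 0 ≤ δ) (hδ1 : δ ≤ 1)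
    (hw : ∀ x y, 0 ≤ w x y) (hw1 : ∀ x y, w x y ≤ 1) {x y : α} (hx : x ∈ V) (hy : y ∈ V)
    (hxy : x ≠ y) {b : ℝ} (hb : 1 ≤ b) (hwb : 1 ≤ b * w x y) :
    ν x ≤ 2 * b * c ^ 2 * V.card * ν y := by
  have hc0 : 0 < c := by linarith
  have hνx := h.nonneg x hx
  have hνy := h.nonneg y hy
  have h1 : ν x ≤ b * (ν x * (w x y + δ)) := by
    calc ν x = ν x * 1 := (mul_one _).symm
      _ ≤ ν x * (b * w x y) := by gcongr
      _ ≤ ν x * (b * (w x y + δ)) := by gcongr; linarith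
      _ = _ := by ring
  -- What enters `y` must leave it, and the outflow of `y` is at most a constant times its mass,
  -- each rate `w y u + δ` being at most `2`.
  have h2 : φ x y ≤ ∑ u ∈ V.erase y, φ u y :=
    Finset.single_le_sum (f := fun u => φ u y)
      (fun u hu => h.flow_nonneg hc0 hδ hw (Finset.mem_of_mem_erase hu) hy
        (Finset.ne_of_mem_erase hu)) (Finset.mem_erase.2 ⟨hxy, hx⟩)
  have h3 : ∑ u ∈ V.erase y, φ y u ≤ ∑ u ∈ V.erase y, 2 * c * ν y := by
    refine Finset.sum_le_sum fun u hu => ?_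
    calc φ y u ≤ c * (ν y * (w y u + δ)) :=
          h.upper y hy u (Finset.mem_of_mem_erase hu) (Finset.ne_of_mem_erase hu).symm
      _ ≤ c * (ν y * (1 + 1)) := by gcongr; exact hw1 y u
      _ = _ := by ring
  have h4 : ∑ u ∈ V.erase y, 2 * c * ν y ≤ V.card * (2 * c * ν y) := by
    rw [Finset.sum_const, nsmul_eq_mul]
    gcongr
    exact Finset.erase_subset _ _
  calc ν x ≤ b * (c * φ x y) := 
        h1.trans (mul_le_mul_of_nonneg_left (h.lower x hx y hy hxy) (by linarith))
    _ ≤ b * (c * (V.card * (2 * c * ν y))) := by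
        gcongr
        exact h2.trans ((h.balance_erase hy).le.trans (h3.trans h4))
    _ = _ := by ring

/-- When all weights vanish, the mass is spread evenly. -/
theorem sum_le_of_weight_zero (h : IsFlow V w δ c ν φ) (hc : 1 ≤ c) (hδ : 0 < δ)
    (hw : ∀ x ∈ V, ∀ y ∈ V, x ≠ y → w x y = 0) {a : α} (ha : a ∈ V) :
    ∑ x ∈ V, ν x ≤ (c ^ 2 * V.card + 1) * ν a := by
  have hνa := h.nonneg a ha
  -- The inflow of `a` is of order `δ` times the mass elsewhere and its outflow at most of order `δ`
  -- times its own mass; `δ` cancels between the two.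
  have h1 : δ * ∑ x ∈ V.erase a, ν x ≤ c * ∑ x ∈ V.erase a, φ x a := by
    rw [Finset.mul_sum, Finset.mul_sum]
    refine Finset.sum_le_sum fun x hx => ?_
    have hx' := Finset.mem_of_mem_erase hx
    have := h.lower x hx' a ha (Finset.ne_of_mem_erase hx)
    rw [hw x hx' a ha (Finset.ne_of_mem_erase hx)] at this
    linarith
  have h2 : ∑ x ∈ V.erase a, φ a x ≤ ∑ x ∈ V.erase a, c * (ν a * δ) := by
    refine Finset.sum_le_sum fun x hx => ?_
    have hx' := Finset.mem_of_mem_erase hx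
    have := h.upper a ha x hx' (Finset.ne_of_mem_erase hx).symm
    rw [hw a ha x hx' (Finset.ne_of_mem_erase hx).symm] at this
    linarith
  have h3 : ∑ x ∈ V.erase a, c * (ν a * δ) ≤ V.card * (c * (ν a * δ)) := by
    rw [Finset.sum_const, nsmul_eq_mul]
    gcongr
    exact Finset.erase_subset _ _
  have h4 : δ * ∑ x ∈ V.erase a, ν x ≤ δ * (c ^ 2 * V.card * ν a) := by
    calc _ ≤ c * ∑ x ∈ V.erase a, φ x a := h1
      _ ≤ c * (V.card * (c * (ν a * δ))) := by
          gcongr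
          exact (h.balance_erase ha).le.trans (h2.trans h3)
      _ = _ := by ring
  have h5 := le_of_mul_le_mul_left h4 hδ
  rw [← Finset.add_sum_erase V _ ha]
  linarith

/-- Elimination of a vertex `z` with an outgoing arc whose weight is bounded from below. -/
theorem eliminate (h : IsFlow V w δ c ν φ) (hc : 1 ≤ c) (hδ : 0 ≤ δ) (hδ1 : δ ≤ 1)
    (hw : ∀ x y, 0 ≤ w x y) (hw1 : ∀ x y, w x y ≤ 1) (hw' : ∀ x y, 0 ≤ w' x y)
    {z y₀ : α} (hz : z ∈ V) (hy₀ : y₀ ∈ V) (hzy : z ≠ y₀) {b : ℝ} (hb : 1 ≤ b)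
    (hwb : 1 ≤ b * w z y₀)
    (h₁ : ∀ x ∈ V.erase z, ∀ y ∈ V.erase z, x ≠ y → w x y ≤ b * w' x y)
    (h₂ : ∀ x ∈ V.erase z, ∀ y ∈ V.erase z, x ≠ y → w x z * w z y ≤ b * w' x y)
    (h₃ : ∀ x ∈ V.erase z, ∀ y ∈ V.erase z, x ≠ y → w' x y ≤ b * (w x y + w x z * w z y)) :
    ∃ φ', IsFlow (V.erase z) w' δ (4 * V.card * b ^ 2 * c ^ 3) ν φ' := by
  have hc0 : 0 < c := by linarith
  have hb0 : 0 < b := by linarith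
  have hn : (1 : ℝ) ≤ V.card := by exact_mod_cast Finset.card_pos.2 ⟨z, hz⟩
  have hνz := h.nonneg z hz
  have hf0 : ∀ {x y}, x ∈ V → y ∈ V → x ≠ y → 0 ≤ φ x y := fun hx hy hxy =>
    h.flow_nonneg hc0 hδ hw hx hy hxy
  -- The throughput `Φ` of `z` is comparable to `ν z`: the arc to `y₀` bounds it from below, and
  -- rates of at most `2` bound it from above.
  set Φ := ∑ y ∈ V.erase z, φ z y with hΦ
  have hin : ∑ x ∈ V.erase z, φ x z = Φ := h.balance_erase hz
  have hout_le : ∀ y ∈ V.erase z, φ z y ≤ Φ := fun y hy =>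
    Finset.single_le_sum (f := fun y => φ z y)
      (fun u hu => hf0 hz (Finset.mem_of_mem_erase hu) (Finset.ne_of_mem_erase hu).symm) hy
  have hin_le : ∀ x ∈ V.erase z, φ x z ≤ Φ := fun x hx => by
    rw [← hin]
    exact Finset.single_le_sum (f := fun x => φ x z)
      (fun u hu => hf0 (Finset.mem_of_mem_erase hu) hz (Finset.ne_of_mem_erase hu)) hx
  have hΦlow : ν z ≤ b * c * Φ := by
    calc ν z = ν z * 1 := (mul_one _).symm
      _ ≤ ν z * (b * w z y₀) := by gcongr
      _ ≤ ν z * (b * (w z y₀ + δ)) := by gcongr; linarith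
      _ = b * (ν z * (w z y₀ + δ)) := by ring
      _ ≤ b * (c * φ z y₀) := mul_le_mul_of_nonneg_left (h.lower z hz y₀ hy₀ hzy) hb0.le
      _ ≤ b * (c * Φ) := by gcongr; exact hout_le y₀ (Finset.mem_erase.2 ⟨hzy.symm, hy₀⟩)
      _ = _ := by ring
  have hΦup : Φ ≤ 2 * c * V.card * ν z := by
    calc Φ ≤ ∑ y ∈ V.erase z, 2 * c * ν z := by
          refine Finset.sum_le_sum fun u hu => ?_
          calc φ z u ≤ c * (ν z * (w z u + δ)) :=
                h.upper z hz u (Finset.mem_of_mem_erase hu) (Finset.ne_of_mem_erase hu).symm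
            _ ≤ c * (ν z * (1 + 1)) := by gcongr; exact hw1 z u
            _ = _ := by ring
      _ ≤ V.card * (2 * c * ν z) := by
          rw [Finset.sum_const, nsmul_eq_mul]
          gcongr
          exact Finset.erase_subset _ _
      _ = _ := by ring
  have hΦ0 : 0 ≤ Φ := Finset.sum_nonneg fun u hu =>
    hf0 hz (Finset.mem_of_mem_erase hu) (Finset.ne_of_mem_erase hu).symm
  -- The flow that `z` receives from `x` is distributed among the arcs leaving `z` in proportion to
  -- their flow. Since `Φ` is comparable to `ν z`, the added term is of order `ν x * w x z * w z y`,
  -- up to the background. If `Φ = 0`, no flow passes through `z`, and division by `0` gives the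
  -- right value.
  refine ⟨fun x y => φ x y + φ x z * φ z y / Φ, ?_, ?_, ?_, ?_⟩
  · exact fun x hx => h.nonneg x (Finset.mem_of_mem_erase hx)
  · intro y hy
    have hyV := Finset.mem_of_mem_erase hy
    have e1 : ∑ x ∈ V.erase z, φ x z * φ z y / Φ = φ z y := by
      rw [← Finset.sum_div, ← Finset.sum_mul, hin]
      rcases hΦ0.eq_or_lt with h0 | h0
      · have := hout_le y hy
        have h' := hf0 hz hyV (Finset.ne_of_mem_erase hy).symm
        rw [← h0]; simp; linarith
      · field_simp
    have e2 : ∑ x ∈ V.erase z, φ y z * φ z x / Φ = φ y z := by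
      rw [← Finset.sum_div, ← Finset.mul_sum, ← hΦ]
      rcases hΦ0.eq_or_lt with h0 | h0
      · have := hin_le y hy
        have h' := hf0 hyV hz (Finset.ne_of_mem_erase hy)
        rw [← h0]; simp; linarith
      · field_simp
    rw [Finset.sum_add_distrib, Finset.sum_add_distrib, e1, e2, Finset.sum_erase_add _ _ hz,
      Finset.sum_erase_add _ _ hz]
    exact h.balance y hyV
  · intro x hx y hy hxy
    have hxV := Finset.mem_of_mem_erase hx
    have hyV := Finset.mem_of_mem_erase hy
    have hxz := Finset.ne_of_mem_erase hx
    have hzy := (Finset.ne_of_mem_erase hy).symm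
    have hνx := h.nonneg x hxV
    have f1 := hf0 hxV hyV hxy
    have f2 := hf0 hxV hz hxz
    have f3 := hf0 hz hyV hzy
    have key : ν x * (w x z * w z y) ≤ 2 * c ^ 3 * V.card * (φ x z * φ z y / Φ) := by
      have g1 : ν x * w x z ≤ c * φ x z :=
        le_trans (by gcongr; linarith) (h.lower x hxV z hz hxz)
      have g2 : ν z * w z y ≤ c * φ z y :=
        le_trans (by gcongr; linarith) (h.lower z hz y hyV hzy)
      rcases hΦ0.eq_or_lt with h0 | h0
      · have : φ x z = 0 := le_antisymm (h0 ▸ hin_le x hx) f2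
        rw [← h0]
        rw [this] at g1
        have := hw z y
        have h'' : ν x * w x z = 0 :=
          le_antisymm (by simpa using g1) (mul_nonneg hνx (hw x z))
        rw [← mul_assoc, h'']
        simp
      · rw [← mul_div_assoc, le_div_iff₀ h0]
        calc ν x * (w x z * w z y) * Φ ≤ ν x * (w x z * w z y) * (2 * c * V.card * ν z) := by
              have := hw x z
              have := hw z y
              gcongr
          _ = 2 * c * V.card * ((ν x * w x z) * (ν z * w z y)) := by ring
          _ ≤ 2 * c * V.card * ((c * φ x z) * (c * φ z y)) := by
              have := hw z y
              gcongr
          _ = _ := by ring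
    have f4 : 0 ≤ φ x z * φ z y / Φ := by positivity
    have hwxy := hw x y
    calc ν x * (w' x y + δ) ≤ ν x * (b * (w x y + w x z * w z y) + b * δ) := by
          gcongr
          · exact h₃ x hx y hy hxy
          · nlinarith
      _ = b * (ν x * (w x y + δ)) + b * (ν x * (w x z * w z y)) := by ring
      _ ≤ b * (c * φ x y) + b * (2 * c ^ 3 * V.card * (φ x z * φ z y / Φ)) := by
          exact add_le_add (mul_le_mul_of_nonneg_left (h.lower x hxV y hyV hxy) hb0.le)
            (mul_le_mul_of_nonneg_left key hb0.le)
      _ ≤ (4 * V.card * b ^ 2 * c ^ 3) * φ x y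
            + (4 * V.card * b ^ 2 * c ^ 3) * (φ x z * φ z y / Φ) := by
          have k1 : b * c ≤ 4 * V.card * b ^ 2 * c ^ 3 := by
            calc b * c = 1 * 1 * (b ^ 1 * c ^ 1) := by ring
              _ ≤ 4 * V.card * (b ^ 2 * c ^ 3) := by gcongr <;> norm_num
              _ = _ := by ring
          have k2 : b * (2 * c ^ 3 * V.card) ≤ 4 * V.card * b ^ 2 * c ^ 3 := by
            calc b * (2 * c ^ 3 * V.card) = 2 * V.card * b ^ 1 * c ^ 3 := by ring
              _ ≤ 4 * V.card * b ^ 2 * c ^ 3 := by gcongr <;> norm_num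
          have := mul_le_mul_of_nonneg_right k1 f1
          have := mul_le_mul_of_nonneg_right k2 f4
          linarith
      _ = _ := by ring
  · intro x hx y hy hxy
    have hxV := Finset.mem_of_mem_erase hx
    have hyV := Finset.mem_of_mem_erase hy
    have hxz := Finset.ne_of_mem_erase hx
    have hzy := (Finset.ne_of_mem_erase hy).symm
    have hνx := h.nonneg x hxV
    have f2 := hf0 hxV hz hxz
    have f3 := hf0 hz hyV hzy
    have wxz := hw x z
    have wzy := hw z y
    have wxy' := hw' x y
    have key : φ x z * φ z y / Φ ≤ b * c ^ 3 * (ν x * ((w x z + δ) * (w z y + δ))) := by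
      rcases hΦ0.eq_or_lt with h0 | h0
      · rw [← h0, div_zero]; positivity
      · rw [div_le_iff₀ h0]
        calc φ x z * φ z y ≤ (c * (ν x * (w x z + δ))) * (c * (ν z * (w z y + δ))) :=
              mul_le_mul (h.upper x hxV z hz hxz) (h.upper z hz y hyV hzy) f3 (by positivity)
          _ ≤ (c * (ν x * (w x z + δ))) * (c * ((b * c * Φ) * (w z y + δ))) := by gcongr
          _ = _ := by ring
    -- As `w` and `δ` are at most `1`, the terms of the product that contain `δ` add up to at most
    -- `3 * δ`, again a background of order `δ`.
    have key2 : (w x z + δ) * (w z y + δ) ≤ b * w' x y + 3 * δ := by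
      have := h₂ x hx y hy hxy
      have := hw1 x z
      have := hw1 z y
      nlinarith
    have k1 : c * b ≤ 1 * (b ^ 2 * c ^ 3) := by
      calc c * b = 1 * (b ^ 1 * c ^ 1) := by ring
        _ ≤ 1 * (b ^ 2 * c ^ 3) := by gcongr <;> norm_num
    calc φ x y + φ x z * φ z y / Φ
        ≤ c * (ν x * (b * w' x y + b * δ))
          + b * c ^ 3 * (ν x * (3 * b * w' x y + 3 * b * δ)) := by
          refine add_le_add ((h.upper x hxV y hyV hxy).trans ?_) (key.trans ?_)
          · gcongr
            · exact h₁ x hx y hy hxy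
            · nlinarith
          · gcongr
            refine key2.trans (add_le_add ?_ ?_) <;> nlinarith [mul_nonneg hb0.le wxy']
      _ = (c * b + 3 * (b ^ 2 * c ^ 3)) * (ν x * (w' x y + δ)) := by ring
      _ ≤ (4 * V.card * b ^ 2 * c ^ 3) * (ν x * (w' x y + δ)) := by
          gcongr
          calc c * b + 3 * (b ^ 2 * c ^ 3) ≤ 4 * 1 * (b ^ 2 * c ^ 3) := by linarith
            _ ≤ 4 * V.card * (b ^ 2 * c ^ 3) := by gcongr
            _ = _ := by ring

end DecidableEq

end IsFlow

end Flow

end StochStab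

namespace StochStab

open OrderClass

/-! ### Vertex sets that a family of circulations charges -/

section Correct

variable {I : Set ℝ} {α : Type*}

/-- There are finitely many pairs and each condition is monotone in its constant, so the largest
constant serves all of them. -/
theorem exists_uniform_pairs (V : Finset α) {R : α → α → ℝ → I → Prop}
    (hR : ∀ x y b b' ε, b ≤ b' → R x y b ε → R x y b' ε)
    (h : ∀ x ∈ V, ∀ y ∈ V, x ≠ y → ∃ b : ℝ, 1 ≤ b ∧ ∀ᶠ ε in toZero I, R x y b ε) :
    ∃ b : ℝ, 1 ≤ b ∧ ∀ᶠ ε in toZero I, ∀ x ∈ V, ∀ y ∈ V, x ≠ y → R x y b ε := by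
  classical
  have key : ∀ s : Finset (α × α), (∀ e ∈ s, ∃ b : ℝ, 1 ≤ b ∧ ∀ᶠ ε in toZero I, R e.1 e.2 b ε) →
      ∃ b : ℝ, 1 ≤ b ∧ ∀ᶠ ε in toZero I, ∀ e ∈ s, R e.1 e.2 b ε := by
    intro s
    induction s using Finset.induction_on with
    | empty => exact fun _ => ⟨1, le_rfl, by simp⟩
    | insert e s he ih =>
      intro hs
      obtain ⟨b, hb, h1⟩ := ih fun e he => hs e (Finset.mem_insert_of_mem he)
      obtain ⟨b', hb', h2⟩ := hs e (Finset.mem_insert_self _ _)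
      refine ⟨max b b', le_max_of_le_left hb, ?_⟩
      filter_upwards [h1, h2] with ε h1 h2 j hj
      rcases Finset.mem_insert.1 hj with rfl | hj
      · exact hR _ _ _ _ _ (le_max_right _ _) h2
      · exact hR _ _ _ _ _ (le_max_left _ _) (h1 j hj)
  obtain ⟨b, hb, h'⟩ := key V.offDiag fun e he => by
    obtain ⟨h1, h2, h3⟩ := Finset.mem_offDiag.1 he
    exact h _ h1 _ h2 h3
  exact ⟨b, hb, h'.mono fun ε h' x hx y hy hxy => h' (x, y) (Finset.mem_offDiag.2 ⟨hx, hy, hxy⟩)⟩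

/-- The weights at `ε` of a matrix of classes. -/
noncomputable def wt (P : α → α → OrderClass I) (ε : I) (x y : α) : ℝ := rep (P x y) ε

theorem wt_nonneg (P : α → α → OrderClass I) (ε : I) (x y : α) : 0 ≤ wt P ε x y := rep_nonneg _ _

theorem wt_le_one (P : α → α → OrderClass I) (ε : I) (x y : α) : wt P ε x y ≤ 1 := rep_le_one _ _

theorem dom_pairs (V : Finset α) {P Q : α → α → OrderClass I}
    (h : ∀ x ∈ V, ∀ y ∈ V, x ≠ y → P x y ≤ Q x y) :
    ∃ b : ℝ, 1 ≤ b ∧ ∀ᶠ ε in toZero I, ∀ x ∈ V, ∀ y ∈ V, x ≠ y → wt P ε x y ≤ b * wt Q ε x y := by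
  refine exists_uniform_pairs V (fun x y b b' ε hbb hb => ?_) fun x hx y hy hxy =>
    dom_of_le (h x hx y hy hxy)
  exact hb.trans (mul_le_mul_of_nonneg_right hbb (wt_nonneg _ _ _ _))

/-- `H` is the set of the vertices that carry a non-vanishing part of the mass, for circulations
on `V` with rates of the orders `P`: with a small positive background rate `δ` they always do, and
the other vertices lose their mass along some sequence of parameters tending to `0`, even if
there is no background rate. -/
structure Correct (V : Finset α) (P : α → α → OrderClass I) (H : Finset α) : Prop where
  subset : H ⊆ V
  -- The bound `κ` is uniform in `ε`, but `δ₀` may depend on `ε`: the background has to be small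
  -- compared with the actual rates, and it tends to `0` with `ε` fixed.
  sound : ∀ a ∈ H, ∀ c : ℝ, 1 ≤ c → ∃ κ : ℝ, 0 < κ ∧ ∀ᶠ ε in toZero I, ∃ δ₀ : ℝ, 0 < δ₀ ∧
    ∀ δ, 0 < δ → δ ≤ δ₀ → ∀ ν φ, IsFlow V (wt P ε) δ c ν φ → κ * ∑ x ∈ V, ν x ≤ ν a
  -- The arc of small weight is there for `Correct.of_div`: it excludes the parameters at which `M`
  -- vanishes, where all divided weights are bounded from below and do not reflect the original
  -- ones.
  complete : ∀ a ∈ V, a ∉ H → ∀ c : ℝ, 1 ≤ c → ∀ η : ℝ, 0 < η → ∀ κ : ℝ, 0 < κ →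
    ∃ᶠ ε in toZero I, (∃ x ∈ V, ∃ y ∈ V, x ≠ y ∧ wt P ε x y < κ) ∧
      ∀ ν φ, IsFlow V (wt P ε) 0 c ν φ → ν a ≤ η * ∑ x ∈ V, ν x
  -- Needed in `Correct.of_eliminate`, where the flow out of the charged set has to be small.
  closed : ∀ x ∈ H, ∀ y ∈ V, y ∉ H → P x y ≠ 1

/-- Near `0` only the background rate is left, which is the same on all arcs and spreads the mass
evenly. With every vertex charged, the remaining conditions are void. -/
theorem Correct.of_zero (V : Finset α) {P : α → α → OrderClass I}
    (hP : ∀ x ∈ V, ∀ y ∈ V, x ≠ y → P x y = 0) : Correct V P V := by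
  classical
  refine ⟨subset_rfl, fun a ha c hc => ?_, fun a ha ha' => absurd ha ha',
    fun x _ y hy hy' => absurd hy hy'⟩
  refine ⟨(c ^ 2 * V.card + 1)⁻¹, by positivity, ?_⟩
  filter_upwards [rep_zero (I := I)] with ε hε
  refine ⟨1, one_pos, fun δ hδ _ ν φ h => ?_⟩
  rw [inv_mul_le_iff₀ (by positivity)]
  refine h.sum_le_of_weight_zero hc hδ (fun x hx y hy hxy => ?_) ha
  rw [wt, hP x hx y hy hxy, hε]

/-- Outgoing scaling. -/
theorem Correct.of_div {V : Finset α} {P P' : α → α → OrderClass I} {H : Finset α}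
    {M : OrderClass I} (hM : ∀ x ∈ V, ∀ y ∈ V, x ≠ y → P x y ≤ M)
    (hP' : ∀ x ∈ V, ∀ y ∈ V, x ≠ y → P' x y = P x y / M) (h : Correct V P' H) :
    Correct V P H := by
  classical
  obtain ⟨b, hb, hdiv⟩ : ∃ b : ℝ, 1 ≤ b ∧ ∀ᶠ ε in toZero I, ∀ x ∈ V, ∀ y ∈ V, x ≠ y →
      ((rep M ε = 0 → 1 ≤ b * wt P' ε x y) ∧
      wt P ε x y ≤ b * (rep M ε * wt P' ε x y) ∧ rep M ε * wt P' ε x y ≤ b * wt P ε x y) := by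
    refine exists_uniform_pairs V (fun x y b b' ε hbb h' => ?_) fun x hx y hy hxy => ?_
    · have h1 := wt_nonneg P ε x y
      have h2 := wt_nonneg P' ε x y
      have h3 := rep_nonneg M ε
      refine ⟨fun h0 => (h'.1 h0).trans ?_, h'.2.1.trans ?_, h'.2.2.trans ?_⟩ <;> gcongr
    · simp only [wt, hP' x hx y hy hxy]
      exact rep_div (hM x hx y hy hxy)
  have hflow : ∀ {ε δ c ν φ}, 1 ≤ c → 0 ≤ δ → 0 < rep M ε → (∀ x ∈ V, ∀ y ∈ V, x ≠ y →
      ((rep M ε = 0 → 1 ≤ b * wt P' ε x y) ∧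
      wt P ε x y ≤ b * (rep M ε * wt P' ε x y) ∧ rep M ε * wt P' ε x y ≤ b * wt P ε x y)) →
      IsFlow V (wt P ε) δ c ν φ →
      IsFlow V (wt P' ε) (δ / rep M ε) (b * c) ν (fun x y => φ x y / rep M ε) := by
    intro ε δ c ν φ hc hδ hM0 hε hf
    refine (hf.div_const hM0).mono_weight hb (by linarith) (by positivity) ?_ ?_
    · intro x hx y hy hxy
      rw [div_le_iff₀ hM0]
      linarith [(hε x hx y hy hxy).2.1]
    · intro x hx y hy hxy
      rw [← mul_div_assoc, le_div_iff₀ hM0]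
      linarith [(hε x hx y hy hxy).2.2]
  refine ⟨h.subset, fun a ha c hc => ?_, fun a ha ha' c hc η hη κ hκ => ?_,
    fun x hx y hy hy' h1 => h.closed x hx y hy hy' ?_⟩
  · obtain ⟨κ, hκ, hs⟩ := h.sound a ha (b * c) (one_le_mul_of_one_le_of_one_le hb hc)
    refine ⟨min κ (c ^ 2 * V.card + 1)⁻¹, lt_min hκ (by positivity), ?_⟩
    filter_upwards [hdiv, hs] with ε hε ⟨δ₀, hδ₀, hs⟩
    -- At a parameter where `M` vanishes so do all weights, and the background alone spreads the
    -- mass. Elsewhere division turns the background `δ` into `δ / rep M ε`, which accounts for the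
    -- new `δ₀`.
    rcases (rep_nonneg M ε).eq_or_lt with h0 | h0
    · refine ⟨1, one_pos, fun δ hδ _ ν φ hf => ?_⟩
      refine (mul_le_mul_of_nonneg_right (min_le_right _ _) hf.sum_nonneg).trans ?_
      rw [inv_mul_le_iff₀ (by positivity)]
      refine hf.sum_le_of_weight_zero hc hδ (fun x hx y hy hxy => ?_) (h.subset ha)
      have := (hε x hx y hy hxy).2.1
      rw [← h0] at this
      exact le_antisymm (by simpa using this) (wt_nonneg _ _ _ _)
    · refine ⟨rep M ε * δ₀, by positivity, fun δ hδ hδ' ν φ hf => ?_⟩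
      refine (mul_le_mul_of_nonneg_right (min_le_left _ _) hf.sum_nonneg).trans ?_
      exact hs _ (by positivity) (by rw [div_le_iff₀ h0]; linarith) ν _ (hflow hc hδ.le h0 hε hf)
  -- A weight below `b⁻¹` cannot occur where `M` vanishes; a weight below `κ / b` stays below `κ`
  -- when passing back from `P'` to `P`.
  · have := h.complete a ha ha' (b * c) (one_le_mul_of_one_le_of_one_le hb hc) η hη
      (min b⁻¹ (κ / b)) (by positivity)
    refine (this.and_eventually hdiv).mono ?_
    rintro ε ⟨⟨⟨x, hx, y, hy, hxy, hlt⟩, hs⟩, hε⟩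
    have h0 : 0 < rep M ε := by
      refine (rep_nonneg M ε).lt_of_ne' fun h0 => ?_
      have h1 := (hε x hx y hy hxy).1 h0
      have h2 := hlt.trans_le (min_le_left _ _)
      rw [← one_div, lt_div_iff₀' (by linarith)] at h2
      linarith
    refine ⟨⟨x, hx, y, hy, hxy, ?_⟩, fun ν φ hf => ?_⟩
    · have h2 := hlt.trans_le (min_le_right _ _)
      rw [lt_div_iff₀ (by linarith)] at h2
      calc wt P ε x y ≤ b * (rep M ε * wt P' ε x y) := (hε x hx y hy hxy).2.1
        _ ≤ b * (1 * wt P' ε x y) := by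
            have := wt_nonneg P' ε x y
            have := rep_le_one M ε
            gcongr
        _ < κ := by linarith
    · have := hflow hc le_rfl h0 hε hf
      rw [zero_div] at this
      exact hs ν _ this
  · have hxy : x ≠ y := fun e => hy' (e ▸ hx)
    rw [hP' x (h.subset hx) y hy hxy]
    exact eq_one_of_le (h1 ▸ le_div_self (P x y) M)

theorem rep_of_one {c : OrderClass I} (hc : c = 1) :
    ∃ b : ℝ, 1 ≤ b ∧ ∀ᶠ ε in toZero I, 1 ≤ b * rep c ε := hc ▸ rep_one

/-- Elimination of a vertex with an outgoing arc of weight `1`. -/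
theorem Correct.of_eliminate [DecidableEq α] (hI : ∀ ε ∈ I, 0 < ε) {Γ : Set (OrderClass I)}
    (hΓ : IsTotalMonoid Γ) {V : Finset α} {P P' : α → α → OrderClass I} {H H' : Finset α}
    {z y₀ : α} (hz : z ∈ V) (hy₀ : y₀ ∈ V) (hzy : z ≠ y₀) (hone : P z y₀ = 1)
    (hPΓ : ∀ x ∈ V, ∀ y ∈ V, x ≠ y → P x y ∈ Γ)
    (hP' : ∀ x ∈ V.erase z, ∀ y ∈ V.erase z, x ≠ y → P' x y = P x y ⊔ P x z * P z y)
    (hH : ∀ a, a ∈ H ↔ a ∈ H' ∨ (a = z ∧ ∃ x ∈ H', P x z = 1))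
    (h : Correct (V.erase z) P' H') : Correct V P H := by
  have hsub : V.erase z ⊆ V := Finset.erase_subset _ _
  have hy₀' : y₀ ∈ V.erase z := Finset.mem_erase.2 ⟨hzy.symm, hy₀⟩
  have hH'V : H' ⊆ V := h.subset.trans hsub
  have hzH' : z ∉ H' := fun hc => Finset.ne_of_mem_erase (h.subset hc) rfl
  obtain ⟨b₀, hb₀, hb₀e⟩ := rep_of_one hone
  obtain ⟨b₁, hb₁, hb₁e⟩ := dom_pairs (V.erase z) (P := P) (Q := P')
    fun x hx y hy hxy => by rw [hP' x hx y hy hxy]; exact le_sup_left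
  obtain ⟨b₂, hb₂, hb₂e⟩ : ∃ b : ℝ, 1 ≤ b ∧ ∀ᶠ ε in toZero I, ∀ x ∈ V.erase z, ∀ y ∈ V.erase z,
      x ≠ y → wt P ε x z * wt P ε z y ≤ b * wt P' ε x y := by
    refine exists_uniform_pairs _ (fun x y b b' ε hbb hb => ?_) fun x hx y hy hxy => ?_
    · exact hb.trans (mul_le_mul_of_nonneg_right hbb (wt_nonneg _ _ _ _))
    · obtain ⟨b, hb, h1⟩ := dom_rep_mul (P x z) (P z y)
      obtain ⟨b', hb', h2⟩ := dom_of_le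
        (le_sup_right.trans (hP' x hx y hy hxy).ge : P x z * P z y ≤ P' x y)
      refine ⟨b * b', one_le_mul_of_one_le_of_one_le hb hb', ?_⟩
      filter_upwards [h1, h2] with ε h1 h2
      calc _ ≤ b * rep (P x z * P z y) ε := h1
        _ ≤ b * (b' * rep (P' x y) ε) := by gcongr
        _ = b * b' * wt P' ε x y := (mul_assoc _ _ _).symm
  obtain ⟨b₃, hb₃, hb₃e⟩ : ∃ b : ℝ, 1 ≤ b ∧ ∀ᶠ ε in toZero I, ∀ x ∈ V.erase z, ∀ y ∈ V.erase z,
      x ≠ y → wt P' ε x y ≤ b * (wt P ε x y + wt P ε x z * wt P ε z y) := by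
    refine exists_uniform_pairs _ (fun x y b b' ε hbb hb => ?_) fun x hx y hy hxy => ?_
    · have h1 := wt_nonneg P ε x y
      have h2 := wt_nonneg P ε x z
      have h3 := wt_nonneg P ε z y
      exact hb.trans (mul_le_mul_of_nonneg_right hbb (by positivity))
    · obtain ⟨b, hb, h1⟩ := rep_sup_dom (P x y) (P x z * P z y)
      obtain ⟨b', hb', h2⟩ := rep_mul_dom (P x z) (P z y)
      refine ⟨b * b', one_le_mul_of_one_le_of_one_le hb hb', ?_⟩
      filter_upwards [h1, h2] with ε h1 h2
      have h3 := rep_nonneg (P x y) ε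
      simp only [wt, hP' x hx y hy hxy]
      calc _ ≤ b * (rep (P x y) ε + rep (P x z * P z y) ε) := h1
        _ ≤ b * (b' * rep (P x y) ε + b' * (rep (P x z) ε * rep (P z y) ε)) := by
            gcongr
            nlinarith
        _ = _ := by ring
  set b := max (max b₀ b₁) (max b₂ b₃) with hbdef
  have hb0 : b₀ ≤ b := (le_max_left _ _).trans (le_max_left _ _)
  have hb : 1 ≤ b := hb₀.trans hb0
  set K : ℝ → ℝ := fun c => 2 * b * c ^ 2 * V.card with hK
  have hK0 : ∀ c, 1 ≤ c → 0 ≤ K c := fun c hc => by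
    have : 0 ≤ b := by linarith
    positivity
  set D : ℝ → ℝ := fun c => 4 * V.card * b ^ 2 * c ^ 3 with hD
  have hD1 : ∀ c, 1 ≤ c → 1 ≤ D c := fun c hc => by
    have hn : (1 : ℝ) ≤ V.card := by exact_mod_cast Finset.card_pos.2 ⟨z, hz⟩
    calc (1 : ℝ) = 1 * 1 * 1 ^ 2 * 1 ^ 3 := by norm_num
      _ ≤ _ := by simp only [hD]; gcongr; norm_num
  -- the two facts about circulations used below
  have hpush : ∀ᶠ ε in toZero I, ∀ δ, 0 ≤ δ → δ ≤ 1 → ∀ c, 1 ≤ c → ∀ ν φ,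
      IsFlow V (wt P ε) δ c ν φ → (∃ φ', IsFlow (V.erase z) (wt P' ε) δ (D c) ν φ') ∧
        ν z ≤ K c * ν y₀ ∧ ∑ x ∈ V, ν x ≤ (K c + 1) * ∑ x ∈ V.erase z, ν x := by
    filter_upwards [hb₀e, hb₁e, hb₂e, hb₃e] with ε h₀ h₁ h₂ h₃ δ hδ hδ1 c hc ν φ hf
    have hwb : 1 ≤ b * wt P ε z y₀ :=
      h₀.trans (mul_le_mul_of_nonneg_right hb0 (rep_nonneg _ _))
    have hmass := hf.mass_le hc hδ hδ1 (wt_nonneg P ε) (wt_le_one P ε) hz hy₀ hzy hb hwb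
    refine ⟨hf.eliminate hc hδ hδ1 (wt_nonneg P ε) (wt_le_one P ε) (wt_nonneg P' ε) hz hy₀ hzy hb
      hwb (fun x hx y hy hxy => ?_) (fun x hx y hy hxy => ?_) (fun x hx y hy hxy => ?_), hmass, ?_⟩
    · refine (h₁ x hx y hy hxy).trans (mul_le_mul_of_nonneg_right ?_ (wt_nonneg _ _ _ _))
      exact (le_max_right _ _).trans (le_max_left _ _)
    · refine (h₂ x hx y hy hxy).trans (mul_le_mul_of_nonneg_right ?_ (wt_nonneg _ _ _ _))
      exact (le_max_left _ _).trans (le_max_right _ _)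
    · have h1 := wt_nonneg P ε x y
      have h2 := wt_nonneg P ε x z
      have h3 := wt_nonneg P ε z y
      refine (h₃ x hx y hy hxy).trans (mul_le_mul_of_nonneg_right ?_ (by positivity))
      exact (le_max_right _ _).trans (le_max_right _ _)
    · have hy : ν y₀ ≤ ∑ x ∈ V.erase z, ν x :=
        Finset.single_le_sum (fun x hx => hf.nonneg x (hsub hx)) hy₀'
      rw [← Finset.add_sum_erase V _ hz]
      have := mul_le_mul_of_nonneg_left hy (hK0 c hc)
      linarith
  have hsound : ∀ a ∈ H', ∀ c : ℝ, 1 ≤ c → ∃ κ : ℝ, 0 < κ ∧ ∀ᶠ ε in toZero I, ∃ δ₀ : ℝ, 0 < δ₀ ∧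
      δ₀ ≤ 1 ∧ ∀ δ, 0 < δ → δ ≤ δ₀ → ∀ ν φ, IsFlow V (wt P ε) δ c ν φ →
        κ * ∑ x ∈ V, ν x ≤ ν a := by
    intro a ha c hc
    obtain ⟨κ, hκ, hs⟩ := h.sound a ha (D c) (hD1 c hc)
    have hKp : 0 < K c + 1 := by linarith [hK0 c hc]
    refine ⟨κ / (K c + 1), by positivity, ?_⟩
    filter_upwards [hs, hpush] with ε ⟨δ₀, hδ₀, hs⟩ hpush
    refine ⟨min δ₀ 1, by positivity, min_le_right _ _, fun δ hδ hδ' ν φ hf => ?_⟩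
    obtain ⟨⟨φ', hf'⟩, -, hsum⟩ := hpush δ hδ.le (hδ'.trans (min_le_right _ _)) c hc ν φ hf
    refine le_trans ?_ (hs δ hδ (hδ'.trans (min_le_left _ _)) ν φ' hf')
    calc κ / (K c + 1) * ∑ x ∈ V, ν x ≤ κ / (K c + 1) * ((K c + 1) * ∑ x ∈ V.erase z, ν x) := by
          gcongr
      _ = _ := by field_simp
  have hHV : H ⊆ V := fun a ha => by
    rcases (hH a).1 ha with ha | ⟨rfl, -⟩
    exacts [hH'V ha, hz]
  have hclosed' : ∀ x ∈ H', ∀ y ∈ V.erase z, y ∉ H' → P x y ≠ 1 ∧ (P x z = 1 → P z y ≠ 1) := by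
    intro x hx y hy hy'
    have hxy : x ≠ y := fun e => hy' (e ▸ hx)
    have h1 := h.closed x hx y hy hy'
    rw [hP' x (h.subset hx) y hy hxy] at h1
    refine ⟨fun h2 => h1 (eq_one_of_le (h2 ▸ le_sup_left)), fun h2 h3 => h1 (eq_one_of_le ?_)⟩
    rw [h2, h3, one_mul]
    exact le_sup_right
  refine ⟨hHV, fun a ha c hc => ?_, fun a ha ha' c hc η hη κ hκ => ?_, fun x hx y hy hy' => ?_⟩
  · rcases (hH a).1 ha with ha | ⟨rfl, f, hf, hfz⟩
    · obtain ⟨κ, hκ, hs⟩ := hsound a ha c hc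
      exact ⟨κ, hκ, hs.mono fun ε ⟨δ₀, h1, _, h2⟩ => ⟨δ₀, h1, h2⟩⟩
    -- The mass of the charged vertex `f` bounds that of the eliminated vertex from below, along the
    -- arc of weight `1` between them.
    · obtain ⟨κ, hκ, hs⟩ := hsound f hf c hc
      obtain ⟨b', hb', hb'e⟩ := rep_of_one hfz
      have hn : (1 : ℝ) ≤ V.card := by exact_mod_cast Finset.card_pos.2 ⟨a, hz⟩
      have hpos : 0 < 2 * b' * c ^ 2 * V.card := by
        have : 0 < c := by linarith
        have : 0 < b' := by linarith
        positivity
      refine ⟨κ / (2 * b' * c ^ 2 * V.card), by positivity, ?_⟩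
      filter_upwards [hs, hb'e] with ε ⟨δ₀, hδ₀, hδ₁, hs⟩ hb'e
      refine ⟨δ₀, hδ₀, fun δ hδ hδ' ν φ hF => ?_⟩
      have hne : f ≠ a := Finset.ne_of_mem_erase (h.subset hf)
      have := hF.mass_le hc hδ.le (hδ'.trans hδ₁) (wt_nonneg P ε) (wt_le_one P ε) (hH'V hf) hz hne
        hb' hb'e
      rw [div_mul_eq_mul_div, div_le_iff₀ hpos]
      linarith [hs δ hδ hδ' ν φ hF]
  · have haH' : a ∉ H' := fun h' => ha' ((hH a).2 (Or.inl h'))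
    -- a vertex that stays
    have hstay : ∀ a ∈ V.erase z, a ∉ H' → ∀ η : ℝ, 0 < η → ∃ᶠ ε in toZero I,
        (∃ x ∈ V, ∃ y ∈ V, x ≠ y ∧ wt P ε x y < κ) ∧
        ∀ ν φ, IsFlow V (wt P ε) 0 c ν φ → ν a ≤ η * ∑ x ∈ V, ν x ∧ ν z ≤ K c * ν y₀ := by
      intro a ha ha' η hη
      have := h.complete a ha ha' (D c) (hD1 c hc) η hη (κ / b₁)
        (by have : 0 < b₁ := by linarith
            positivity)
      refine ((this.and_eventually hpush).and_eventually hb₁e).mono ?_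
      rintro ε ⟨⟨⟨⟨x, hx, y, hy, hxy, hlt⟩, hs⟩, hp⟩, h₁⟩
      refine ⟨⟨x, hsub hx, y, hsub hy, hxy, ?_⟩, fun ν φ hf => ?_⟩
      · rw [lt_div_iff₀ (by linarith)] at hlt
        linarith [h₁ x hx y hy hxy]
      · obtain ⟨⟨φ', hf'⟩, hm, -⟩ := hp 0 le_rfl zero_le_one c hc ν φ hf
        refine ⟨(hs ν φ' hf').trans (mul_le_mul_of_nonneg_left ?_ hη.le), hm⟩
        exact Finset.sum_le_sum_of_subset_of_nonneg hsub fun x hx _ => hf.nonneg x hx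
    by_cases haz : a = z
    · subst haz
      by_cases hy : y₀ ∈ H'
      -- The cut around `H'`: the eliminated vertex `a` sends a flow of the order of its mass into
      -- `H'` along the arc to `y₀`, so at least that much must leave `H'`. No arc leaving `H'` has
      -- weight `1`. By total ordering one of them, `(f, u)`, dominates all others, so along one
      -- sequence of parameters the whole outflow is a small part of the total mass.
      · have hnz : ∀ x ∈ H', P x a ≠ 1 := fun x hx h1 => ha' ((hH a).2 (Or.inr ⟨rfl, x, hx, h1⟩))
        have hprodΓ : ∀ e ∈ H' ×ˢ (V \ H'), P e.1 e.2 ∈ Γ := by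
          intro e he
          obtain ⟨h1, h2⟩ := Finset.mem_product.1 he
          obtain ⟨h2, h3⟩ := Finset.mem_sdiff.1 h2
          exact hPΓ _ (hH'V h1) _ h2 fun e => h3 (e ▸ h1)
        obtain ⟨⟨f, u⟩, hfu, hmax⟩ := hΓ.exists_max hprodΓ
          ⟨(y₀, a), Finset.mem_product.2 ⟨hy, Finset.mem_sdiff.2 ⟨hz, haH'⟩⟩⟩
        obtain ⟨hf, hu⟩ := Finset.mem_product.1 hfu
        obtain ⟨hu, hu'⟩ := Finset.mem_sdiff.1 hu
        simp only at hf hu hu'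
        have hfune : f ≠ u := fun e => hu' (e ▸ hf)
        have hfu1 : P f u ≠ 1 := by
          by_cases hua : u = a
          · exact hua ▸ hnz f hf
          · exact (hclosed' f hf u (Finset.mem_erase.2 ⟨hua, hu⟩) hu').1
        obtain ⟨b', hb', hb'e⟩ : ∃ b : ℝ, 1 ≤ b ∧ ∀ᶠ ε in toZero I, ∀ x ∈ V, ∀ y ∈ V, x ≠ y →
            x ∈ H' → y ∉ H' → wt P ε x y ≤ b * wt P ε f u := by
          refine exists_uniform_pairs V (fun x y b b' ε hbb hb h1 h2 => (hb h1 h2).trans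
            (mul_le_mul_of_nonneg_right hbb (wt_nonneg _ _ _ _))) fun x hx y hy hxy => ?_
          by_cases hxy' : x ∈ H' ∧ y ∉ H'
          · obtain ⟨b, hb, h1⟩ := dom_of_le (hmax (x, y)
              (Finset.mem_product.2 ⟨hxy'.1, Finset.mem_sdiff.2 ⟨hy, hxy'.2⟩⟩))
            exact ⟨b, hb, h1.mono fun ε h1 _ _ => h1⟩
          · exact ⟨1, le_rfl, Eventually.of_forall fun ε h1 h2 => absurd ⟨h1, h2⟩ hxy'⟩
        have hn : (1 : ℝ) ≤ V.card := by exact_mod_cast Finset.card_pos.2 ⟨a, hz⟩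
        have hc0 : 0 < c := by linarith
        have hb'0 : 0 < b' := by linarith
        have hb00 : 0 < b₀ := by linarith
        have hfreq := frequently_rep_lt hI hfu1
          (lt_min (by positivity : 0 < η / (b₀ * c ^ 2 * b' * V.card)) hκ)
        refine ((hfreq.and_eventually hb'e).and_eventually hb₀e).mono ?_
        rintro ε ⟨⟨hlt, h₁⟩, h₀⟩
        refine ⟨⟨f, hH'V hf, u, hu, hfune, hlt.trans_le (min_le_right _ _)⟩, fun ν φ hF => ?_⟩
        set S := ∑ x ∈ V, ν x
        have hcut := hF.balance_cut hH'V
        have hφ : φ a y₀ ≤ ∑ x ∈ H', ∑ y ∈ V \ H', φ y x := by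
          have hnn : ∀ x ∈ H', ∀ y ∈ V \ H', 0 ≤ φ y x := fun x hx y hy => by
            obtain ⟨h1, h2⟩ := Finset.mem_sdiff.1 hy
            exact hF.flow_nonneg hc0 le_rfl (wt_nonneg P ε) h1 (hH'V hx) fun e => h2 (e ▸ hx)
          refine le_trans ?_ (Finset.single_le_sum (f := fun x => ∑ y ∈ V \ H', φ y x)
            (fun x hx => Finset.sum_nonneg (hnn x hx)) hy)
          exact Finset.single_le_sum (f := fun y => φ y y₀) (hnn y₀ hy)
            (Finset.mem_sdiff.2 ⟨hz, haH'⟩)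
        have hfin : ∑ x ∈ H', ∑ y ∈ V \ H', φ x y ≤ c * b' * wt P ε f u * (V.card * S) := by
          calc ∑ x ∈ H', ∑ y ∈ V \ H', φ x y
              ≤ ∑ x ∈ H', ∑ y ∈ V \ H', c * b' * wt P ε f u * ν x := by
                refine Finset.sum_le_sum fun x hx => Finset.sum_le_sum fun y hy => ?_
                obtain ⟨h1, h2⟩ := Finset.mem_sdiff.1 hy
                have hxy : x ≠ y := fun e => h2 (e ▸ hx)
                have h3 := hF.nonneg x (hH'V hx)
                calc φ x y ≤ c * (ν x * (wt P ε x y + 0)) := hF.upper x (hH'V hx) y h1 hxy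
                  _ ≤ c * (ν x * (b' * wt P ε f u + 0)) := by
                      gcongr
                      exact h₁ x (hH'V hx) y h1 hxy hx h2
                  _ = _ := by ring
            _ = c * b' * wt P ε f u * ((V \ H').card * ∑ x ∈ H', ν x) := by
                simp only [Finset.sum_const, nsmul_eq_mul, ← Finset.mul_sum]
                ring
            _ ≤ _ := by
                have h1 := wt_nonneg P ε f u
                have h2 : 0 ≤ ∑ x ∈ H', ν x := Finset.sum_nonneg fun x hx => hF.nonneg x (hH'V hx)
                gcongr
                · exact Finset.sdiff_subset
                · exact Finset.sum_le_sum_of_subset_of_nonneg hH'V fun x hx _ => hF.nonneg x hx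
        have hS : 0 ≤ S := hF.sum_nonneg
        have hνa := hF.nonneg a hz
        have hlt' : wt P ε f u ≤ η / (b₀ * c ^ 2 * b' * V.card) :=
          (hlt.trans_le (min_le_left _ _)).le
        calc ν a = ν a * 1 := (mul_one _).symm
          _ ≤ ν a * (b₀ * wt P ε a y₀) := by gcongr; exact h₀
          _ = b₀ * (ν a * (wt P ε a y₀ + 0)) := by ring
          _ ≤ b₀ * (c * φ a y₀) :=
              mul_le_mul_of_nonneg_left (hF.lower a hz y₀ hy₀ hzy) hb00.le
          _ ≤ b₀ * (c * (c * b' * wt P ε f u * (V.card * S))) := by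
              gcongr
              exact hφ.trans (hcut.ge.trans hfin)
          _ ≤ b₀ * (c * (c * b' * (η / (b₀ * c ^ 2 * b' * V.card)) * (V.card * S))) := by gcongr
          _ = η * S := by
              have : (V.card : ℝ) ≠ 0 := by linarith
              field_simp
      -- Here `y₀` itself loses its mass, and the mass of the eliminated vertex is at most `K c`
      -- times that of `y₀`.
      · have hKp : 0 < K c + 1 := by linarith [hK0 c hc]
        refine (hstay y₀ hy₀' hy (η / (K c + 1)) (by positivity)).mono fun ε hε =>
          ⟨hε.1, fun ν φ hf => ?_⟩
        obtain ⟨h1, h2⟩ := hε.2 ν φ hf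
        have hS : 0 ≤ ∑ x ∈ V, ν x := hf.sum_nonneg
        calc ν a ≤ K c * ν y₀ := h2
          _ ≤ K c * (η / (K c + 1) * ∑ x ∈ V, ν x) := mul_le_mul_of_nonneg_left h1 (hK0 c hc)
          _ ≤ (K c + 1) * (η / (K c + 1) * ∑ x ∈ V, ν x) := by
              gcongr
              linarith
          _ = _ := by field_simp
    · exact (hstay a (Finset.mem_erase.2 ⟨haz, ha⟩) haH' η hη).mono fun ε hε =>
        ⟨hε.1, fun ν φ hf => (hε.2 ν φ hf).1⟩
  · have hy'' : y ∉ H' := fun h' => hy' ((hH y).2 (Or.inl h'))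
    rcases (hH x).1 hx with hx' | ⟨rfl, f, hf, hfz⟩
    · by_cases hyz : y = z
      · subst hyz
        exact fun h1 => hy' ((hH y).2 (Or.inr ⟨rfl, x, hx', h1⟩))
      · exact (hclosed' x hx' y (Finset.mem_erase.2 ⟨hyz, hy⟩) hy'').1
    · have hyx : y ≠ x := fun e => hy' (e ▸ hx)
      exact (hclosed' f hf y (Finset.mem_erase.2 ⟨hyx, hy⟩) hy'').2 hfz

end Correct

end StochStab

namespace StochStab

open OrderClass

/-! ### Merging vertices of comparable mass -/

section Merge

variable {I : Set ℝ} {α β : Type*} [DecidableEq β]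

/-- Merging the fibres of a map on which the mass is spread evenly. -/
theorem IsFlow.merge {V : Finset α} {w : α → α → ℝ} {w' : β → β → ℝ} {δ c b K : ℝ} {ν : α → ℝ}
    {φ : α → α → ℝ} {π : α → β} {W : Finset β} (h : IsFlow V w δ c ν φ) (hc : 1 ≤ c)
    (hδ : 0 ≤ δ) (hw : ∀ x y, 0 ≤ w x y) (hw' : ∀ i j, 0 ≤ w' i j) (hb : 1 ≤ b) (hK : 1 ≤ K)
    (hW : V.image π = W) (hν : ∀ x ∈ V, ∀ y ∈ V, π x = π y → ν x ≤ K * ν y)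
    (h₁ : ∀ x ∈ V, ∀ y ∈ V, π x ≠ π y → w x y ≤ b * w' (π x) (π y))
    (h₂ : ∀ i ∈ W, ∀ j ∈ W, i ≠ j → w' i j ≤ b * ∑ x ∈ V with π x = i, ∑ y ∈ V with π y = j, w x y) :
    IsFlow W w' δ (b * K * c * V.card) (fun i => ∑ x ∈ V with π x = i, ν x)
      (fun i j => ∑ x ∈ V with π x = i, ∑ y ∈ V with π y = j, φ x y) := by
  have hmaps : ∀ x ∈ V, π x ∈ W := fun x hx => hW ▸ Finset.mem_image_of_mem π hx
  have hc0 : 0 < c := by linarith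
  have hb0 : 0 < b := by linarith
  have hK0 : 0 < K := by linarith
  have hcard : ∀ i, ((V.filter fun x => π x = i).card : ℝ) ≤ V.card := fun i => by
    exact_mod_cast Finset.card_le_card (Finset.filter_subset _ _)
  have hne : ∀ i ∈ W, (V.filter fun x => π x = i).Nonempty := fun i hi => by
    rw [← hW] at hi
    obtain ⟨x, hx, rfl⟩ := Finset.mem_image.1 hi
    exact ⟨x, Finset.mem_filter.2 ⟨hx, rfl⟩⟩
  refine ⟨fun i _ => Finset.sum_nonneg fun x hx => h.nonneg x (Finset.mem_filter.1 hx).1, ?_, ?_, ?_⟩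
  · intro j _
    calc ∑ i ∈ W, ∑ x ∈ V with π x = i, ∑ y ∈ V with π y = j, φ x y
        = ∑ x ∈ V, ∑ y ∈ V with π y = j, φ x y := Finset.sum_fiberwise_of_maps_to hmaps _
      _ = ∑ y ∈ V with π y = j, ∑ x ∈ V, φ x y := Finset.sum_comm
      _ = ∑ y ∈ V with π y = j, ∑ x ∈ V, φ y x :=
          Finset.sum_congr rfl fun y hy => h.balance y (Finset.mem_filter.1 hy).1
      _ = ∑ y ∈ V with π y = j, ∑ i ∈ W, ∑ x ∈ V with π x = i, φ y x :=
          Finset.sum_congr rfl fun y _ => (Finset.sum_fiberwise_of_maps_to hmaps _).symm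
      _ = _ := Finset.sum_comm
  · intro i hi j hj hij
    -- Every single vertex of a fibre carries a fixed part of the mass of the fibre, so any arc
    -- leaving the fibre can be charged to the total.
    have hνi : ∀ x ∈ V.filter (fun x => π x = i),
        ∑ u ∈ V with π u = i, ν u ≤ V.card * K * ν x := by
      intro x hx
      obtain ⟨hxV, hxi⟩ := Finset.mem_filter.1 hx
      have hνx := h.nonneg x hxV
      calc ∑ u ∈ V with π u = i, ν u ≤ ∑ u ∈ V with π u = i, K * ν x := by
            refine Finset.sum_le_sum fun u hu => ?_
            obtain ⟨huV, hui⟩ := Finset.mem_filter.1 hu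
            exact hν u huV x hxV (hui.trans hxi.symm)
        _ = (V.filter fun x => π x = i).card * (K * ν x) := by
            rw [Finset.sum_const, nsmul_eq_mul]
        _ ≤ V.card * (K * ν x) := by gcongr; exact Finset.filter_subset _ _
        _ = _ := by ring
    set N := ∑ u ∈ V with π u = i, ν u
    have hN : 0 ≤ N := Finset.sum_nonneg fun x hx => h.nonneg x (Finset.mem_filter.1 hx).1
    -- The fibres are nonempty, so at least one pair contributes its background to the merged arc.
    have hδsum : δ ≤ ∑ x ∈ V with π x = i, ∑ y ∈ V with π y = j, δ := by
      obtain ⟨x, hx⟩ := hne i hi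
      obtain ⟨y, hy⟩ := hne j hj
      refine le_trans ?_ (Finset.single_le_sum (f := fun x => ∑ y ∈ V with π y = j, δ)
        (fun x _ => Finset.sum_nonneg fun _ _ => hδ) hx)
      exact Finset.single_le_sum (f := fun y => δ) (fun _ _ => hδ) hy
    calc N * (w' i j + δ)
        ≤ N * (b * (∑ x ∈ V with π x = i, ∑ y ∈ V with π y = j, w x y)
          + b * ∑ x ∈ V with π x = i, ∑ y ∈ V with π y = j, δ) := by
          refine mul_le_mul_of_nonneg_left (add_le_add (h₂ i hi j hj hij) ?_) hN
          nlinarith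
      _ = b * ∑ x ∈ V with π x = i, ∑ y ∈ V with π y = j, N * (w x y + δ) := by
          simp only [← Finset.mul_sum, Finset.sum_add_distrib]
          ring
      _ ≤ b * ∑ x ∈ V with π x = i, ∑ y ∈ V with π y = j, V.card * K * c * φ x y := by
          refine mul_le_mul_of_nonneg_left (Finset.sum_le_sum fun x hx => Finset.sum_le_sum
            fun y hy => ?_) hb0.le
          obtain ⟨hxV, hxi⟩ := Finset.mem_filter.1 hx
          obtain ⟨hyV, hyj⟩ := Finset.mem_filter.1 hy
          have hxy : x ≠ y := fun e => hij (by rw [← hxi, ← hyj, e])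
          calc N * (w x y + δ) ≤ V.card * K * ν x * (w x y + δ) :=
                mul_le_mul_of_nonneg_right (hνi x hx) (add_nonneg (hw x y) hδ)
            _ = V.card * K * (ν x * (w x y + δ)) := by ring
            _ ≤ V.card * K * (c * φ x y) :=
                mul_le_mul_of_nonneg_left (h.lower x hxV y hyV hxy) (by positivity)
            _ = _ := by ring
      _ = _ := by
          simp only [← Finset.mul_sum]
          ring
  · intro i hi j hj hij
    set N := ∑ u ∈ V with π u = i, ν u with hNdef
    have hN : 0 ≤ N := Finset.sum_nonneg fun x hx => h.nonneg x (Finset.mem_filter.1 hx).1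
    have hw'' := hw' i j
    calc ∑ x ∈ V with π x = i, ∑ y ∈ V with π y = j, φ x y
        ≤ ∑ x ∈ V with π x = i, ∑ y ∈ V with π y = j, c * b * (w' i j + δ) * ν x := by
          refine Finset.sum_le_sum fun x hx => Finset.sum_le_sum fun y hy => ?_
          obtain ⟨hxV, rfl⟩ := Finset.mem_filter.1 hx
          obtain ⟨hyV, rfl⟩ := Finset.mem_filter.1 hy
          have hxy : x ≠ y := fun e => hij (by rw [e])
          have hνx := h.nonneg x hxV
          calc φ x y ≤ c * (ν x * (w x y + δ)) := h.upper x hxV y hyV hxy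
            _ ≤ c * (ν x * (b * w' (π x) (π y) + b * δ)) := by
                gcongr
                · exact h₁ x hxV y hyV hij
                · nlinarith
            _ = _ := by ring
      _ = (V.filter fun y => π y = j).card * (c * b * (w' i j + δ)) * N := by
          simp only [Finset.sum_const, nsmul_eq_mul, ← Finset.mul_sum]
          ring
      _ ≤ V.card * (c * b * (w' i j + δ)) * N := by
          gcongr
          exact Finset.filter_subset _ _
      _ = 1 * (b * c * V.card * (N * (w' i j + δ))) := by ring
      _ ≤ K * (b * c * V.card * (N * (w' i j + δ))) := by gcongr
      _ = _ := by ring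

theorem rep_finset_sup_dom {ι : Type*} (s : Finset ι) (f : ι → OrderClass I) :
    Dom (rep (s.sup f)) (fun ε => ∑ i ∈ s, rep (f i) ε) := by
  classical
  induction s using Finset.induction_on with
  | empty => exact ⟨1, le_rfl, rep_zero.mono fun ε h => by simpa [bot_eq_zero] using h.le⟩
  | insert i s hi ih =>
    obtain ⟨b, hb, h1⟩ := ih
    obtain ⟨b', hb', h2⟩ := rep_sup_dom (f i) (s.sup f)
    refine ⟨b' * b, one_le_mul_of_one_le_of_one_le hb' hb, ?_⟩
    filter_upwards [h1, h2] with ε h1 h2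
    have h3 := rep_nonneg (f i) ε
    rw [Finset.sup_insert, Finset.sum_insert hi]
    calc _ ≤ b' * (rep (f i) ε + rep (s.sup f) ε) := h2
      _ ≤ b' * (b * rep (f i) ε + b * ∑ i ∈ s, rep (f i) ε) := by
          gcongr
          nlinarith
      _ = _ := by ring

/-- Along arcs of weight `1` the mass decreases at most by a constant factor. -/
theorem exists_mass_le {V : Finset α} {P : α → α → OrderClass I} {x y : α}
    (h : Relation.ReflTransGen (fun u v => u ∈ V ∧ v ∈ V ∧ u ≠ v ∧ P u v = 1) x y)
    {c : ℝ} (hc : 1 ≤ c) : ∃ K : ℝ, 1 ≤ K ∧ ∀ᶠ ε in toZero I, ∀ δ, 0 ≤ δ → δ ≤ 1 → ∀ ν φ,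
      IsFlow V (wt P ε) δ c ν φ → ν x ≤ K * ν y := by
  classical
  induction h with
  | refl => exact ⟨1, le_rfl, Eventually.of_forall fun ε δ _ _ ν φ _ => by simp⟩
  | @tail y z _ hyz ih =>
    obtain ⟨K, hK, ih⟩ := ih
    obtain ⟨hy, hz, hne, hone⟩ := hyz
    obtain ⟨b, hb, hbe⟩ := rep_of_one hone
    have hn : (1 : ℝ) ≤ V.card := by exact_mod_cast Finset.card_pos.2 ⟨z, hz⟩
    have hle : 1 ≤ 2 * b * c ^ 2 * V.card := by
      calc (1 : ℝ) = 1 * 1 * 1 ^ 2 * 1 := by norm_num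
        _ ≤ _ := by gcongr; norm_num
    refine ⟨K * (2 * b * c ^ 2 * V.card), one_le_mul_of_one_le_of_one_le hK hle, ?_⟩
    filter_upwards [ih, hbe] with ε ih hbe δ hδ hδ1 ν φ hf
    have h1 := hf.mass_le hc hδ hδ1 (wt_nonneg P ε) (wt_le_one P ε) hy hz hne hb hbe
    calc ν x ≤ K * ν y := ih δ hδ hδ1 ν φ hf
      _ ≤ K * (2 * b * c ^ 2 * V.card * ν z) := by gcongr
      _ = _ := by ring

/-- Merging sets of vertices that are strongly connected by arcs of weight `1`. -/
theorem Correct.of_merge {V : Finset α} {P : α → α → OrderClass I} {W H' : Finset β}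
    {Q : β → β → OrderClass I} {π : α → β} (hW : V.image π = W)
    (hQ : ∀ i ∈ W, ∀ j ∈ W, i ≠ j →
      Q i j = (V.filter (π · = i) ×ˢ V.filter (π · = j)).sup fun e => P e.1 e.2)
    (hconn : ∀ x ∈ V, ∀ y ∈ V, π x = π y →
      Relation.ReflTransGen (fun u v => u ∈ V ∧ v ∈ V ∧ u ≠ v ∧ P u v = 1) x y)
    (h : Correct W Q H') : Correct V P (V.filter (π · ∈ H')) := by
  have hmaps : ∀ x ∈ V, π x ∈ W := fun x hx => hW ▸ Finset.mem_image_of_mem π hx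
  have hle : ∀ x ∈ V, ∀ y ∈ V, π x ≠ π y → P x y ≤ Q (π x) (π y) := by
    intro x hx y hy hxy
    rw [hQ _ (hmaps x hx) _ (hmaps y hy) hxy]
    exact Finset.le_sup (f := fun e : α × α => P e.1 e.2) (b := (x, y))
      (Finset.mem_product.2 ⟨Finset.mem_filter.2 ⟨hx, rfl⟩, Finset.mem_filter.2 ⟨hy, rfl⟩⟩)
  obtain ⟨b₁, hb₁, hb₁e⟩ : ∃ b : ℝ, 1 ≤ b ∧ ∀ᶠ ε in toZero I, ∀ x ∈ V, ∀ y ∈ V, x ≠ y →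
      π x ≠ π y → wt P ε x y ≤ b * wt Q ε (π x) (π y) := by
    refine exists_uniform_pairs V (fun x y b b' ε hbb hb hxy => (hb hxy).trans
      (mul_le_mul_of_nonneg_right hbb (wt_nonneg _ _ _ _))) fun x hx y hy _ => ?_
    by_cases hxy : π x = π y
    · exact ⟨1, le_rfl, Eventually.of_forall fun ε h => absurd hxy h⟩
    · obtain ⟨b, hb, h1⟩ := dom_of_le (hle x hx y hy hxy)
      exact ⟨b, hb, h1.mono fun ε h1 _ => h1⟩
  obtain ⟨b₂, hb₂, hb₂e⟩ : ∃ b : ℝ, 1 ≤ b ∧ ∀ᶠ ε in toZero I, ∀ i ∈ W, ∀ j ∈ W, i ≠ j →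
      wt Q ε i j ≤ b * ∑ x ∈ V with π x = i, ∑ y ∈ V with π y = j, wt P ε x y := by
    refine exists_uniform_pairs W (fun x y b b' ε hbb hb => hb.trans
      (mul_le_mul_of_nonneg_right hbb (Finset.sum_nonneg fun _ _ => Finset.sum_nonneg fun _ _ =>
        wt_nonneg _ _ _ _))) fun i hi j hj hij => ?_
    simp only [wt, hQ i hi j hj hij]
    obtain ⟨b, hb, h1⟩ := rep_finset_sup_dom (V.filter (π · = i) ×ˢ V.filter (π · = j))
      fun e => P e.1 e.2
    refine ⟨b, hb, h1.mono fun ε h1 => ?_⟩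
    beta_reduce at h1
    rwa [Finset.sum_product] at h1
  set b := max b₁ b₂
  have hb : 1 ≤ b := le_max_of_le_left hb₁
  have hpush : ∀ c : ℝ, 1 ≤ c → ∃ K C : ℝ, 1 ≤ K ∧ 1 ≤ C ∧ ∀ᶠ ε in toZero I, ∀ δ, 0 ≤ δ → δ ≤ 1 →
      ∀ ν φ, IsFlow V (wt P ε) δ c ν φ →
        (V.Nonempty → ∃ φ', IsFlow W (wt Q ε) δ C (fun i => ∑ x ∈ V with π x = i, ν x) φ') ∧
        ∀ x ∈ V, ∀ y ∈ V, π x = π y → ν x ≤ K * ν y := by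
    intro c hc
    obtain ⟨K, hK, hKe⟩ : ∃ b : ℝ, 1 ≤ b ∧ ∀ᶠ ε in toZero I, ∀ x ∈ V, ∀ y ∈ V, x ≠ y →
        π x = π y → ∀ δ, 0 ≤ δ → δ ≤ 1 → ∀ ν φ, IsFlow V (wt P ε) δ c ν φ → ν x ≤ b * ν y := by
      have := exists_uniform_pairs (I := I) V (R := fun x y b ε => y ∈ V → π x = π y →
        ∀ δ, 0 ≤ δ → δ ≤ 1 → ∀ ν φ, IsFlow V (wt P ε) δ c ν φ → ν x ≤ b * ν y)
        (fun x y b b' ε hbb hb hy hxy δ hδ hδ1 ν φ hf => (hb hy hxy δ hδ hδ1 ν φ hf).trans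
          (mul_le_mul_of_nonneg_right hbb (hf.nonneg y hy))) fun x hx y hy _ => by
        by_cases hxy : π x = π y
        · obtain ⟨K, hK, h1⟩ := exists_mass_le (hconn x hx y hy hxy) hc
          exact ⟨K, hK, h1.mono fun ε h1 _ _ => h1⟩
        · exact ⟨1, le_rfl, Eventually.of_forall fun ε _ h => absurd h hxy⟩
      obtain ⟨K, hK, h1⟩ := this
      exact ⟨K, hK, h1.mono fun ε h1 x hx y hy hxy => h1 x hx y hy hxy hy⟩
    -- The constant must be at least `1` even for empty `V`; once `V` is known to be nonempty, the
    -- maximum is the constant of `IsFlow.merge`.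
    refine ⟨K, max 1 (b * K * c * V.card), hK, le_max_left _ _, ?_⟩
    filter_upwards [hKe, hb₁e, hb₂e] with ε hK' h1 h2 δ hδ hδ1 ν φ hf
    have hmass : ∀ x ∈ V, ∀ y ∈ V, π x = π y → ν x ≤ K * ν y := by
      intro x hx y hy hxy
      rcases eq_or_ne x y with rfl | hne
      · have := hf.nonneg x hx
        nlinarith
      · exact hK' x hx y hy hne hxy δ hδ hδ1 ν φ hf
    refine ⟨fun hV => ?_, hmass⟩
    have hn : (1 : ℝ) ≤ V.card := by exact_mod_cast Finset.card_pos.2 hV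
    have hC : 1 ≤ b * K * c * V.card := one_le_mul_of_one_le_of_one_le
      (one_le_mul_of_one_le_of_one_le (one_le_mul_of_one_le_of_one_le hb hK) hc) hn
    rw [max_eq_right hC]
    refine ⟨_, hf.merge hc hδ (wt_nonneg P ε) (wt_nonneg Q ε) hb hK hW hmass
      (fun x hx y hy hxy => ?_) (fun i hi j hj hij => ?_)⟩
    · exact (h1 x hx y hy (fun e => hxy (by rw [e])) hxy).trans
        (mul_le_mul_of_nonneg_right (le_max_left _ _) (wt_nonneg _ _ _ _))
    · exact (h2 i hi j hj hij).trans (mul_le_mul_of_nonneg_right (le_max_right _ _)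
        (Finset.sum_nonneg fun _ _ => Finset.sum_nonneg fun _ _ => wt_nonneg _ _ _ _))
  have hsum : ∀ ν : α → ℝ, ∑ i ∈ W, ∑ x ∈ V with π x = i, ν x = ∑ x ∈ V, ν x :=
    fun ν => Finset.sum_fiberwise_of_maps_to hmaps _
  refine ⟨Finset.filter_subset _ _, fun a ha c hc => ?_, fun a ha ha' c hc η hη κ hκ => ?_,
    fun x hx y hy hy' h1 => ?_⟩
  · obtain ⟨haV, haH⟩ := Finset.mem_filter.1 ha
    obtain ⟨K, C, hK, hC, hp⟩ := hpush c hc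
    obtain ⟨κ, hκ, hs⟩ := h.sound (π a) haH C hC
    have hn : (0 : ℝ) < V.card := by exact_mod_cast Finset.card_pos.2 ⟨a, haV⟩
    have hK0 : 0 < K := by linarith
    refine ⟨κ / (V.card * K), by positivity, ?_⟩
    filter_upwards [hp, hs] with ε hp ⟨δ₀, hδ₀, hs⟩
    refine ⟨min δ₀ 1, by positivity, fun δ hδ hδ' ν φ hf => ?_⟩
    obtain ⟨h1, h2⟩ := hp δ hδ.le (hδ'.trans (min_le_right _ _)) ν φ hf
    obtain ⟨φ', hf'⟩ := h1 ⟨a, haV⟩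
    have h3 := hs δ hδ (hδ'.trans (min_le_left _ _)) _ φ' hf'
    rw [hsum] at h3
    rw [div_mul_eq_mul_div, div_le_iff₀ (by positivity)]
    refine h3.trans ?_
    calc ∑ x ∈ V with π x = π a, ν x ≤ ∑ x ∈ V with π x = π a, K * ν a := by
          refine Finset.sum_le_sum fun x hx => ?_
          obtain ⟨h4, h5⟩ := Finset.mem_filter.1 hx
          exact h2 x h4 a haV h5
      _ = (V.filter fun x => π x = π a).card * (K * ν a) := by rw [Finset.sum_const, nsmul_eq_mul]
      _ ≤ V.card * (K * ν a) := by
          have := hf.nonneg a haV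
          gcongr
          exact Finset.filter_subset _ _
      _ = _ := by ring
  · have haH : π a ∉ H' := fun h' => ha' (Finset.mem_filter.2 ⟨ha, h'⟩)
    obtain ⟨K, C, hK, hC, hp⟩ := hpush c hc
    have hb₁0 : 0 < b₁ := by linarith
    have := h.complete (π a) (hmaps a ha) haH C hC η hη (κ / b₁) (by positivity)
    refine ((this.and_eventually hp).and_eventually hb₁e).mono ?_
    rintro ε ⟨⟨⟨⟨i, hi, j, hj, hij, hlt⟩, hs⟩, hp⟩, h₁⟩
    refine ⟨?_, fun ν φ hf => ?_⟩
    · rw [← hW] at hi hj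
      obtain ⟨x, hx, rfl⟩ := Finset.mem_image.1 hi
      obtain ⟨y, hy, rfl⟩ := Finset.mem_image.1 hj
      have hxy : x ≠ y := fun e => hij (by rw [e])
      refine ⟨x, hx, y, hy, hxy, ?_⟩
      rw [lt_div_iff₀ hb₁0] at hlt
      linarith [h₁ x hx y hy hxy hij]
    · obtain ⟨h1, -⟩ := hp 0 le_rfl zero_le_one ν φ hf
      obtain ⟨φ', hf'⟩ := h1 ⟨a, ha⟩
      have h3 := hs _ φ' hf'
      rw [hsum] at h3
      refine le_trans ?_ h3
      exact Finset.single_le_sum (f := ν) (fun x hx => hf.nonneg x (Finset.mem_filter.1 hx).1)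
        (Finset.mem_filter.2 ⟨ha, rfl⟩)
  · obtain ⟨hxV, hxH⟩ := Finset.mem_filter.1 hx
    have hyH : π y ∉ H' := fun h' => hy' (Finset.mem_filter.2 ⟨hy, h'⟩)
    have hne : π x ≠ π y := fun e => hyH (e ▸ hxH)
    exact h.closed _ hxH _ (hmaps y hy) hyH (eq_one_of_le (h1 ▸ hle x hxV y hy hne))

end Merge

end StochStab

namespace StochStab

open OrderClass

/-! ### Stationary distributions and stability -/

section Stationary

variable {S : Type*} [Fintype S]

/-- The matrix `A - 1` kills the constant vector, hence is singular and has a left null vector `v`.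
The triangle inequality gives `|v| ≤ |v| A` entrywise, and both sides have the same sum, so `|v|` is
invariant as well. -/
theorem exists_isStationary [DecidableEq S] [Nonempty S] {A : Matrix S S ℝ}
    (hA : A ∈ Matrix.rowStochastic ℝ S) : ∃ μ, IsStationary A μ := by
  obtain ⟨hA0, hA1⟩ := Matrix.mem_rowStochastic_iff_sum.1 hA
  have hdet : (A - 1).det = 0 := by
    refine Matrix.exists_mulVec_eq_zero_iff.1 ⟨1, one_ne_zero, ?_⟩
    rw [Matrix.sub_mulVec, (Matrix.mem_rowStochastic.1 hA).2, Matrix.one_mulVec, sub_self]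
  obtain ⟨v, hv0, hv⟩ := Matrix.exists_vecMul_eq_zero_iff.2 hdet
  rw [Matrix.vecMul_sub, Matrix.vecMul_one, sub_eq_zero] at hv
  have hv' : ∀ y, ∑ x, v x * A x y = v y := fun y => congrFun hv y
  have hle : ∀ y ∈ Finset.univ, |v y| ≤ ∑ x, |v x| * A x y := fun y _ => by
    conv_lhs => rw [← hv' y]
    refine (Finset.abs_sum_le_sum_abs _ _).trans (le_of_eq (Finset.sum_congr rfl fun x _ => ?_))
    rw [abs_mul, abs_of_nonneg (hA0 x y)]
  have hsum : ∑ y, ∑ x, |v x| * A x y = ∑ y, |v y| := by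
    rw [Finset.sum_comm]
    exact Finset.sum_congr rfl fun x _ => by rw [← Finset.mul_sum, hA1, mul_one]
  have heq := (Finset.sum_eq_sum_iff_of_le hle).1 hsum.symm
  have hpos : 0 < ∑ x, |v x| := by
    obtain ⟨x, hx⟩ := Function.ne_iff.1 hv0
    exact Finset.sum_pos' (fun x _ => abs_nonneg _) ⟨x, Finset.mem_univ x, abs_pos.2 hx⟩
  refine ⟨fun x => |v x| / ∑ x, |v x|, ⟨fun x => by positivity, ?_⟩, funext fun y => ?_⟩
  · rw [← Finset.sum_div, div_self hpos.ne']
  · change ∑ x, |v x| / (∑ x, |v x|) * A x y = |v y| / ∑ x, |v x|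
    rw [heq y (Finset.mem_univ y), Finset.sum_div]
    exact Finset.sum_congr rfl fun x _ => by ring

/-- If all the chains obtained by adding a small background rate have a stationary distribution
of mass at least `κ` at `x`, then so has the chain itself. -/
theorem exists_isStationary_of_background [DecidableEq S] [Nonempty S] {A : Matrix S S ℝ}
    (hA : A ∈ Matrix.rowStochastic ℝ S) {x : S} {κ δ₀ : ℝ} (hδ₀ : 0 < δ₀)
    (h : ∀ δ, 0 < δ → δ ≤ δ₀ → ∀ μ ∈ stdSimplex ℝ S,
      (∀ y, ∑ x, μ x * (A x y + δ) = ∑ x, μ y * (A y x + δ)) → κ ≤ μ x) :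
    ∃ μ, IsStationary A μ ∧ κ ≤ μ x := by
  obtain ⟨hA0, hA1⟩ := Matrix.mem_rowStochastic_iff_sum.1 hA
  set N : ℝ := (Fintype.card S : ℝ) with hN
  have hex : ∀ δ : ℝ, 0 < δ → ∃ μ ∈ stdSimplex ℝ S,
      ∀ y, ∑ x, μ x * (A x y + δ) = ∑ x, μ y * (A y x + δ) := by
    intro δ hδ
    have hp : 0 < 1 + N * δ := by positivity
    -- The chain with background has row sums `1 + N * δ`; dividing by them makes it stochastic
    -- without affecting the balance equations.
    have hB : Matrix.of (fun x y => (A x y + δ) / (1 + N * δ)) ∈ Matrix.rowStochastic ℝ S := by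
      refine Matrix.mem_rowStochastic_iff_sum.2 ⟨fun i j => ?_, fun i => ?_⟩
      · have := hA0 i j
        simp only [Matrix.of_apply]
        positivity
      · simp only [Matrix.of_apply]
        rw [← Finset.sum_div, Finset.sum_add_distrib, hA1]
        simp only [Finset.sum_const, Finset.card_univ, nsmul_eq_mul]
        exact div_self hp.ne'
    obtain ⟨μ, hμ, hst⟩ := exists_isStationary hB
    refine ⟨μ, hμ, fun y => ?_⟩
    have h1 : ∑ x, μ x * ((A x y + δ) / (1 + N * δ)) = μ y := congrFun hst y
    have h2 : ∑ x, μ x * (A x y + δ) = μ y * (1 + N * δ) := by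
      rw [← h1, Finset.sum_mul]
      exact Finset.sum_congr rfl fun x _ => by rw [mul_assoc, div_mul_cancel₀ _ hp.ne']
    rw [h2, ← Finset.mul_sum, Finset.sum_add_distrib, hA1]
    simp [hN]
  have hδn : ∀ n : ℕ, 0 < δ₀ / (n + 1) := fun n => by positivity
  choose μ hμ hbal using fun n : ℕ => hex (δ₀ / (n + 1)) (hδn n)
  -- The simplex is compact. Along a convergent subsequence the background disappears from the
  -- balance equations, while the lower bound `κ` persists.
  obtain ⟨ν, hν, f, hf, hlim⟩ := (isCompact_stdSimplex ℝ S).tendsto_subseq hμ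
  have hlim' : ∀ y, Tendsto (fun n => μ (f n) y) atTop (𝓝 (ν y)) := fun y =>
    (tendsto_pi_nhds.1 hlim) y
  have hδlim : Tendsto (fun n => δ₀ / ((f n : ℕ) + 1 : ℝ)) atTop (𝓝 0) := by
    have h1 : Tendsto (fun n : ℕ => δ₀ * (1 / ((n : ℝ) + 1))) atTop (𝓝 (δ₀ * 0)) :=
      tendsto_one_div_add_atTop_nhds_zero_nat.const_mul δ₀
    rw [mul_zero] at h1
    refine (h1.comp hf.tendsto_atTop).congr fun n => ?_
    simp [div_eq_mul_inv]
  refine ⟨ν, ⟨hν, funext fun y => ?_⟩, ?_⟩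
  · have h1 : Tendsto (fun n => ∑ x, μ (f n) x * (A x y + δ₀ / ((f n : ℕ) + 1 : ℝ))) atTop
        (𝓝 (∑ x, ν x * (A x y + 0))) :=
      tendsto_finsetSum _ fun x _ => (hlim' x).mul (hδlim.const_add _)
    have h2 : Tendsto (fun n => ∑ x, μ (f n) y * (A y x + δ₀ / ((f n : ℕ) + 1 : ℝ))) atTop
        (𝓝 (∑ x, ν y * (A y x + 0))) :=
      tendsto_finsetSum _ fun x _ => (hlim' y).mul (hδlim.const_add _)
    have h3 := tendsto_nhds_unique h1 (h2.congr fun n => (hbal (f n) y).symm)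
    simp only [add_zero, ← Finset.mul_sum, hA1, mul_one] at h3
    exact h3
  · refine ge_of_tendsto' (hlim' x) fun n => h _ (hδn _) ?_ _ (hμ _) (hbal _)
    exact div_le_self hδ₀.le (by linarith [(f n).cast_nonneg (α := ℝ)])

/-- The flow of a distribution that is stationary up to a background rate. -/
theorem isFlow_of_balance {α : Type*} [DecidableEq α] {A : Matrix S S ℝ}
    {e : S → α} (he : Function.Injective e)
    {g : α → S} (hg : Function.LeftInverse g e) {w : α → α → ℝ} {δ b : ℝ} {μ : S → ℝ} (hb : 1 ≤ b)
    (hδ : 0 ≤ δ) (hμ : ∀ x, 0 ≤ μ x)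
    (h₁ : ∀ x y, x ≠ y → A x y ≤ b * w (e x) (e y)) (h₂ : ∀ x y, x ≠ y → w (e x) (e y) ≤ b * A x y)
    (hbal : ∀ y, ∑ x, μ x * (A x y + δ) = ∑ x, μ y * (A y x + δ)) :
    IsFlow (Finset.univ.image e) w δ b (fun a => μ (g a))
      (fun a a' => μ (g a) * (A (g a) (g a') + δ)) := by
  have hmem : ∀ {a}, a ∈ Finset.univ.image e → ∃ x, e x = a := fun h => by simpa using h
  refine ⟨fun a _ => hμ _, fun a ha => ?_, fun a ha a' ha' hne => ?_, fun a ha a' ha' hne => ?_⟩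
  · obtain ⟨y, rfl⟩ := hmem ha
    rw [Finset.sum_image he.injOn, Finset.sum_image he.injOn]
    simp only [hg _]
    exact hbal y
  · obtain ⟨x, rfl⟩ := hmem ha
    obtain ⟨y, rfl⟩ := hmem ha'
    simp only [hg _]
    have hx := hμ x
    calc μ x * (w (e x) (e y) + δ) ≤ μ x * (b * A x y + b * δ) := by
          gcongr
          · exact h₂ x y fun h => hne (by rw [h])
          · nlinarith
      _ = _ := by ring
  · obtain ⟨x, rfl⟩ := hmem ha
    obtain ⟨y, rfl⟩ := hmem ha'
    simp only [hg _]
    have hx := hμ x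
    calc μ x * (A x y + δ) ≤ μ x * (b * w (e x) (e y) + b * δ) := by
          gcongr
          · exact h₁ x y fun h => hne (by rw [h])
          · nlinarith
      _ = _ := by ring

end Stationary

section Stable

variable {I : Set ℝ} {S α : Type*} [Fintype S] [DecidableEq S] [DecidableEq α]

theorem Perturbation.neBot (p : Perturbation I S) : (toZero I).NeBot := by
  have h := p.accPt
  rw [accPt_iff_nhds] at h
  refine comap_neBot_iff.2 fun t ht => ?_
  obtain ⟨y, ⟨h1, h2⟩, -⟩ := h t ht
  exact ⟨⟨y, h2⟩, h1⟩

/-- Stationary distributions are flows without background, so an uncharged state has mass below any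
given positive bound along some sequence of parameters. For a charged state the background rates are
sent to `0`. The embedding `e` allows the states to be singletons, as for `Hub`, or numbers, as for
the program. -/
theorem Correct.stable_iff {p : Perturbation I S} {e : S → α} (he : Function.Injective e)
    {P : α → α → OrderClass I} {H : Finset α}
    (hP : ∀ x y, x ≠ y → P (e x) (e y) = p.classes x y)
    (h : Correct (Finset.univ.image e) P H) (x : S) : p.Stable x ↔ e x ∈ H := by
  classical
  have := p.neBot
  have : Nonempty S := ⟨x⟩
  obtain ⟨g, hg⟩ := he.hasLeftInverse
  obtain ⟨b₁, hb₁, hb₁e⟩ : ∃ b : ℝ, 1 ≤ b ∧ ∀ᶠ ε in toZero I, ∀ x ∈ Finset.univ,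
      ∀ y ∈ Finset.univ, x ≠ y → p.mat ε x y ≤ b * wt P ε (e x) (e y) := by
    refine exists_uniform_pairs _ (fun x y b b' ε hbb hb => hb.trans
      (mul_le_mul_of_nonneg_right hbb (wt_nonneg _ _ _ _))) fun x _ y _ hxy => ?_
    simp only [wt, hP x y hxy]
    exact dom_rep_mk (p.entry x y)
  obtain ⟨b₂, hb₂, hb₂e⟩ : ∃ b : ℝ, 1 ≤ b ∧ ∀ᶠ ε in toZero I, ∀ x ∈ Finset.univ,
      ∀ y ∈ Finset.univ, x ≠ y → wt P ε (e x) (e y) ≤ b * p.mat ε x y := by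
    refine exists_uniform_pairs _ (fun x y b b' ε hbb hb => hb.trans
      (mul_le_mul_of_nonneg_right hbb (p.entry x y ε).2.1)) fun x _ y _ hxy => ?_
    simp only [wt, hP x y hxy]
    exact rep_mk_dom (p.entry x y)
  set b := max b₁ b₂
  have hb : 1 ≤ b := le_max_of_le_left hb₁
  have hflow : ∀ᶠ ε in toZero I, ∀ δ, 0 ≤ δ → ∀ μ ∈ stdSimplex ℝ S,
      (∀ y, ∑ x, μ x * (p.mat ε x y + δ) = ∑ x, μ y * (p.mat ε y x + δ)) →
      IsFlow (Finset.univ.image e) (wt P ε) δ b (fun a => μ (g a))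
        (fun a a' => μ (g a) * (p.mat ε (g a) (g a') + δ)) := by
    filter_upwards [hb₁e, hb₂e] with ε h1 h2 δ hδ μ hμ hbal
    refine isFlow_of_balance he hg hb hδ hμ.1 (fun x y hxy => ?_) (fun x y hxy => ?_) hbal
    · exact (h1 x (Finset.mem_univ x) y (Finset.mem_univ y) hxy).trans
        (mul_le_mul_of_nonneg_right (le_max_left _ _) (wt_nonneg _ _ _ _))
    · exact (h2 x (Finset.mem_univ x) y (Finset.mem_univ y) hxy).trans
        (mul_le_mul_of_nonneg_right (le_max_right _ _) (p.entry x y ε).2.1)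
  have hsum : ∀ μ ∈ stdSimplex ℝ S, ∑ a ∈ Finset.univ.image e, μ (g a) = 1 := by
    intro μ hμ
    rw [Finset.sum_image he.injOn]
    simp only [hg _]
    exact hμ.2
  constructor
  · rintro ⟨μ, hμ, hlim⟩
    by_contra hx
    set L := liminf (fun ε => μ ε x) (toZero I)
    have hbd : IsBoundedUnder (· ≥ ·) (toZero I) fun ε => μ ε x :=
      isBoundedUnder_of ⟨0, fun ε => (hμ ε).1.1 x⟩
    have hev := eventually_lt_of_lt_liminf (half_lt_self hlim) hbd
    have hfr := h.complete (e x) (Finset.mem_image_of_mem e (Finset.mem_univ x)) hx b hb (L / 2)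
      (half_pos hlim) 1 one_pos
    obtain ⟨ε, ⟨⟨-, h1⟩, h2⟩, h3⟩ := ((hfr.and_eventually hev).and_eventually hflow).exists
    have h4 := h1 _ _ (h3 0 le_rfl (μ ε) (hμ ε).1 fun y => by
      have hst : ∑ x, μ ε x * p.mat ε x y = μ ε y := congrFun (hμ ε).2 y
      simp only [add_zero, ← Finset.mul_sum,
        Matrix.sum_row_of_mem_rowStochastic (p.stoch ε), mul_one]
      exact hst)
    rw [hsum _ (hμ ε).1, hg, mul_one] at h4
    linarith
  · intro hx
    obtain ⟨κ, hκ, hs⟩ := h.sound (e x) hx b hb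
    have hex : ∀ᶠ ε in toZero I, ∃ μ, IsStationary (p.mat ε) μ ∧ κ ≤ μ x := by
      filter_upwards [hs, hflow] with ε ⟨δ₀, hδ₀, hs⟩ hflow
      refine exists_isStationary_of_background (p.stoch ε) hδ₀ fun δ hδ hδ' μ hμ hbal => ?_
      have h4 := hs δ hδ hδ' _ _ (hflow δ hδ.le μ hμ hbal)
      rwa [hsum _ hμ, hg, mul_one] at h4
    -- A stationary distribution is required at every parameter, also at those away from `0` where
    -- the bound `κ` may not be attainable.
    have hall : ∀ ε, ∃ μ, IsStationary (p.mat ε) μ ∧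
        ((∃ μ, IsStationary (p.mat ε) μ ∧ κ ≤ μ x) → κ ≤ μ x) := by
      intro ε
      by_cases h1 : ∃ μ, IsStationary (p.mat ε) μ ∧ κ ≤ μ x
      · obtain ⟨μ, h2, h3⟩ := h1
        exact ⟨μ, h2, fun _ => h3⟩
      · obtain ⟨μ, h2⟩ := exists_isStationary (p.stoch ε)
        exact ⟨μ, h2, fun h => absurd h h1⟩
    choose μ hμ hμκ using hall
    refine ⟨μ, hμ, hκ.trans_le (le_liminf_of_le ?_ (hex.mono fun ε h => hμκ ε h))⟩
    refine IsBoundedUnder.isCoboundedUnder_ge (isBoundedUnder_of ⟨1, fun ε => ?_⟩)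
    have h1 := (hμ ε).1
    rw [← h1.2]
    exact Finset.single_le_sum (fun y _ => h1.1 y) (Finset.mem_univ x)

end Stable

end StochStab

namespace StochStab

open OrderClass

/-! ### Correctness of the algorithm `Hub` -/

section Hub

open Classical

variable {I : Set ℝ} {S : Type*}

/-! ### Maximal weights of paths -/

theorem pathWeight_append (P : Finset S → Finset S → OrderClass I) (l l' : List (Finset S))
    (a : Finset S) :
    pathWeight P (l ++ a :: l') = pathWeight P (l ++ [a]) * pathWeight P (a :: l') := by
  induction l with
  | nil => simp [pathWeight]
  | cons x l ih =>
    cases l with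
    | nil => simp [pathWeight]
    | cons y l =>
      simp only [List.cons_append, pathWeight] at ih ⊢
      rw [ih, mul_assoc]

/-- A walk contains a path of at least the same weight. -/
theorem exists_nodup_pathWeight_le (P : Finset S → Finset S → OrderClass I)
    (T : Finset (Finset S)) (y : Finset S) (l : List (Finset S)) (hl : ∀ t ∈ l, t ∈ T)
    (x : Finset S) : ∃ l' : List (Finset S), l'.Nodup ∧ (∀ t ∈ l', t ∈ T) ∧
      pathWeight P (x :: (l ++ [y])) ≤ pathWeight P (x :: (l' ++ [y])) := by
  induction l generalizing x with
  | nil => exact ⟨[], List.nodup_nil, by simp, le_rfl⟩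
  | cons t l ih =>
    obtain ⟨l', hnd, hT, hle⟩ := ih (fun u hu => hl u (List.mem_cons_of_mem t hu)) t
    have hle' : pathWeight P (x :: (t :: l ++ [y])) ≤ P x t * pathWeight P (t :: (l' ++ [y])) :=
      mul_le_mul' le_rfl hle
    by_cases ht : t ∈ l'
    · obtain ⟨l₁, l₂, rfl⟩ := List.append_of_mem ht
      have hnd₂ : (t :: l₂).Nodup := (List.nodup_append.1 hnd).2.1
      refine ⟨t :: l₂, hnd₂, fun u hu => hT u (List.mem_append_right _ hu), hle'.trans ?_⟩
      have h1 : t :: (l₁ ++ t :: l₂ ++ [y]) = (t :: l₁) ++ t :: (l₂ ++ [y]) := by simp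
      rw [h1, pathWeight_append]
      exact mul_le_mul' le_rfl (mul_le_right _ _)
    · exact ⟨t :: l', List.nodup_cons.2 ⟨ht, hnd⟩, fun u hu => by
        rcases List.mem_cons.1 hu with rfl | hu
        exacts [hl _ List.mem_cons_self, hT u hu], hle'⟩

theorem pathWeight_le_maxPath (P : Finset S → Finset S → OrderClass I) {T : Finset (Finset S)}
    (x y : Finset S) {l : List (Finset S)} (hl : ∀ t ∈ l, t ∈ T) :
    pathWeight P (x :: (l ++ [y])) ≤ maxPath P T x y := by
  obtain ⟨l', hnd, hT, hle⟩ := exists_nodup_pathWeight_le P T y l hl x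
  refine hle.trans ?_
  lift l' to List T using hT
  exact Finset.le_sup (f := fun γ : {l : List T // l.Nodup} =>
    pathWeight P (x :: (γ.1.map Subtype.val ++ [y]))) (b := ⟨l', hnd.of_map _⟩) (Finset.mem_univ _)

theorem maxPath_le {P : Finset S → Finset S → OrderClass I} {T : Finset (Finset S)}
    {x y : Finset S} {B : OrderClass I}
    (h : ∀ l : List (Finset S), l.Nodup → (∀ t ∈ l, t ∈ T) → pathWeight P (x :: (l ++ [y])) ≤ B) :
    maxPath P T x y ≤ B := by
  refine Finset.sup_le fun γ _ => h _ (γ.2.map Subtype.val_injective) fun t ht => ?_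
  obtain ⟨u, -, rfl⟩ := List.mem_map.1 ht
  exact u.2

theorem maxPath_empty (P : Finset S → Finset S → OrderClass I) : maxPath P ∅ = P := by
  funext x y
  apply le_antisymm
  · refine maxPath_le fun l _ hl => ?_
    have : l = [] := List.eq_nil_iff_forall_not_mem.2 fun t ht => Finset.notMem_empty t (hl t ht)
    subst this
    simp [pathWeight]
  · have := pathWeight_le_maxPath P (T := ∅) x y (l := []) (by simp)
    simpa [pathWeight] using this

theorem mul_maxPath_le (P : Finset S → Finset S → OrderClass I) {T : Finset (Finset S)}
    {B c : OrderClass I} {x y : Finset S}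
    (h : ∀ l : List (Finset S), (∀ t ∈ l, t ∈ T) → c * pathWeight P (x :: (l ++ [y])) ≤ B) :
    c * maxPath P T x y ≤ B := by
  rw [maxPath, mul_finset_sup]
  refine Finset.sup_le fun γ _ => h _ fun t ht => ?_
  obtain ⟨u, -, rfl⟩ := List.mem_map.1 ht
  exact u.2

/-- Two paths joined at `z` form a walk that may repeat vertices. Cutting out its cycles does not
decrease the weight, as all weights are at most `1`. -/
theorem maxPath_mul_maxPath_le (P : Finset S → Finset S → OrderClass I) {T : Finset (Finset S)}
    {z : Finset S} (hz : z ∈ T) (x y : Finset S) :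
    maxPath P T x z * maxPath P T z y ≤ maxPath P T x y := by
  refine mul_maxPath_le P fun l hl => ?_
  rw [mul_comm]
  refine mul_maxPath_le P fun l' hl' => ?_
  rw [mul_comm, ← List.cons_append, ← pathWeight_append P (x :: l') (l ++ [y]) z]
  have : x :: l' ++ z :: (l ++ [y]) = x :: ((l' ++ z :: l) ++ [y]) := by simp
  rw [this]
  refine pathWeight_le_maxPath P x y fun t ht => ?_
  rcases List.mem_append.1 ht with ht | ht
  · exact hl' t ht
  · rcases List.mem_cons.1 ht with rfl | ht
    exacts [hz, hl t ht]

theorem maxPath_mono (P : Finset S → Finset S → OrderClass I) {T T' : Finset (Finset S)}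
    (h : T ⊆ T') (x y : Finset S) : maxPath P T x y ≤ maxPath P T' x y :=
  maxPath_le fun _ _ hl => pathWeight_le_maxPath P x y fun t ht => h (hl t ht)

theorem le_maxPath (P : Finset S → Finset S → OrderClass I) (T : Finset (Finset S))
    (x y : Finset S) : P x y ≤ maxPath P T x y := by
  conv_lhs => rw [← maxPath_empty P]
  exact maxPath_mono P (Finset.empty_subset T) x y

/-- A simple path passes through `z` at most once and splits there. This is the weight update of
`Correct.of_eliminate`, so passing to maximal paths through `T` amounts to eliminating the elements
of `T` one at a time. -/
theorem maxPath_insert (P : Finset S → Finset S → OrderClass I) {T : Finset (Finset S)}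
    {z : Finset S} (x y : Finset S) :
    maxPath P (insert z T) x y = maxPath P T x y ⊔ maxPath P T x z * maxPath P T z y := by
  apply le_antisymm
  · refine maxPath_le fun l hnd hl => ?_
    by_cases hz : z ∈ l
    · obtain ⟨l₁, l₂, rfl⟩ := List.append_of_mem hz
      have hnd' := List.nodup_append.1 hnd
      have h1 : x :: (l₁ ++ z :: l₂ ++ [y]) = (x :: l₁) ++ z :: (l₂ ++ [y]) := by simp
      rw [h1, pathWeight_append]
      refine le_trans (mul_le_mul' ?_ ?_) le_sup_right
      · refine pathWeight_le_maxPath P x z fun t ht => ?_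
        refine Finset.mem_of_mem_insert_of_ne (hl t (List.mem_append_left _ ht)) ?_
        exact hnd'.2.2 t ht z List.mem_cons_self
      · refine pathWeight_le_maxPath P z y fun t ht => ?_
        refine Finset.mem_of_mem_insert_of_ne
          (hl t (List.mem_append_right _ (List.mem_cons_of_mem _ ht))) fun e => ?_
        exact (List.nodup_cons.1 hnd'.2.1).1 (e ▸ ht)
    · refine (pathWeight_le_maxPath P x y fun t ht => ?_).trans le_sup_left
      exact Finset.mem_of_mem_insert_of_ne (hl t ht) fun e => hz (e ▸ ht)
  · refine sup_le (maxPath_mono P (Finset.subset_insert z T) x y) ?_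
    refine le_trans (mul_le_mul' ?_ ?_) (maxPath_mul_maxPath_le P (Finset.mem_insert_self z T) x y)
    exacts [maxPath_mono P (Finset.subset_insert z T) x z,
      maxPath_mono P (Finset.subset_insert z T) z y]

theorem maxPath_mem {Γ : Set (OrderClass I)} (hΓ : IsTotalMonoid Γ) {V : Finset (Finset S)}
    {P : Finset S → Finset S → OrderClass I} (hP : ∀ x ∈ V, ∀ y ∈ V, x ≠ y → P x y ∈ Γ)
    {T : Finset (Finset S)} (hT : T ⊆ V) :
    ∀ x ∈ V \ T, ∀ y ∈ V \ T, x ≠ y → maxPath P T x y ∈ Γ := by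
  induction T using Finset.induction_on with
  | empty =>
    rw [maxPath_empty, Finset.sdiff_empty]
    exact hP
  | insert z T hz ih =>
    intro x hx y hy hxy
    have hzV : z ∈ V \ T := Finset.mem_sdiff.2 ⟨hT (Finset.mem_insert_self z T), hz⟩
    have hsub : V \ insert z T ⊆ V \ T := Finset.sdiff_subset_sdiff subset_rfl
      (Finset.subset_insert z T)
    have ih' := ih ((Finset.subset_insert z T).trans hT)
    have hne : ∀ u ∈ V \ insert z T, u ≠ z := fun u hu e =>
      (Finset.mem_sdiff.1 hu).2 (e ▸ Finset.mem_insert_self z T)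
    rw [maxPath_insert]
    exact hΓ.sup_mem (ih' x (hsub hx) y (hsub hy) hxy)
      (hΓ.mul_mem (ih' x (hsub hx) z hzV (hne x hx)) (ih' z hzV y (hsub hy) (hne y hy).symm))

theorem eq_one_of_mul_eq_one {a b : OrderClass I} (h : a * b = 1) : a = 1 :=
  eq_one_of_le (h ▸ mul_le_left a b)

/-- Elimination of a set `T` of vertices that are transient for the arcs of weight `1`. -/
theorem Correct.of_maxPath (hI : ∀ ε ∈ I, 0 < ε) {Γ : Set (OrderClass I)} (hΓ : IsTotalMonoid Γ)
    {V T H : Finset (Finset S)} {P : Finset S → Finset S → OrderClass I} (hT : T ⊆ V)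
    (hP : ∀ x ∈ V, ∀ y ∈ V, x ≠ y → P x y ∈ Γ)
    (hreach : ∀ t ∈ T, ∃ e ∈ V \ T, EssReach V P t e)
    (hout : ∀ e ∈ V \ T, ∀ t ∈ T, P e t ≠ 1)
    (h : Correct (V \ T) (maxPath P T) H) : Correct V P H := by
  -- No arc of weight `1` from `V \ T` to `T` arises during the elimination: by total ordering a
  -- maximum equal to `1` is attained, and a product is `1` only if its first factor is. Hence no
  -- eliminated vertex is charged.
  have hne_one : ∀ T' ⊆ T, ∀ e ∈ V \ T, ∀ t ∈ T \ T', maxPath P T' e t ≠ 1 := by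
    intro T'
    induction T' using Finset.induction_on with
    | empty =>
      intro _ e he t ht
      rw [maxPath_empty]
      exact hout e he t (Finset.mem_sdiff.1 ht).1
    | insert z T' hz ih =>
      intro hT' e he t ht
      have hT'' := (Finset.subset_insert z T').trans hT'
      have hzT := hT' (Finset.mem_insert_self z T')
      obtain ⟨htT, htT'⟩ := Finset.mem_sdiff.1 ht
      have ht' : t ∈ T \ T' := Finset.mem_sdiff.2 ⟨htT, fun h => htT' (Finset.mem_insert_of_mem h)⟩
      have hz' : z ∈ T \ T' := Finset.mem_sdiff.2 ⟨hzT, hz⟩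
      have htz : z ≠ t := fun e => htT' (e ▸ Finset.mem_insert_self z T')
      have hsub : T \ T' ⊆ V \ T' := Finset.sdiff_subset_sdiff hT subset_rfl
      have heV : e ∈ V \ T' := Finset.sdiff_subset_sdiff subset_rfl hT'' he
      have heT : ∀ u ∈ T, e ≠ u := fun u hu h => (Finset.mem_sdiff.1 he).2 (h ▸ hu)
      have hm := maxPath_mem hΓ hP (hT''.trans hT)
      rw [maxPath_insert]
      intro h1
      rcases hΓ.sup_eq (hm e heV t (hsub ht') (heT t htT)) (hΓ.mul_mem
        (hm e heV z (hsub hz') (heT z hzT)) (hm z (hsub hz') t (hsub ht') htz)) with h2 | h2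
      · exact ih hT'' e he t ht' (h2.symm.trans h1)
      · exact ih hT'' e he z hz' (eq_one_of_mul_eq_one (h2.symm.trans h1))
  have key : ∀ T' ⊆ T, Correct (V \ T') (maxPath P T') H → Correct V P H := by
    intro T'
    induction T' using Finset.induction_on with
    | empty =>
      intro _ h
      rwa [maxPath_empty, Finset.sdiff_empty] at h
    | insert z T' hz ih =>
      intro hT' h'
      have hT'' := (Finset.subset_insert z T').trans hT'
      have hzT := hT' (Finset.mem_insert_self z T')
      have hzV : z ∈ V \ T' := Finset.mem_sdiff.2 ⟨hT hzT, hz⟩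
      have herase : (V \ T').erase z = V \ insert z T' := by
        ext u
        simp only [Finset.mem_erase, Finset.mem_sdiff, Finset.mem_insert]
        tauto
      -- For `z` to be eliminated it needs an arc of weight `1` to a vertex still present. Such an
      -- arc arises from a path of weight `1` to `V \ T`, shortened through the vertices already
      -- eliminated.
      obtain ⟨y₀, hy₀, hy₁⟩ : ∃ y ∈ V \ insert z T', maxPath P T' z y = 1 := by
        obtain ⟨e, he, hze⟩ := hreach z hzT
        -- The first alternative absorbs the case that the path returns to `z`: its last visit to
        -- `z` already supplies the arc.
        have claim : ∀ u, EssReach V P u e → (∃ y ∈ V \ insert z T', maxPath P T' z y = 1) ∨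
            u ∈ V \ insert z T' ∨ ∃ y ∈ V \ insert z T', maxPath P T' u y = 1 := by
          intro u hu
          induction hu using Relation.ReflTransGen.head_induction_on with
          | refl => exact Or.inr (Or.inl (Finset.sdiff_subset_sdiff subset_rfl hT' he))
          | @head u v huv _ ih =>
            obtain ⟨-, hv, -, h1⟩ := huv
            by_cases hvz : v = z
            · subst hvz
              rcases ih with ih | ih | ih
              · exact Or.inl ih
              · exact absurd (Finset.mem_insert_self v T') (Finset.mem_sdiff.1 ih).2
              · exact Or.inl ih
            by_cases hvT : v ∈ T'
            · rcases ih with ih | ih | ⟨y, hy, hy1⟩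
              · exact Or.inl ih
              · exact absurd (Finset.mem_insert_of_mem hvT) (Finset.mem_sdiff.1 ih).2
              · refine Or.inr (Or.inr ⟨y, hy, eq_one_of_le ?_⟩)
                have h2 := maxPath_mul_maxPath_le P hvT u y
                rw [hy1, mul_one] at h2
                exact (h1 ▸ le_maxPath P T' u v).trans h2
            · refine Or.inr (Or.inr ⟨v, Finset.mem_sdiff.2 ⟨hv, ?_⟩,
                eq_one_of_le (h1 ▸ le_maxPath P T' u v)⟩)
              simp [hvz, hvT]
        rcases claim z hze with h1 | h1 | h1
        · exact h1
        · exact absurd (Finset.mem_insert_self z T') (Finset.mem_sdiff.1 h1).2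
        · exact h1
      have hy₀' : y₀ ∈ V \ T' := by rw [← herase] at hy₀; exact Finset.mem_of_mem_erase hy₀
      have hzy : z ≠ y₀ := fun e => (Finset.mem_sdiff.1 hy₀).2 (e ▸ Finset.mem_insert_self z T')
      refine ih hT'' (Correct.of_eliminate hI hΓ hzV hy₀' hzy hy₁ (maxPath_mem hΓ hP (hT''.trans hT))
        (fun x _ y _ _ => maxPath_insert P x y) (fun a => ⟨Or.inl, ?_⟩) (herase ▸ h'))
      rintro (ha | ⟨-, x, hx, hx1⟩)
      · exact ha
      · exact absurd hx1 (hne_one T' hT'' x (h.subset hx) z (Finset.mem_sdiff.2 ⟨hzT, hz⟩))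
  exact key T subset_rfl h

/-! ### Essential classes and the shrunk digraph -/

theorem EssReach.mem {V : Finset (Finset S)} {P : Finset S → Finset S → OrderClass I}
    {x y : Finset S} (h : EssReach V P x y) (hx : x ∈ V) : y ∈ V := by
  induction h with
  | refl => exact hx
  | tail _ h _ => exact h.2.1

theorem IsEssential.of_reach {V : Finset (Finset S)} {P : Finset S → Finset S → OrderClass I}
    {x y : Finset S} (h : IsEssential V P x) (hxy : EssReach V P x y) : IsEssential V P y :=
  ⟨hxy.mem h.1, fun z hz => (h.2 z (hxy.trans hz)).trans hxy⟩

/-- Among the vertices reachable from `x`, one that itself reaches the fewest vertices is essential: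
whatever it reaches must reach equally many, and so reaches it back. -/
theorem exists_essential (V : Finset (Finset S)) (P : Finset S → Finset S → OrderClass I)
    {x : Finset S} (hx : x ∈ V) : ∃ y, IsEssential V P y ∧ EssReach V P x y := by
  obtain ⟨y, hy, hmin⟩ := Finset.exists_min_image (V.filter (EssReach V P x))
    (fun y => (V.filter (EssReach V P y)).card) ⟨x, Finset.mem_filter.2 ⟨hx, .refl⟩⟩
  obtain ⟨hyV, hxy⟩ := Finset.mem_filter.1 hy
  refine ⟨y, ⟨hyV, fun z hyz => ?_⟩, hxy⟩
  have hsub : V.filter (EssReach V P z) ⊆ V.filter (EssReach V P y) := fun u hu => by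
    obtain ⟨h1, h2⟩ := Finset.mem_filter.1 hu
    exact Finset.mem_filter.2 ⟨h1, hyz.trans h2⟩
  have heq := Finset.eq_of_subset_of_card_le hsub
    (hmin z (Finset.mem_filter.2 ⟨hyz.mem hyV, hxy.trans hyz⟩))
  have : y ∈ V.filter (EssReach V P z) := heq ▸ Finset.mem_filter.2 ⟨hyV, .refl⟩
  exact (Finset.mem_filter.1 this).2

/-- The vertex of the shrunk graph that contains `x`. -/
noncomputable def shrinkProj (V : Finset (Finset S)) (P : Finset S → Finset S → OrderClass I)
    (x : Finset S) : Finset S := (scc V P x).biUnion id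

theorem shrinkVerts_eq (V : Finset (Finset S)) (P : Finset S → Finset S → OrderClass I) :
    shrinkVerts V P = (V.filter (IsEssential V P)).image (shrinkProj V P) := by
  rw [shrinkVerts, essClasses, Finset.image_image]
  rfl

theorem mem_scc_self {V : Finset (Finset S)} {P : Finset S → Finset S → OrderClass I}
    {x : Finset S} (hx : x ∈ V) : x ∈ scc V P x := Finset.mem_filter.2 ⟨hx, .refl, .refl⟩

theorem subset_shrinkProj {V : Finset (Finset S)} {P : Finset S → Finset S → OrderClass I}
    {x : Finset S} (hx : x ∈ V) : x ⊆ shrinkProj V P x :=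
  Finset.subset_biUnion_of_mem id (mem_scc_self hx)

section Disjoint

variable {V : Finset (Finset S)} {P : Finset S → Finset S → OrderClass I}

/-- As the vertices are nonempty and disjoint, the union of a component determines its members. This
identifies the inclusions in `shrinkWeight` with the fibres of `shrinkProj`, as `Correct.of_merge`
requires. -/
theorem subset_shrinkProj_iff (hne : ∀ x ∈ V, x.Nonempty)
    (hdisj : ∀ x ∈ V, ∀ y ∈ V, x ≠ y → Disjoint x y) {v : Finset S} (x : Finset S)
    (hv : v ∈ V) :
    v ⊆ shrinkProj V P x ↔ v ∈ scc V P x := by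
  refine ⟨fun h => ?_, fun h => Finset.subset_biUnion_of_mem id h⟩
  obtain ⟨s, hs⟩ := hne v hv
  obtain ⟨u, hu, hsu⟩ := Finset.mem_biUnion.1 (h hs)
  have huV := (Finset.mem_filter.1 hu).1
  by_cases huv : v = u
  · exact huv ▸ hu
  · exact absurd hsu (Finset.disjoint_left.1 (hdisj v hv u huV huv) hs)

theorem shrinkProj_eq_iff (hne : ∀ x ∈ V, x.Nonempty)
    (hdisj : ∀ x ∈ V, ∀ y ∈ V, x ≠ y → Disjoint x y) {x y : Finset S} (hy : y ∈ V) :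
    shrinkProj V P x = shrinkProj V P y ↔ EssReach V P x y ∧ EssReach V P y x := by
  constructor
  · intro h
    have h1 : y ⊆ shrinkProj V P x := h ▸ subset_shrinkProj hy
    exact (Finset.mem_filter.1 ((subset_shrinkProj_iff hne hdisj x hy).1 h1)).2
  · rintro ⟨h1, h2⟩
    have : scc V P x = scc V P y := by
      refine Finset.filter_congr fun z _ => ?_
      exact ⟨fun h => ⟨h2.trans h.1, h.2.trans h1⟩, fun h => ⟨h1.trans h.1, h.2.trans h2⟩⟩
    rw [shrinkProj, shrinkProj, this]

theorem filter_subset_shrinkProj (hne : ∀ x ∈ V, x.Nonempty)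
    (hdisj : ∀ x ∈ V, ∀ y ∈ V, x ≠ y → Disjoint x y)
    {x : Finset S} (hx : IsEssential V P x) :
    V.filter (· ⊆ shrinkProj V P x) =
      (V.filter (IsEssential V P)).filter (shrinkProj V P · = shrinkProj V P x) := by
  ext v
  simp only [Finset.mem_filter]
  constructor
  · rintro ⟨hv, h⟩
    have h1 := (Finset.mem_filter.1 ((subset_shrinkProj_iff hne hdisj x hv).1 h)).2
    exact ⟨⟨hv, hx.of_reach h1.1⟩, (shrinkProj_eq_iff hne hdisj hx.1).2 h1.symm⟩
  · rintro ⟨⟨hv, -⟩, h⟩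
    exact ⟨hv, h ▸ subset_shrinkProj hv⟩

theorem shrinkProj_disjoint (hne : ∀ x ∈ V, x.Nonempty)
    (hdisj : ∀ x ∈ V, ∀ y ∈ V, x ≠ y → Disjoint x y) {x y : Finset S} (hy : y ∈ V)
    (h : shrinkProj V P x ≠ shrinkProj V P y) :
    Disjoint (shrinkProj V P x) (shrinkProj V P y) := by
  rw [Finset.disjoint_left]
  intro s hs hs'
  obtain ⟨u, hu, hsu⟩ := Finset.mem_biUnion.1 hs
  obtain ⟨v, hv, hsv⟩ := Finset.mem_biUnion.1 hs'
  obtain ⟨huV, hxu⟩ := Finset.mem_filter.1 hu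
  obtain ⟨hvV, hyv⟩ := Finset.mem_filter.1 hv
  have huv : u = v := by
    by_contra huv
    exact Finset.disjoint_left.1 (hdisj u huV v hvV huv) hsu hsv
  subst huv
  exact h ((shrinkProj_eq_iff hne hdisj hy).2 ⟨hxu.1.trans hyv.2, hyv.1.trans hxu.2⟩)

end Disjoint

/-- The algorithm terminates on graphs whose weights generate a totally ordered monoid, and
returns the union of the vertices that carry mass. -/
theorem exists_hubRec (hI : ∀ ε ∈ I, 0 < ε) (n : ℕ) : ∀ (Γ : Set (OrderClass I))
    (V : Finset (Finset S)) (P : Finset S → Finset S → OrderClass I), V.card = n →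
    IsTotalMonoid Γ → (∀ x ∈ V, ∀ y ∈ V, x ≠ y → P x y ∈ Γ) → (∀ x ∈ V, x.Nonempty) →
    (∀ x ∈ V, ∀ y ∈ V, x ≠ y → Disjoint x y) →
    ∃ K : Finset (Finset S), HubRec V P (K.biUnion id) ∧ Correct V P K := by
  induction n using Nat.strong_induction_on with
  | _ n ih =>
  intro Γ V P hn hΓ hP hne hdisj
  have hMle : ∀ x ∈ V, ∀ y ∈ V, x ≠ y → P x y ≤ maxLabel V P := fun x hx y hy hxy =>
    Finset.le_sup (f := fun e : Finset S × Finset S => P e.1 e.2) (b := (x, y))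
      (Finset.mem_offDiag.2 ⟨hx, hy, hxy⟩)
  by_cases hM : maxLabel V P = 0
  · exact ⟨V, .base V P hM, .of_zero V fun x hx y hy hxy =>
      le_antisymm (hM ▸ hMle x hx y hy hxy) (zero_le _)⟩
  have hPoff : ∀ e ∈ V.offDiag, P e.1 e.2 ∈ Γ := fun e he => by
    obtain ⟨h1, h2, h3⟩ := Finset.mem_offDiag.1 he
    exact hP _ h1 _ h2 h3
  obtain ⟨Γ', hΓ', hdiv⟩ := hΓ.exists_div hI (hΓ.finset_sup_mem hPoff : maxLabel V P ∈ Γ)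
  set P₁ := outScale V P with hP₁
  have hP₁eq : ∀ x ∈ V, ∀ y ∈ V, x ≠ y → P₁ x y = P x y / maxLabel V P :=
    fun x _ y _ hxy => if_neg hxy
  have hP₁Γ : ∀ x ∈ V, ∀ y ∈ V, x ≠ y → P₁ x y ∈ Γ' := fun x hx y hy hxy => by
    rw [hP₁eq x hx y hy hxy]
    exact hdiv _ (hP x hx y hy hxy) (hMle x hx y hy hxy)
  set E := V.filter (IsEssential V P₁) with hE
  set T := transients V P₁ with hT
  set π := shrinkProj V P₁ with hπ
  have hEV : E ⊆ V := Finset.filter_subset _ _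
  have hET : V \ T = E := by
    ext x
    simp only [hT, hE, transients, Finset.mem_sdiff, Finset.mem_filter]
    tauto
  have hEess : ∀ x ∈ E, IsEssential V P₁ x := fun x hx => (Finset.mem_filter.1 hx).2
  have hTV : T ⊆ V := Finset.filter_subset _ _
  have hV' : E.image π = shrinkVerts V P₁ := (shrinkVerts_eq V P₁).symm
  have hmaxΓ : ∀ x ∈ E, ∀ y ∈ E, x ≠ y → maxPath P₁ T x y ∈ Γ' := hET ▸ maxPath_mem hΓ' hP₁Γ hTV
  have hQ : ∀ i ∈ shrinkVerts V P₁, ∀ j ∈ shrinkVerts V P₁, i ≠ j → shrinkWeight V P₁ i j =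
      (E.filter (π · = i) ×ˢ E.filter (π · = j)).sup fun e => maxPath P₁ T e.1 e.2 := by
    intro i hi j hj _
    rw [← hV'] at hi hj
    obtain ⟨x, hx, rfl⟩ := Finset.mem_image.1 hi
    obtain ⟨y, hy, rfl⟩ := Finset.mem_image.1 hj
    rw [shrinkWeight, filter_subset_shrinkProj hne hdisj (hEess x hx),
      filter_subset_shrinkProj hne hdisj (hEess y hy)]
  -- After scaling a maximal arc has weight `1`. If no vertex were lost, all vertices would be
  -- essential and `π` injective; but the two ends of this arc would then lie in one component.
  have hcard : (shrinkVerts V P₁).card < n := by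
    have hoff : V.offDiag.Nonempty := by
      rw [Finset.nonempty_iff_ne_empty]
      intro h
      apply hM
      rw [maxLabel, h, Finset.sup_empty, bot_eq_zero]
    obtain ⟨⟨x, y⟩, he, hmax⟩ := hΓ.exists_max hPoff hoff
    obtain ⟨hx, hy, hxy⟩ := Finset.mem_offDiag.1 he
    have hPM : P x y = maxLabel V P := le_antisymm (hMle x hx y hy hxy) (Finset.sup_le hmax)
    have harc : EssArc V P₁ x y :=
      ⟨hx, hy, hxy, by rw [hP₁eq x hx y hy hxy, hPM, div_self_eq_one]⟩
    rw [← hV', ← hn]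
    refine lt_of_le_of_ne (Finset.card_image_le.trans (Finset.card_le_card hEV)) fun heq => ?_
    have h1 : E = V := Finset.eq_of_subset_of_card_le hEV (heq ▸ Finset.card_image_le)
    have h2 : (E.image π).card = E.card := by rw [heq, h1]
    have hxE : x ∈ E := h1 ▸ hx
    have hyE : y ∈ E := h1 ▸ hy
    refine hxy (Finset.card_image_iff.1 h2 hxE hyE ?_)
    have hr : EssReach V P₁ x y := .single harc
    exact (shrinkProj_eq_iff hne hdisj hy).2 ⟨hr, (hEess x hxE).2 y hr⟩
  obtain ⟨K, hK, hcor⟩ := ih _ hcard Γ' (shrinkVerts V P₁) (shrinkWeight V P₁) rfl hΓ'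
    (fun i hi j hj hij => by
      rw [hQ i hi j hj hij]
      refine hΓ'.finset_sup_mem fun e he => ?_
      obtain ⟨h1, h2⟩ := Finset.mem_product.1 he
      obtain ⟨h1, h1'⟩ := Finset.mem_filter.1 h1
      obtain ⟨h2, h2'⟩ := Finset.mem_filter.1 h2
      exact hmaxΓ _ h1 _ h2 fun h => hij (by rw [← h1', ← h2', h]))
    (fun i hi => by
      rw [← hV'] at hi
      obtain ⟨x, hx, rfl⟩ := Finset.mem_image.1 hi
      exact (hne x (hEV hx)).mono (subset_shrinkProj (hEV hx)))
    (fun i hi j hj hij => by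
      rw [← hV'] at hi hj
      obtain ⟨x, hx, rfl⟩ := Finset.mem_image.1 hi
      obtain ⟨y, hy, rfl⟩ := Finset.mem_image.1 hj
      exact shrinkProj_disjoint hne hdisj (hEV hy) hij)
  refine ⟨E.filter (π · ∈ K), ?_, ?_⟩
  · have hU : (E.filter (π · ∈ K)).biUnion id = K.biUnion id := by
      ext s
      simp only [Finset.mem_biUnion, Finset.mem_filter, id]
      constructor
      · rintro ⟨x, ⟨hx, hxK⟩, hs⟩
        exact ⟨π x, hxK, subset_shrinkProj (hEV hx) hs⟩
      · rintro ⟨i, hi, hs⟩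
        have hi' := hcor.subset hi
        rw [← hV'] at hi'
        obtain ⟨x, hx, rfl⟩ := Finset.mem_image.1 hi'
        obtain ⟨v, hv, hsv⟩ := Finset.mem_biUnion.1 hs
        obtain ⟨hvV, hxv⟩ := Finset.mem_filter.1 hv
        have hvE : v ∈ E := Finset.mem_filter.2 ⟨hvV, (hEess x hx).of_reach hxv.1⟩
        refine ⟨v, ⟨hvE, ?_⟩, hsv⟩
        rwa [hπ, (shrinkProj_eq_iff hne hdisj (hEV hx)).2 hxv.symm]
    rw [hU]
    exact .step V P _ hM hK
  · have hmerge : Correct E (maxPath P₁ T) (E.filter (π · ∈ K)) := by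
      refine Correct.of_merge hV' hQ (fun x hx y hy hxy => ?_) hcor
      -- A path of weight `1` that starts at an essential vertex never leaves the essential
      -- vertices, so it survives in the digraph without `T`.
      have hr := ((shrinkProj_eq_iff hne hdisj (hEV hy)).1 hxy).1
      clear hxy hy
      induction hr with
      | refl => exact .refl
      | @tail u v hxu huv ih =>
        have hu := (hEess x hx).of_reach hxu
        refine ih.tail ⟨Finset.mem_filter.2 ⟨hu.1, hu⟩, ?_, huv.2.2.1, ?_⟩
        · have hv := hu.of_reach (.single huv)
          exact Finset.mem_filter.2 ⟨hv.1, hv⟩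
        · exact eq_one_of_le (huv.2.2.2 ▸ le_maxPath P₁ T u v)
    rw [← hET] at hmerge
    refine Correct.of_div hMle hP₁eq (Correct.of_maxPath hI hΓ' hTV hP₁Γ ?_ ?_ (hET ▸ hmerge))
    · intro t ht
      obtain ⟨y, hy, hty⟩ := exists_essential V P₁ (hTV ht)
      exact ⟨y, hET ▸ Finset.mem_filter.2 ⟨hy.1, hy⟩, hty⟩
    · intro e he t ht h1
      rw [hET] at he
      have het : e ≠ t := fun h => (Finset.mem_filter.1 ht).2 (h ▸ hEess e he)
      exact (Finset.mem_filter.1 ht).2 ((hEess e he).of_reach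
        (.single ⟨hEV he, hTV ht, het, h1⟩))

theorem exists_hub [Fintype S] [DecidableEq S] {p : Perturbation I S} (hp : p.Comparable) :
    ∃ H : Finset S, Hub p.classes H ∧ ∀ x : S, p.Stable x ↔ x ∈ H := by
  obtain ⟨Γ, hΓ, hpΓ⟩ := hp.exists_total
  have hmem : ∀ {a : Finset S}, a ∈ Finset.univ.image (fun s : S => ({s} : Finset S)) →
      ∃ s : S, {s} = a := fun h => by simpa using h
  set P : Finset S → Finset S → OrderClass I :=
    fun a b => (a ×ˢ b).sup fun e => p.classes e.1 e.2 with hPdef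
  have hP : ∀ x y : S, P {x} {y} = p.classes x y := fun x y => by
    simp only [hPdef, Finset.singleton_product_singleton, Finset.sup_singleton]
  obtain ⟨K, hK, hcor⟩ := exists_hubRec p.pos _ Γ
    (Finset.univ.image fun s : S => ({s} : Finset S)) P rfl hΓ
    (fun a ha b hb hab => by
      obtain ⟨x, rfl⟩ := hmem ha
      obtain ⟨y, rfl⟩ := hmem hb
      rw [hP]
      exact hpΓ x y fun h => hab (by rw [h]))
    (fun a ha => by
      obtain ⟨x, rfl⟩ := hmem ha
      exact Finset.singleton_nonempty x)
    (fun a ha b hb hab => by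
      obtain ⟨x, rfl⟩ := hmem ha
      obtain ⟨y, rfl⟩ := hmem hb
      exact Finset.disjoint_singleton.2 fun h => hab (by rw [h]))
  refine ⟨K.biUnion id, ?_, fun x => ?_⟩
  · unfold Hub
    convert hK
  · rw [Correct.stable_iff Finset.singleton_injective (fun x y _ => hP x y) hcor x]
    simp only [Finset.mem_biUnion, id]
    constructor
    · exact fun h => ⟨{x}, h, Finset.mem_singleton_self x⟩
    · rintro ⟨a, ha, hxa⟩
      obtain ⟨y, rfl⟩ := hmem (hcor.subset ha)
      rwa [Finset.mem_singleton.1 hxa]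

end Hub

end StochStab

namespace StochStab

open OrderClass

/-! ### A program logic for random access machines -/

section Run

variable {F : Type*}

/-- Assignment to an integer register. -/
def Mem.setReg (m : Mem F) (r v : ℕ) : Mem F := { m with reg := Function.update m.reg r v }

/-- Assignment to a weight register. -/
def Mem.setWreg (m : Mem F) (r : ℕ) (v : F) : Mem F := { m with wreg := Function.update m.wreg r v }

/-- Assignment to a cell of an integer array. -/
def Mem.setArr (m : Mem F) (a i j v : ℕ) : Mem F := { m with arr := setCell m.arr a i j v }

/-- Assignment to a cell of a weight array. -/
def Mem.setWarr (m : Mem F) (a i j : ℕ) (v : F) : Mem F :=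
  { m with warr := setCell m.warr a i j v }

theorem setCell_apply {α : Type*} (A : ℕ → ℕ → ℕ → α) (a i j : ℕ) (v : α) (a' i' j' : ℕ) :
    setCell A a i j v a' i' j' = if a' = a ∧ i' = i ∧ j' = j then v else A a' i' j' := by
  simp only [setCell, Function.update_apply]
  by_cases h1 : a' = a
  · subst h1
    by_cases h2 : i' = i
    · subst h2
      by_cases h3 : j' = j <;> simp [h3]
    · simp [h2]
  · simp [h1]

namespace Mem

variable (m : Mem F)

@[simp] theorem setReg_reg (r v s : ℕ) : (m.setReg r v).reg s = if s = r then v else m.reg s :=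
  Function.update_apply _ _ _ _
@[simp] theorem setReg_wreg (r v : ℕ) : (m.setReg r v).wreg = m.wreg := rfl
@[simp] theorem setReg_arr (r v : ℕ) : (m.setReg r v).arr = m.arr := rfl
@[simp] theorem setReg_warr (r v : ℕ) : (m.setReg r v).warr = m.warr := rfl
@[simp] theorem setWreg_reg (r : ℕ) (v : F) : (m.setWreg r v).reg = m.reg := rfl
@[simp] theorem setWreg_wreg (r : ℕ) (v : F) (s : ℕ) :
    (m.setWreg r v).wreg s = if s = r then v else m.wreg s := Function.update_apply _ _ _ _
@[simp] theorem setWreg_arr (r : ℕ) (v : F) : (m.setWreg r v).arr = m.arr := rfl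
@[simp] theorem setWreg_warr (r : ℕ) (v : F) : (m.setWreg r v).warr = m.warr := rfl
@[simp] theorem setArr_reg (a i j v : ℕ) : (m.setArr a i j v).reg = m.reg := rfl
@[simp] theorem setArr_wreg (a i j v : ℕ) : (m.setArr a i j v).wreg = m.wreg := rfl
@[simp] theorem setArr_arr (a i j v a' i' j' : ℕ) : (m.setArr a i j v).arr a' i' j' =
    if a' = a ∧ i' = i ∧ j' = j then v else m.arr a' i' j' := setCell_apply _ _ _ _ _ _ _ _
@[simp] theorem setArr_warr (a i j v : ℕ) : (m.setArr a i j v).warr = m.warr := rfl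
@[simp] theorem setWarr_reg (a i j : ℕ) (v : F) : (m.setWarr a i j v).reg = m.reg := rfl
@[simp] theorem setWarr_wreg (a i j : ℕ) (v : F) : (m.setWarr a i j v).wreg = m.wreg := rfl
@[simp] theorem setWarr_arr (a i j : ℕ) (v : F) : (m.setWarr a i j v).arr = m.arr := rfl
@[simp] theorem setWarr_warr (a i j : ℕ) (v : F) (a' i' j' : ℕ) :
    (m.setWarr a i j v).warr a' i' j' =
      if a' = a ∧ i' = i ∧ j' = j then v else m.warr a' i' j' := setCell_apply _ _ _ _ _ _ _ _

end Mem

variable [Zero F] [One F] [Mul F] [Div F] [LE F]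

/-- Started in `m`, the program `c` halts within `t` steps in a memory satisfying `Q`. -/
def Run (c : Prog) (t : ℕ) (m : Mem F) (Q : Mem F → Prop) : Prop :=
  ∃ s m', Exec c m s m' ∧ s ≤ t ∧ Q m'

namespace Run

variable {c d : Prog} {t u : ℕ} {m : Mem F} {Q Q' : Mem F → Prop}

theorem mono (h : Run c t m Q) (htu : t ≤ u) (hQ : ∀ m', Q m' → Q' m') : Run c u m Q' := by
  obtain ⟨s, m', he, hs, hq⟩ := h
  exact ⟨s, m', he, hs.trans htu, hQ m' hq⟩

theorem weaken (h : Run c t m Q) (htu : t ≤ u) : Run c u m Q := h.mono htu fun _ => id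

theorem seq (h : Run c t m fun m' => Run d u m' Q) : Run (.seq c d) (t + u) m Q := by
  obtain ⟨s, m₁, h1, hs, s', m₂, h2, hs', hq⟩ := h
  exact ⟨s + s', m₂, .seq c d _ _ _ _ _ h1 h2, add_le_add hs hs', hq⟩

theorem const {r k : ℕ} (h : Q (m.setReg r k)) : Run (.const r k) 1 m Q :=
  ⟨1, _, .const m r k, le_rfl, h⟩

theorem copy {r s : ℕ} (h : Q (m.setReg r (m.reg s))) : Run (.copy r s) 1 m Q :=
  ⟨1, _, .copy m r s, le_rfl, h⟩

theorem succ {r : ℕ} (h : Q (m.setReg r (m.reg r + 1))) : Run (.succ r) 1 m Q :=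
  ⟨1, _, .succ m r, le_rfl, h⟩

theorem pred {r : ℕ} (h : Q (m.setReg r (m.reg r - 1))) : Run (.pred r) 1 m Q :=
  ⟨1, _, .pred m r, le_rfl, h⟩

theorem load {r a i j : ℕ} (h : Q (m.setReg r (m.arr a (m.reg i) (m.reg j)))) :
    Run (.load r a i j) 1 m Q := ⟨1, _, .load m r a i j, le_rfl, h⟩

theorem store {a i j r : ℕ} (h : Q (m.setArr a (m.reg i) (m.reg j) (m.reg r))) :
    Run (.store a i j r) 1 m Q := ⟨1, _, .store m a i j r, le_rfl, h⟩

theorem wzero {r : ℕ} (h : Q (m.setWreg r 0)) : Run (.wzero r) 1 m Q :=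
  ⟨1, _, .wzero m r, le_rfl, h⟩

theorem wone {r : ℕ} (h : Q (m.setWreg r 1)) : Run (.wone r) 1 m Q :=
  ⟨1, _, .wone m r, le_rfl, h⟩

theorem wcopy {r s : ℕ} (h : Q (m.setWreg r (m.wreg s))) : Run (.wcopy r s) 1 m Q :=
  ⟨1, _, .wcopy m r s, le_rfl, h⟩

theorem wmul {r s s' : ℕ} (h : Q (m.setWreg r (m.wreg s * m.wreg s'))) :
    Run (.wmul r s s') 1 m Q := ⟨1, _, .wmul m r s s', le_rfl, h⟩

theorem wdiv {r s s' : ℕ} (hle : m.wreg s ≤ m.wreg s')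
    (h : Q (m.setWreg r (m.wreg s / m.wreg s'))) : Run (.wdiv r s s') 1 m Q :=
  ⟨1, _, .wdiv m r s s' hle, le_rfl, h⟩

theorem wload {r a i j : ℕ} (h : Q (m.setWreg r (m.warr a (m.reg i) (m.reg j)))) :
    Run (.wload r a i j) 1 m Q := ⟨1, _, .wload m r a i j, le_rfl, h⟩

theorem wstore {a i j r : ℕ} (h : Q (m.setWarr a (m.reg i) (m.reg j) (m.wreg r))) :
    Run (.wstore a i j r) 1 m Q := ⟨1, _, .wstore m a i j r, le_rfl, h⟩

theorem iflt {r s : ℕ} (hc : m.reg r < m.reg s → Run c t m Q)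
    (hd : ¬ m.reg r < m.reg s → Run d t m Q) : Run (.iflt r s c d) (t + 1) m Q := by
  by_cases h : m.reg r < m.reg s
  · obtain ⟨x, m', he, hx, hq⟩ := hc h
    exact ⟨x + 1, m', .iflt_true r s c d m m' x h he, by lia, hq⟩
  · obtain ⟨x, m', he, hx, hq⟩ := hd h
    exact ⟨x + 1, m', .iflt_false r s c d m m' x h he, by lia, hq⟩

theorem ifwle {r s : ℕ} (hc : m.wreg r ≤ m.wreg s → Run c t m Q)
    (hd : ¬ m.wreg r ≤ m.wreg s → Run d t m Q) : Run (.ifwle r s c d) (t + 1) m Q := by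
  by_cases h : m.wreg r ≤ m.wreg s
  · obtain ⟨x, m', he, hx, hq⟩ := hc h
    exact ⟨x + 1, m', .ifwle_true r s c d m m' x h he, by lia, hq⟩
  · obtain ⟨x, m', he, hx, hq⟩ := hd h
    exact ⟨x + 1, m', .ifwle_false r s c d m m' x h he, by lia, hq⟩

theorem while_true {r s : ℕ} (h : m.reg r < m.reg s)
    (hc : Run c t m fun m' => Run (.whilelt r s c) u m' Q) :
    Run (.whilelt r s c) (t + u + 1) m Q := by
  obtain ⟨x, m₁, h1, hx, y, m₂, h2, hy, hq⟩ := hc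
  exact ⟨x + y + 1, m₂, .whilelt_true r s c _ _ _ _ _ h h1 h2, by lia, hq⟩

theorem while_false {r s : ℕ} (h : ¬ m.reg r < m.reg s) (hq : Q m) :
    Run (.whilelt r s c) 1 m Q := ⟨1, m, .whilelt_false r s c m h, le_rfl, hq⟩

end Run

/-- No operation. -/
def Prog.skip : Prog := .copy 6 6

/-- A loop in which register `r` runs from `0` to the content of register `0`. -/
def Prog.loop (r : ℕ) (c : Prog) : Prog := .seq (.const r 0) (.whilelt r 0 (.seq c (.succ r)))

/-- A loop over the pairs `(i, j)`, kept in the registers `3` and `4`, for which the cell `[i][j]`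
of array `1` holds `0`. -/
def Prog.pairs (c : Prog) : Prog :=
  .loop 3 (.loop 4 (.seq (.load 6 1 3 4) (.iflt 1 6 .skip c)))

/-- Each round costs `2` steps beyond the body, for the test and the increment; the initial
assignment and the last test account for the final `2`. The invariant must not depend on the loop
register, which is the content of `hscr`. -/
theorem Run.loop {r n t : ℕ} {c : Prog} {Inv : ℕ → Mem F → Prop}
    (hn : ∀ i m, Inv i m → m.reg 0 = n) (hscr : ∀ i m v, Inv i m → Inv i (m.setReg r v))
    (hbody : ∀ i m, i < n → Inv i m → m.reg r = i →
      Run c t m fun m' => m'.reg r = i ∧ Inv (i + 1) m')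
    (m : Mem F) (h : Inv 0 m) : Run (.loop r c) (n * (t + 2) + 2) m (Inv n) := by
  have key : ∀ d i, i + d = n → ∀ m : Mem F, Inv i m → m.reg r = i →
      Run (.whilelt r 0 (.seq c (.succ r))) (d * (t + 2) + 1) m (Inv n) := by
    intro d
    induction d with
    | zero =>
      intro i hi m hm hmr
      obtain rfl : i = n := by lia
      refine (Run.while_false ?_ hm).weaken (by lia)
      rw [hmr, hn i m hm]
      exact lt_irrefl i
    | succ d ih =>
      intro i hi m hm hmr
      have hin : i < n := by lia
      refine (Run.while_true (t := t + 1) (u := d * (t + 2) + 1) ?_ (Run.seq ?_)).weaken ?_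
      · rw [hmr, hn i m hm]
        exact hin
      · refine (hbody i m hin hm hmr).mono le_rfl fun m' hm' => Run.succ ?_
        refine ih (i + 1) (by lia) _ (hscr _ _ _ hm'.2) ?_
        simp [hm'.1]
      · ring_nf
        lia
  refine Run.weaken (t := 1 + (n * (t + 2) + 1)) (Run.seq (Run.const ?_)) (by lia)
  exact key n 0 (by lia) _ (hscr _ _ _ h) (by simp)

/-- The inner body costs `t + 2`, for loading the mark, testing it and running `c` or `skip`, whence
`1 ≤ t`. The invariant passes from the end of a row to the beginning of the next by `hrow`. -/
theorem Run.pairs {n t : ℕ} {c : Prog} {Act : ℕ → ℕ → Prop} {Inv : ℕ → ℕ → Mem F → Prop}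
    (ht : 1 ≤ t)
    (hscr : ∀ i j m r v, r = 3 ∨ r = 4 ∨ r = 6 → Inv i j m → Inv i j (m.setReg r v))
    (hbase : ∀ i j m, Inv i j m → m.reg 0 = n ∧ m.reg 1 = 0 ∧
      ∀ a < n, ∀ b < n, (m.arr 1 a b = 0 ↔ Act a b))
    (hrow : ∀ i m, Inv i n m → Inv (i + 1) 0 m)
    (hskip : ∀ i j m, ¬ Act i j → Inv i j m → Inv i (j + 1) m)
    (hbody : ∀ i j m, i < n → j < n → Act i j → Inv i j m → m.reg 3 = i → m.reg 4 = j →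
      Run c t m fun m' => m'.reg 3 = i ∧ m'.reg 4 = j ∧ Inv i (j + 1) m')
    (m : Mem F) (h : Inv 0 0 m) :
    Run (.pairs c) (n * (n * (t + 4) + 4) + 2) m (Inv n 0) := by
  refine Run.loop (Inv := fun i => Inv i 0) (fun i m h => (hbase i 0 m h).1)
    (fun i m v h => hscr i 0 m 3 v (Or.inl rfl) h) (fun i m hi hm hmi => ?_) m h
  refine Run.mono (Run.loop (Inv := fun j m => m.reg 3 = i ∧ Inv i j m) (t := 1 + (t + 1)) (r := 4)
    (n := n) (fun j m h => (hbase i j m h.2).1)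
    (fun j m v h => ⟨by simpa using h.1, hscr i j m 4 v (by simp) h.2⟩) ?_ m ⟨hmi, hm⟩) ?_
    fun m' hm' => ⟨hm'.1, hrow i m' hm'.2⟩
  · rintro j m hj ⟨hmi, hm⟩ hmj
    obtain ⟨-, h1, hact⟩ := hbase i j m hm
    refine Run.seq (Run.load ?_)
    have hm6 := hscr i j m 6 (m.arr 1 (m.reg 3) (m.reg 4)) (by simp) hm
    refine Run.iflt (fun hlt => ?_) (fun hlt => ?_)
    · refine Run.weaken (Run.copy ?_) ht
      refine ⟨by simpa using hmj, by simpa using hmi, hskip _ _ _ ?_ (hscr i j _ 6 _ (by simp) hm6)⟩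
      intro ha
      rw [← hact i hi j hj] at ha
      simp [h1, hmi, hmj, ha] at hlt
    · have ha : Act i j := by
        rw [← hact i hi j hj]
        simpa [h1, hmi, hmj] using hlt
      refine (hbody i j _ hi hj ha hm6 (by simpa using hmi) (by simpa using hmj)).mono le_rfl ?_
      exact fun m' hm' => ⟨hm'.2.1, hm'.1, hm'.2.2⟩
  · have : 1 + (t + 1) + 2 = t + 4 := by lia
    rw [this]

end Run

end StochStab

namespace StochStab

open OrderClass

/-! ### The program

Integer registers: `0` holds `n`, `1` holds `0`, `2` counts the eliminated vertices, `3` and `4` are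
loop variables, `5` holds the vertex to be eliminated, `6` is a scratch register, `7` counts the
rounds, `8` holds `1`. Weight registers: `0` holds the maximal weight, `1` and `2` are scratch
registers, `3` holds `0`, `4` holds `1`. Array `0` holds the answer, array `1` marks the pairs that
are not arcs between distinct remaining vertices, array `2` lists the eliminated vertices. -/

namespace Prog

/-- Initialization. -/
def init : Prog :=
  .seq (.wone 4) (.seq (.const 8 1) (.loop 3 (.seq (.store 1 3 3 8) (.store 0 3 1 8))))

/-- Search for the maximal weight `M` of the arcs and for the source of such an arc. -/
def findMax : Prog :=
  .seq (.wzero 0) (.pairs (.seq (.wload 1 0 3 4)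
    (.ifwle 1 0 .skip (.seq (.wcopy 0 1) (.copy 5 3)))))

/-- Division of all weights by `M`. -/
def scale : Prog := .pairs (.seq (.wload 1 0 3 4) (.seq (.wdiv 1 1 0) (.wstore 0 3 4 1)))

/-- Removal of the vertex in register `5`. -/
def remove : Prog :=
  .seq (.loop 3 (.seq (.store 1 3 5 8) (.store 1 5 3 8)))
    (.seq (.store 2 2 1 5) (.seq (.store 0 5 1 1) (.succ 2)))

/-- Update of the weights of the remaining arcs by those of the paths through the removed
vertex. -/
def shortcut : Prog :=
  .pairs (.seq (.wload 1 0 3 5) (.seq (.wload 2 0 5 4) (.seq (.wmul 1 1 2)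
    (.seq (.wload 2 0 3 4) (.ifwle 1 2 .skip (.wstore 0 3 4 1))))))

/-- One round of elimination. -/
def round : Prog := .seq findMax (.ifwle 0 3 .skip (.seq scale (.seq remove shortcut)))

/-- Decision about the most recently eliminated vertex whose status is unknown. -/
def decideLast : Prog :=
  .seq (.pred 2) (.seq (.load 5 2 2 1) (.loop 3 (.seq (.load 6 0 3 1)
    (.iflt 1 6 (.seq (.wload 1 0 3 5) (.ifwle 4 1 (.store 0 5 1 8) .skip)) .skip))))

/-- The program that decides stability. -/
def stability : Prog := .seq init (.seq (.loop 7 round) (.whilelt 1 2 decideLast))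

end Prog

section Program

variable {I : Set ℝ}

/-- The state of the memory between the phases of the program: `k` vertices have been eliminated,
`V` is the set of the remaining ones, and `H` is the set marked in the output array. -/
structure Core (n k : ℕ) (V H : Finset ℕ) (m : Mem (OrderClass I)) : Prop where
  reg0 : m.reg 0 = n
  reg1 : m.reg 1 = 0
  reg2 : m.reg 2 = k
  reg8 : m.reg 8 = 1
  wreg3 : m.wreg 3 = 0
  wreg4 : m.wreg 4 = 1
  act : ∀ i < n, ∀ j < n, (m.arr 1 i j = 0 ↔ i ∈ V ∧ j ∈ V ∧ i ≠ j)
  out : ∀ i, m.arr 0 i 0 = if i ∈ H then 1 else 0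

namespace Core

variable {n k : ℕ} {V H : Finset ℕ} {m : Mem (OrderClass I)}

theorem setReg (h : Core n k V H m) {r : ℕ} (hr : r = 3 ∨ r = 4 ∨ r = 5 ∨ r = 6 ∨ r = 7) (v : ℕ) :
    Core n k V H (m.setReg r v) := by
  refine ⟨?_, ?_, ?_, ?_, h.wreg3, h.wreg4, h.act, h.out⟩
  · rw [Mem.setReg_reg, if_neg (by lia)]; exact h.reg0
  · rw [Mem.setReg_reg, if_neg (by lia)]; exact h.reg1
  · rw [Mem.setReg_reg, if_neg (by lia)]; exact h.reg2
  · rw [Mem.setReg_reg, if_neg (by lia)]; exact h.reg8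

theorem setWreg (h : Core n k V H m) {r : ℕ} (hr : r < 3) (v : OrderClass I) :
    Core n k V H (m.setWreg r v) := by
  refine ⟨h.reg0, h.reg1, h.reg2, h.reg8, ?_, ?_, h.act, h.out⟩
  · rw [Mem.setWreg_wreg, if_neg (by lia)]; exact h.wreg3
  · rw [Mem.setWreg_wreg, if_neg (by lia)]; exact h.wreg4

theorem setWarr (h : Core n k V H m) (a i j : ℕ) (v : OrderClass I) :
    Core n k V H (m.setWarr a i j v) :=
  ⟨h.reg0, h.reg1, h.reg2, h.reg8, h.wreg3, h.wreg4, h.act, h.out⟩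

end Core

/-- `(a, b)` precedes `(i, j)` in the order in which pairs are visited. -/
def Before (i j a b : ℕ) : Prop := a < i ∨ (a = i ∧ b < j)

theorem before_row {n i a b : ℕ} (hb : b < n) (h : Before (i + 1) 0 a b) : Before i n a b := by
  unfold Before at *; lia

theorem before_succ {i j a b : ℕ} (h : Before i (j + 1) a b) : Before i j a b ∨ a = i ∧ b = j := by
  unfold Before at *; lia

theorem Before.succ {i j a b : ℕ} (h : Before i j a b) : Before i (j + 1) a b := by
  unfold Before at *; lia

theorem Before.row {n i a b : ℕ} (h : Before i n a b) : Before (i + 1) 0 a b := by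
  unfold Before at *; lia

theorem not_before_self (i j : ℕ) : ¬ Before i j i j := by
  unfold Before; lia

theorem not_before_zero (a b : ℕ) : ¬ Before 0 0 a b := by
  unfold Before; lia

theorem before_end {n a b : ℕ} (ha : a < n) : Before n 0 a b := Or.inl ha

/-- A loop over the arcs that replaces their weights one by one. -/
theorem run_update {n k t : ℕ} {V H : Finset ℕ} {c : Prog} (ht : 1 ≤ t)
    (hV : V ⊆ Finset.range n) {X Y : ℕ → ℕ → OrderClass I} {R : Mem (OrderClass I) → Prop}
    (hR : ∀ m r v, r = 3 ∨ r = 4 ∨ r = 6 → R m → R (m.setReg r v))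
    (hbody : ∀ i j m, i ∈ V → j ∈ V → i ≠ j → Core n k V H m → R m → m.reg 3 = i → m.reg 4 = j →
      -- The body may rely on the old values of its own cell and of all cells that are not arcs. The
      -- latter never change during the loop, so updating in place is harmless.
      (∀ a b, ¬ (a ∈ V ∧ b ∈ V ∧ a ≠ b) ∨ (a = i ∧ b = j) → m.warr 0 a b = X a b) →
      Run c t m fun m' => m'.reg 3 = i ∧ m'.reg 4 = j ∧ Core n k V H m' ∧ R m' ∧
        ∀ a b, m'.warr 0 a b = if a = i ∧ b = j then Y a b else m.warr 0 a b)
    (m : Mem (OrderClass I)) (hm : Core n k V H m) (hRm : R m) (hX : m.warr 0 = X) :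
    Run (.pairs c) (n * (n * (t + 4) + 4) + 2) m fun m' => Core n k V H m' ∧ R m' ∧
      (∀ a ∈ V, ∀ b ∈ V, a ≠ b → m'.warr 0 a b = Y a b) ∧
      ∀ a b, ¬ (a ∈ V ∧ b ∈ V ∧ a ≠ b) → m'.warr 0 a b = X a b := by
  have hlt : ∀ a ∈ V, a < n := fun a ha => Finset.mem_range.1 (hV ha)
  refine Run.mono (Run.pairs (Act := fun i j => i ∈ V ∧ j ∈ V ∧ i ≠ j) (n := n)
    (Inv := fun i j m => Core n k V H m ∧ R m ∧
      (∀ a b, a ∈ V ∧ b ∈ V ∧ a ≠ b → Before i j a b → m.warr 0 a b = Y a b) ∧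
      ∀ a b, (a ∈ V ∧ b ∈ V ∧ a ≠ b → ¬ Before i j a b) → m.warr 0 a b = X a b) ht
    ?_ ?_ ?_ ?_ ?_ m ⟨hm, hRm, ?_, ?_⟩) le_rfl ?_
  · rintro i j m r v hr ⟨h1, h2, h3, h4⟩
    exact ⟨h1.setReg (by lia) v, hR m r v hr h2, h3, h4⟩
  · rintro i j m ⟨h1, -⟩
    exact ⟨h1.reg0, h1.reg1, h1.act⟩
  · rintro i m ⟨h1, h2, h3, h4⟩
    exact ⟨h1, h2, fun a b hab hb => h3 a b hab (before_row (hlt b hab.2.1) hb),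
      fun a b hab => h4 a b fun h hb => hab h hb.row⟩
  · rintro i j m hact ⟨h1, h2, h3, h4⟩
    refine ⟨h1, h2, fun a b hab hb => ?_, fun a b hab => h4 a b fun h hb => hab h hb.succ⟩
    rcases before_succ hb with hb | ⟨rfl, rfl⟩
    · exact h3 a b hab hb
    · exact absurd hab hact
  · rintro i j m hi hj ⟨hiV, hjV, hij⟩ ⟨h1, h2, h3, h4⟩ hm3 hm4
    refine (hbody i j m hiV hjV hij h1 h2 hm3 hm4 ?_).mono le_rfl ?_
    · rintro a b (hab | ⟨rfl, rfl⟩)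
      · exact h4 a b fun h => absurd h hab
      · exact h4 a b fun _ => not_before_self a b
    · rintro m' ⟨h5, h6, h7, h8, h9⟩
      refine ⟨h5, h6, h7, h8, fun a b hab hb => ?_, fun a b hab => ?_⟩
      · rw [h9]
        split_ifs with he
        · rfl
        · exact h3 a b hab ((before_succ hb).resolve_right he)
      · rw [h9, if_neg, h4 a b fun h hb => hab h hb.succ]
        rintro ⟨rfl, rfl⟩
        exact hab ⟨hiV, hjV, hij⟩ (by unfold Before; lia)
  · exact fun a b _ hb => absurd hb (not_before_zero a b)
  · exact fun a b _ => by rw [hX]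
  · rintro m' ⟨h1, h2, h3, h4⟩
    exact ⟨h1, h2, fun a ha b hb hab => h3 a b ⟨ha, hb, hab⟩ (before_end (hlt a ha)),
      fun a b hab => h4 a b fun h => absurd h hab⟩

/-- The running maximum is `0` or the weight of an arc, hence stays in `Γ`. By totality a failed
comparison with it means the opposite inequality, so the maximum may be replaced. -/
theorem run_findMax {n k : ℕ} {V H : Finset ℕ} {Γ : Set (OrderClass I)} (hΓ : IsTotalMonoid Γ)
    (hV : V ⊆ Finset.range n) {X : ℕ → ℕ → OrderClass I} {O : ℕ → ℕ → ℕ}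
    (hX : ∀ x ∈ V, ∀ y ∈ V, x ≠ y → X x y ∈ Γ) (m : Mem (OrderClass I)) (hm : Core n k V H m)
    (hmX : m.warr 0 = X) (hmO : m.arr 2 = O) {r : ℕ} (hr : m.reg 7 = r) :
    Run .findMax (1 + (n * (n * (4 + 4) + 4) + 2)) m fun m' => Core n k V H m' ∧ m'.warr 0 = X ∧
      m'.arr 2 = O ∧ m'.reg 7 = r ∧ (∀ a ∈ V, ∀ b ∈ V, a ≠ b → X a b ≤ m'.wreg 0) ∧
      (m'.wreg 0 = 0 ∨ ∃ b ∈ V, m'.reg 5 ∈ V ∧ m'.reg 5 ≠ b ∧ X (m'.reg 5) b = m'.wreg 0) := by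
  have hlt : ∀ a ∈ V, a < n := fun a ha => Finset.mem_range.1 (hV ha)
  refine Run.seq (Run.wzero (Run.mono (Run.pairs (Act := fun i j => i ∈ V ∧ j ∈ V ∧ i ≠ j) (n := n)
    (Inv := fun i j m => Core n k V H m ∧ m.warr 0 = X ∧ m.arr 2 = O ∧ m.reg 7 = r ∧
      (∀ a b, a ∈ V ∧ b ∈ V ∧ a ≠ b → Before i j a b → X a b ≤ m.wreg 0) ∧
      (m.wreg 0 = 0 ∨ ∃ b ∈ V, m.reg 5 ∈ V ∧ m.reg 5 ≠ b ∧ X (m.reg 5) b = m.wreg 0))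
    (by norm_num) ?_ ?_ ?_ ?_ ?_ _ ⟨hm.setWreg (by norm_num) _, hmX, hmO, hr, ?_, ?_⟩) le_rfl ?_))
  · rintro i j m r v hr ⟨h1, h2, h3, h4, h5, h6⟩
    refine ⟨h1.setReg (by lia) v, h2, h3, ?_, h5, ?_⟩
    · rw [Mem.setReg_reg, if_neg (by lia)]; exact h4
    · rw [Mem.setReg_reg, if_neg (by lia)]; exact h6
  · rintro i j m ⟨h1, -⟩
    exact ⟨h1.reg0, h1.reg1, h1.act⟩
  · rintro i m ⟨h1, h2, h3, h4, h5, h6⟩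
    exact ⟨h1, h2, h3, h4, fun a b hab hb => h5 a b hab (before_row (hlt b hab.2.1) hb), h6⟩
  · rintro i j m hact ⟨h1, h2, h3, h4, h5, h6⟩
    refine ⟨h1, h2, h3, h4, fun a b hab hb => ?_, h6⟩
    rcases before_succ hb with hb | ⟨rfl, rfl⟩
    · exact h5 a b hab hb
    · exact absurd hab hact
  · rintro i j m hi hj ⟨hiV, hjV, hij⟩ ⟨h1, h2, h3, h4, h5, h6⟩ hm3 hm4
    have hval : m.warr 0 (m.reg 3) (m.reg 4) = X i j := by rw [h2, hm3, hm4]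
    have hΓ0 : m.wreg 0 ∈ Γ := by
      rcases h6 with h6 | ⟨b, hb, h7, h8, h9⟩
      · rw [h6]; exact hΓ.zero_mem
      · rw [← h9]; exact hX _ h7 _ hb h8
    refine Run.weaken (t := 1 + (2 + 1)) (Run.seq (Run.wload (Run.ifwle (fun hle => ?_)
      fun hle => ?_))) (by norm_num)
    · refine Run.weaken (Run.copy ?_) (by norm_num)
      simp only [Mem.setWreg_wreg, hval] at hle
      refine ⟨by simpa using hm3, by simpa using hm4, (h1.setWreg (by norm_num) _).setReg
        (by norm_num) _, h2, h3, by simpa using h4, fun a b hab hb => ?_, by simpa using h6⟩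
      rcases before_succ hb with hb | ⟨rfl, rfl⟩
      · simpa using h5 a b hab hb
      · simpa using hle
    · refine Run.seq (t := 1) (u := 1) (Run.wcopy (Run.copy ?_))
      simp only [Mem.setWreg_wreg, hval] at hle
      have hge : m.wreg 0 ≤ X i j :=
        (hΓ.total (hX i hiV j hjV hij) hΓ0).resolve_left (by simpa using hle)
      refine ⟨by simpa using hm3, by simpa using hm4, ((h1.setWreg (by norm_num) _).setWreg
        (by norm_num) _).setReg (by norm_num) _, h2, h3, by simpa using h4, fun a b hab hb => ?_, ?_⟩
      · simp only [Mem.setReg_wreg, Mem.setWreg_wreg, hval]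
        rcases before_succ hb with hb | ⟨rfl, rfl⟩
        · simpa using (h5 a b hab hb).trans hge
        · simp
      · refine Or.inr ⟨j, hjV, ?_, ?_, ?_⟩ <;> simp [hm3, hm4, h2, hiV, hij]
  · exact fun a b _ hb => absurd hb (not_before_zero a b)
  · left; simp
  · rintro m' ⟨h1, h2, h3, h4, h5, h6⟩
    exact ⟨h1, h2, h3, h4, fun a ha b hb hab => h5 a b ⟨ha, hb, hab⟩ (before_end (hlt a ha)), h6⟩

/-- Maximality of `M` is what makes each ordered division admissible for the machine. -/
theorem run_scale {n k : ℕ} {V H : Finset ℕ} (hV : V ⊆ Finset.range n)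
    {X : ℕ → ℕ → OrderClass I} {O : ℕ → ℕ → ℕ} {M : OrderClass I} {r z : ℕ}
    (hM : ∀ a ∈ V, ∀ b ∈ V, a ≠ b → X a b ≤ M) (m : Mem (OrderClass I)) (hm : Core n k V H m)
    (hmX : m.warr 0 = X) (hmO : m.arr 2 = O) (hr : m.reg 7 = r) (hz : m.reg 5 = z)
    (hmM : m.wreg 0 = M) :
    Run .scale (n * (n * (3 + 4) + 4) + 2) m fun m' => Core n k V H m' ∧
      (m'.arr 2 = O ∧ m'.reg 7 = r ∧ m'.reg 5 = z ∧ m'.wreg 0 = M) ∧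
      (∀ a ∈ V, ∀ b ∈ V, a ≠ b → m'.warr 0 a b = X a b / M) ∧
      ∀ a b, ¬ (a ∈ V ∧ b ∈ V ∧ a ≠ b) → m'.warr 0 a b = X a b := by
  refine run_update (by norm_num) hV (R := fun m => m.arr 2 = O ∧ m.reg 7 = r ∧ m.reg 5 = z ∧
    m.wreg 0 = M) (Y := fun a b => X a b / M) ?_ ?_ m hm ⟨hmO, hr, hz, hmM⟩ hmX
  · rintro m s v hs ⟨h1, h2, h3, h4⟩
    refine ⟨h1, ?_, ?_, h4⟩
    · rw [Mem.setReg_reg, if_neg (by lia)]; exact h2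
    · rw [Mem.setReg_reg, if_neg (by lia)]; exact h3
  · rintro i j m hi hj hij hm ⟨h1, h2, h3, h4⟩ hm3 hm4 hX
    have hij' : m.warr 0 i j = X i j := hX i j (Or.inr ⟨rfl, rfl⟩)
    refine Run.weaken (t := 1 + (1 + 1)) (Run.seq (Run.wload (Run.seq (Run.wdiv ?_
      (Run.wstore ?_))))) (by norm_num)
    · simpa [hm3, hm4, hij', h4] using hM i hi j hj hij
    · refine ⟨hm3, hm4, ((hm.setWreg (by norm_num) _).setWreg (by norm_num) _).setWarr _ _ _ _,
        ⟨h1, h2, h3, by simpa using h4⟩, fun a b => ?_⟩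
      by_cases he : a = i ∧ b = j
      · obtain ⟨rfl, rfl⟩ := he
        simp [hm3, hm4, hij', h4]
      · simp [hm3, hm4, he]

/-- Row and column `z` are not updated because `z ∉ V`, so the products use the weights from before
the loop. Keeping the old weight or overwriting it computes the maximum, by totality of `Γ`. -/
theorem run_shortcut {n k : ℕ} {V H : Finset ℕ} (hV : V ⊆ Finset.range n) {Γ : Set (OrderClass I)}
    (hΓ : IsTotalMonoid Γ) {X : ℕ → ℕ → OrderClass I} {O : ℕ → ℕ → ℕ} {r z : ℕ}
    (hzV : z ∉ V) (hXΓ : ∀ x ∈ insert z V, ∀ y ∈ insert z V, x ≠ y → X x y ∈ Γ)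
    (m : Mem (OrderClass I)) (hm : Core n k V H m)
    (hmX : m.warr 0 = X) (hmO : m.arr 2 = O) (hr : m.reg 7 = r) (hz : m.reg 5 = z) :
    Run .shortcut (n * (n * (6 + 4) + 4) + 2) m fun m' => Core n k V H m' ∧
      (m'.arr 2 = O ∧ m'.reg 7 = r ∧ m'.reg 5 = z) ∧
      (∀ a ∈ V, ∀ b ∈ V, a ≠ b → m'.warr 0 a b = X a b ⊔ X a z * X z b) ∧
      ∀ a b, ¬ (a ∈ V ∧ b ∈ V ∧ a ≠ b) → m'.warr 0 a b = X a b := by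
  refine run_update (by norm_num) hV (R := fun m => m.arr 2 = O ∧ m.reg 7 = r ∧ m.reg 5 = z)
    (Y := fun a b => X a b ⊔ X a z * X z b) ?_ ?_ m hm ⟨hmO, hr, hz⟩ hmX
  · rintro m s v hs ⟨h1, h2, h3⟩
    refine ⟨h1, ?_, ?_⟩
    · rw [Mem.setReg_reg, if_neg (by lia)]; exact h2
    · rw [Mem.setReg_reg, if_neg (by lia)]; exact h3
  · rintro i j m hi hj hij hm ⟨h1, h2, h3⟩ hm3 hm4 hX
    have hij' : m.warr 0 i j = X i j := hX i j (Or.inr ⟨rfl, rfl⟩)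
    have hiz : m.warr 0 i z = X i z := hX i z (Or.inl fun h => hzV h.2.1)
    have hzj : m.warr 0 z j = X z j := hX z j (Or.inl fun h => hzV h.1)
    have hne : ∀ a ∈ V, a ≠ z := fun a ha h => hzV (h ▸ ha)
    have hmem : ∀ a ∈ V, a ∈ insert z V := fun a => Finset.mem_insert_of_mem
    have hz' := Finset.mem_insert_self z V
    have htot := hΓ.total (hΓ.mul_mem (hXΓ i (hmem i hi) z hz' (hne i hi))
      (hXΓ z hz' j (hmem j hj) (hne j hj).symm)) (hXΓ i (hmem i hi) j (hmem j hj) hij)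
    have hcore := (((hm.setWreg (r := 1) (by norm_num) (X i z)).setWreg (r := 2) (by norm_num)
      (X z j)).setWreg (r := 1) (by norm_num) (X i z * X z j)).setWreg (r := 2) (by norm_num) (X i j)
    refine Run.weaken (t := 1 + (1 + (1 + (1 + (1 + 1))))) (Run.seq (Run.wload (Run.seq (Run.wload
      (Run.seq (Run.wmul (Run.seq (Run.wload ?_)))))))) (by norm_num)
    simp only [Mem.setWreg_reg, Mem.setWreg_warr, Mem.setWreg_wreg, hm3, hm4, h3, hij', hiz, hzj,
      if_true]
    norm_num only [if_false, if_true]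
    refine Run.ifwle (fun hle => Run.copy ?_) (fun hle => Run.wstore ?_)
    · replace hle : X i z * X z j ≤ X i j := by simpa using hle
      refine ⟨by simpa using hm3, by simpa using hm4, hcore.setReg (by norm_num) _,
        ⟨h1, by simpa using h2, by simpa using h3⟩, fun a b => ?_⟩
      simp only [Mem.setReg_warr, Mem.setWreg_warr]
      split_ifs with he
      · rw [he.1, he.2, hij', sup_eq_left.2 hle]
      · rfl
    · replace hle : ¬ X i z * X z j ≤ X i j := by simpa using hle
      refine ⟨hm3, hm4, hcore.setWarr _ _ _ _, ⟨h1, h2, h3⟩, fun a b => ?_⟩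
      simp only [Mem.setWarr_warr, Mem.setWreg_warr, Mem.setWreg_reg, hm3, hm4, true_and]
      split_ifs with he
      · rw [he.1, he.2, sup_eq_right.2 (htot.resolve_left hle)]
        simp
      · rfl

/-- Removal only marks the pairs that contain `z` as inactive. The weights stay in place, so the
column of `z` remains available for deciding its status later. -/
theorem run_remove {n k : ℕ} {V : Finset ℕ} {X : ℕ → ℕ → OrderClass I} {O : ℕ → ℕ → ℕ} {r z : ℕ}
    (m : Mem (OrderClass I)) (hm : Core n k V V m)
    (hmX : m.warr 0 = X) (hmO : m.arr 2 = O) (hr : m.reg 7 = r) (hz : m.reg 5 = z) :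
    Run .remove (n * (2 + 2) + 2 + 3) m fun m' => Core n (k + 1) (V.erase z) (V.erase z) m' ∧
      m'.warr 0 = X ∧ (∀ j, m'.arr 2 j 0 = if j = k then z else O j 0) ∧ m'.reg 7 = r ∧
      m'.reg 5 = z := by
  refine Run.seq (t := n * (2 + 2) + 2) (u := 3) (Run.mono (Run.loop (n := n) (t := 2)
    (Inv := fun i m => (m.reg 0 = n ∧ m.reg 1 = 0 ∧ m.reg 2 = k ∧ m.reg 8 = 1 ∧ m.wreg 3 = 0 ∧
      m.wreg 4 = 1 ∧ m.reg 7 = r ∧ m.reg 5 = z) ∧ m.warr 0 = X ∧ m.arr 2 = O ∧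
      (∀ i, m.arr 0 i 0 = if i ∈ V then 1 else 0) ∧
      ∀ a < n, ∀ b < n, (m.arr 1 a b = 0 ↔ (a ∈ V ∧ b ∈ V ∧ a ≠ b) ∧
        ¬ (a < i ∧ b = z) ∧ ¬ (a = z ∧ b < i)))
    ?_ ?_ ?_ m ?_) le_rfl ?_)
  · exact fun i m h => h.1.1
  · rintro i m v ⟨h, h1, h2, h3, h4⟩
    exact ⟨by simpa using h, h1, h2, h3, h4⟩
  · rintro i m hi ⟨⟨g0, g1, g2, g8, g3, g4, g7, g5⟩, h1, h2, h3, h4⟩ hmi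
    refine Run.seq (t := 1) (u := 1) (Run.store (Run.store ?_))
    refine ⟨hmi, ⟨g0, g1, g2, g8, g3, g4, g7, g5⟩, h1, ?_, ?_, ?_⟩
    · funext a b
      simp [h2]
    · intro a
      simp [h3]
    · intro a ha b hb
      simp only [Mem.setArr_arr, Mem.setArr_reg, hmi, g5, g8, true_and]
      have := h4 a ha b hb
      split_ifs <;> lia
  · refine ⟨⟨hm.reg0, hm.reg1, hm.reg2, hm.reg8, hm.wreg3, hm.wreg4, hr, hz⟩, hmX, hmO, hm.out,
      fun a ha b hb => ?_⟩
    rw [hm.act a ha b hb]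
    simp
  · rintro m' ⟨⟨g0, g1, g2, g8, g3, g4, g7, g5⟩, h1, h2, h3, h4⟩
    refine Run.seq (t := 1) (u := 2) (Run.store (Run.seq (t := 1) (u := 1) (Run.store
      (Run.succ ?_))))
    refine ⟨⟨by simpa using g0, by simpa using g1, by simp [g2], by simpa using g8, g3, g4, ?_, ?_⟩,
      h1, ?_, by simpa using g7, by simpa using g5⟩
    · intro a ha b hb
      simp only [Mem.setReg_arr, Mem.setArr_arr]
      rw [if_neg (by lia), if_neg (by lia), h4 a ha b hb]
      simp only [Finset.mem_erase]
      grind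
    · intro a
      simp only [Mem.setReg_arr, Mem.setArr_arr, Mem.setArr_reg, g1, g2, g5, h3, Finset.mem_erase]
      grind
    · intro j
      simp only [Mem.setReg_arr, Mem.setArr_arr, Mem.setArr_reg, g1, g2, g5, h2]
      grind

end Program

end StochStab

namespace StochStab

open OrderClass

/-! ### Correctness of the program -/

section Program

variable {I : Set ℝ} {V₀ : Finset ℕ} {P₀ : ℕ → ℕ → OrderClass I}

/-- From the digraph `(V₀, P₀)` the digraph `(V, P)` has been obtained by eliminating the vertices
`ord 0, …, ord (k - 1)`, and whether an eliminated vertex belongs to the answer can be read off the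
column of `X` with its index. -/
inductive History (V₀ : Finset ℕ) (P₀ X : ℕ → ℕ → OrderClass I) (ord : ℕ → ℕ) :
    ℕ → Finset ℕ → (ℕ → ℕ → OrderClass I) → Prop
  | zero : History V₀ P₀ X ord 0 V₀ P₀
  | step {k : ℕ} {V : Finset ℕ} {P P' : ℕ → ℕ → OrderClass I} (h : History V₀ P₀ X ord k V P)
      (hback : ∀ H H' : Finset ℕ,
        (∀ a, a ∈ H ↔ a ∈ H' ∨ (a = ord k ∧ ∃ x ∈ H', X x (ord k) = 1)) →
        Correct (V.erase (ord k)) P' H' → Correct V P H) :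
      History V₀ P₀ X ord (k + 1) (V.erase (ord k)) P'

theorem History.subset {X : ℕ → ℕ → OrderClass I} {ord : ℕ → ℕ} {k : ℕ} {V : Finset ℕ}
    {P : ℕ → ℕ → OrderClass I} (h : History V₀ P₀ X ord k V P) : V ⊆ V₀ := by
  induction h with
  | zero => exact subset_rfl
  | step _ _ ih => exact (Finset.erase_subset _ _).trans ih

/-- A history reads only columns of eliminated vertices and the first `k` entries of their list.
Later rounds change neither. -/
theorem History.congr {X X' : ℕ → ℕ → OrderClass I} {ord ord' : ℕ → ℕ} {k : ℕ} {V : Finset ℕ}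
    {P : ℕ → ℕ → OrderClass I} (h : History V₀ P₀ X ord k V P)
    (hX : ∀ a b, b ∉ V → X' a b = X a b) (ho : ∀ j < k, ord' j = ord j) :
    History V₀ P₀ X' ord' k V P := by
  induction h with
  | zero => exact .zero
  | @step k V P P' h hback ih =>
    have ho' := ho k k.lt_succ_self
    rw [← ho'] at hX hback ⊢
    refine .step (ih (fun a b hb => hX a b fun hb' => hb (Finset.mem_of_mem_erase hb'))
      fun j hj => ho j (hj.trans k.lt_succ_self)) fun H H' hH => hback H H' fun a => ?_
    simp only [hH, hX _ _ (Finset.notMem_erase (ord' k) V)]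

/-- The state of the memory after `r` rounds of elimination. -/
def Forward (n : ℕ) (V₀ : Finset ℕ) (P₀ : ℕ → ℕ → OrderClass I) (r : ℕ) (m : Mem (OrderClass I)) :
    Prop :=
  ∃ (k : ℕ) (V : Finset ℕ) (Γ : Set (OrderClass I)), Core n k V V m ∧ IsTotalMonoid Γ ∧
    (∀ x ∈ V, ∀ y ∈ V, x ≠ y → m.warr 0 x y ∈ Γ) ∧
    History V₀ P₀ (m.warr 0) (fun j => m.arr 2 j 0) k V (m.warr 0) ∧ k + V.card = n ∧
    -- Either every round so far has eliminated a vertex, or no arcs are left and further rounds do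
    -- nothing.
    (k = r ∨ k ≤ r ∧ ∀ x ∈ V, ∀ y ∈ V, x ≠ y → m.warr 0 x y = 0)

/-- The source `z` of a maximal arc has, after scaling, an outgoing arc of weight `1`, so
`Correct.of_eliminate` followed by `Correct.of_div` undoes the round. The coefficient `25` collects
`8`, `7` and `10` from the three loops over pairs. -/
theorem run_round (hI : ∀ ε ∈ I, 0 < ε) {n r : ℕ} (hV₀ : V₀ ⊆ Finset.range n)
    (m : Mem (OrderClass I)) (hm : Forward n V₀ P₀ r m) (hr : m.reg 7 = r) :
    Run .round (n * n * 25 + n * 16 + 13) m fun m' => m'.reg 7 = r ∧ Forward n V₀ P₀ (r + 1) m' := by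
  obtain ⟨k, V, Γ, hcore, hΓ, hXΓ, hist, hcard, hk⟩ := hm
  have hV := hist.subset.trans hV₀
  refine Run.weaken (t := 1 + (n * (n * (4 + 4) + 4) + 2) + (n * (n * (3 + 4) + 4) + 2 +
    (n * (2 + 2) + 2 + 3 + (n * (n * (6 + 4) + 4) + 2)) + 1)) (Run.seq ?_) (by ring_nf; lia)
  refine (run_findMax hΓ hV hXΓ m hcore rfl rfl hr).mono le_rfl ?_
  rintro m₁ ⟨hcore₁, hX₁, hO₁, hr₁, hmax, hM⟩
  generalize m.warr 0 = X at *
  generalize m.arr 2 = O at *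
  refine Run.ifwle (fun hle => ?_) (fun hle => ?_) <;> rw [hcore₁.wreg3] at hle
  · refine Run.weaken (Run.copy ⟨by simpa using hr₁, k, V, Γ, hcore₁.setReg (by simp) _, hΓ, ?_⟩)
      (by lia)
    simp only [Mem.setReg_warr, Mem.setReg_arr, hX₁, hO₁]
    exact ⟨hXΓ, hist, hcard, Or.inr ⟨by lia, fun x hx y hy hxy =>
      le_antisymm ((hmax x hx y hy hxy).trans hle) (OrderClass.zero_le _)⟩⟩
  · have hM0 : m₁.wreg 0 ≠ 0 := fun h => hle h.le
    obtain ⟨y₀, hy₀, hz, hzy, hMz⟩ := hM.resolve_left hM0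
    replace hk : k = r := hk.resolve_right fun h => hM0 (hMz ▸ h.2 _ hz _ hy₀ hzy)
    generalize hzdef : m₁.reg 5 = z at *
    generalize hMdef : m₁.wreg 0 = M at *
    obtain ⟨Γ', hΓ', hdiv⟩ := hΓ.exists_div hI (hMz ▸ hXΓ z hz y₀ hy₀ hzy)
    refine Run.seq ((run_scale hV hmax m₁ hcore₁ hX₁ hO₁ hr₁ hzdef hMdef).mono le_rfl ?_)
    rintro m₂ ⟨hcore₂, ⟨hO₂, hr₂, hz₂, -⟩, hin₂, hout₂⟩
    have hΓ₂ : ∀ x ∈ V, ∀ y ∈ V, x ≠ y → m₂.warr 0 x y ∈ Γ' := fun x hx y hy hxy => by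
      rw [hin₂ x hx y hy hxy]
      exact hdiv _ (hXΓ x hx y hy hxy) (hmax x hx y hy hxy)
    refine Run.seq ((run_remove m₂ hcore₂ rfl hO₂ hr₂ hz₂).mono le_rfl ?_)
    rintro m₃ ⟨hcore₃, hX₃, hO₃, hr₃, hz₃⟩
    refine (run_shortcut (X := m₂.warr 0) ((Finset.erase_subset z V).trans hV) hΓ'
      (Finset.notMem_erase z V) (by rwa [Finset.insert_erase hz]) m₃ hcore₃ hX₃ rfl hr₃ hz₃).mono
      le_rfl ?_
    rintro m₄ ⟨hcore₄, ⟨hO₄, hr₄, -⟩, hin₄, hout₄⟩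
    have hordk : m₄.arr 2 k 0 = z := by rw [hO₄, hO₃, if_pos rfl]
    have hcol : ∀ a b, b ∉ V.erase z → m₄.warr 0 a b = m₂.warr 0 a b := fun a b hb =>
      hout₄ a b fun h => hb h.2.1
    refine ⟨hr₄, k + 1, V.erase z, Γ', hcore₄, hΓ', fun x hx y hy hxy => ?_, ?_, ?_, Or.inl (by lia)⟩
    · have hx' := Finset.mem_erase.1 hx
      have hy' := Finset.mem_erase.1 hy
      rw [hin₄ x hx y hy hxy]
      exact hΓ'.sup_mem (hΓ₂ x hx'.2 y hy'.2 hxy)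
        (hΓ'.mul_mem (hΓ₂ x hx'.2 z hz hx'.1) (hΓ₂ z hz y hy'.2 hy'.1.symm))
    · have hstep := History.step (P' := m₄.warr 0) (hist.congr (X' := m₄.warr 0)
        (ord' := fun j => m₄.arr 2 j 0) (fun a b hb => ?_) fun j hj => ?_) ?_
      · simpa only [hordk] using hstep
      -- Neither scaling nor the shortcuts touch a column whose vertex was eliminated in an earlier
      -- round.
      · rw [hcol a b fun h => hb (Finset.mem_of_mem_erase h), hout₂ a b fun h => hb h.2.1]
      · simp only [hO₄, hO₃, if_neg hj.ne]
      · intro H H' hH hcor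
        simp only [hordk] at hH hcor
        refine Correct.of_div hmax hin₂ (Correct.of_eliminate hI hΓ' hz hy₀ hzy ?_ hΓ₂ hin₄ ?_ hcor)
        · rw [hin₂ z hz y₀ hy₀ hzy, hMz, div_self_eq_one]
        · simpa only [hcol _ z (Finset.notMem_erase z V)] using hH
    · rw [Finset.card_erase_of_mem hz]
      have := Finset.card_pos.2 ⟨z, hz⟩
      lia

/-- The state of the memory when the status of `k` eliminated vertices is still unknown. -/
def Backward (n : ℕ) (V₀ : Finset ℕ) (P₀ : ℕ → ℕ → OrderClass I) (k : ℕ) (m : Mem (OrderClass I)) :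
    Prop :=
  (m.reg 0 = n ∧ m.reg 1 = 0 ∧ m.reg 2 = k ∧ m.reg 8 = 1 ∧ m.wreg 4 = 1) ∧
    ∃ (V H : Finset ℕ) (P : ℕ → ℕ → OrderClass I),
      History V₀ P₀ (m.warr 0) (fun j => m.arr 2 j 0) k V P ∧ Correct V P H ∧
      ∀ i, m.arr 0 i 0 = if i ∈ H then 1 else 0

/-- The criterion of `Correct.of_eliminate`: the vertex `z` eliminated last joins the answer if some
vertex already in it has weight `1` in column `z`. That column still holds the weights from the
moment of elimination. -/
theorem run_decideLast {n k : ℕ} (hV₀ : V₀ ⊆ Finset.range n) (m : Mem (OrderClass I))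
    (hm : Backward n V₀ P₀ (k + 1) m) : Run .decideLast (n * 7 + 4) m (Backward n V₀ P₀ k) := by
  obtain ⟨⟨h0, h1, h2, h8, hw4⟩, V, H', P', hist, hcor, hout⟩ := hm
  generalize hX : m.warr 0 = X at *
  generalize hO : (fun j => m.arr 2 j 0) = ord at *
  cases hist with
  | @step _ V P _ hist hback =>
  obtain ⟨z, hz⟩ : ∃ z, ord k = z := ⟨_, rfl⟩
  rw [hz] at hcor hback
  have hH'n : ∀ x ∈ H', x < n := fun x hx =>
    Finset.mem_range.1 (hV₀ (hist.subset (Finset.mem_of_mem_erase (hcor.subset hx))))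
  refine Run.weaken (t := 1 + (1 + (n * (5 + 2) + 2))) (Run.seq (Run.pred (Run.seq (Run.load
    ?_)))) (by lia)
  refine Run.mono (Run.loop (n := n) (t := 5) (Inv := fun i m => (m.reg 0 = n ∧ m.reg 1 = 0 ∧
      m.reg 2 = k ∧ m.reg 8 = 1 ∧ m.wreg 4 = 1 ∧ m.reg 5 = z) ∧ m.warr 0 = X ∧
      (fun j => m.arr 2 j 0) = ord ∧
      ∃ H : Finset ℕ, (∀ a, a ∈ H ↔ a ∈ H' ∨ (a = z ∧ ∃ x ∈ H', x < i ∧ X x z = 1)) ∧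
        ∀ a, m.arr 0 a 0 = if a ∈ H then 1 else 0)
    ?_ ?_ ?_ _ ?_) le_rfl ?_
  · exact fun i m h => h.1.1
  · rintro i m v ⟨h, h'⟩
    exact ⟨by simpa using h, h'⟩
  · rintro i m hi ⟨⟨g0, g1, g2, g8, g4, g5⟩, hX, hO, H, hH, hA⟩ hmi
    have hsame : ¬ (i ∈ H' ∧ X i z = 1) →
        ∀ a, a ∈ H ↔ a ∈ H' ∨ (a = z ∧ ∃ x ∈ H', x < i + 1 ∧ X x z = 1) := by
      intro hi a
      rw [hH]
      refine or_congr_right (and_congr_right fun _ => exists_congr fun x =>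
        and_congr_right fun hx => ?_)
      have : X x z = 1 → x ≠ i := fun h hxi => hi (hxi ▸ ⟨hx, h⟩)
      constructor <;> rintro ⟨h1, h2⟩ <;> refine ⟨?_, h2⟩ <;> have := this h2 <;> lia
    refine Run.weaken (t := 1 + (1 + (1 + 1) + 1)) (Run.seq (Run.load (Run.iflt (fun hlt => ?_)
      fun hlt => ?_))) (by norm_num)
    · have hiH : i ∈ H := by
        by_contra hiH
        simp [hmi, hA, hiH, g1] at hlt
      refine Run.seq (t := 1) (u := 1 + 1) (Run.wload (Run.ifwle (fun hle => Run.store ?_)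
        fun hle => Run.copy ?_))
      · replace hle : X i z = 1 := eq_one_of_le (by simpa [g4, g5, hmi, hX] using hle)
        refine ⟨by simpa using hmi, by simp [g0, g1, g2, g8, g4, g5], hX, by simpa using hO,
          insert z H, fun a => ?_, fun a => ?_⟩
        · rw [Finset.mem_insert, hH]
          constructor
          · rintro (rfl | h | ⟨rfl, x, hx, hxi, h⟩)
            · rcases (hH i).1 hiH with h | ⟨-, x, hx, hxi, h⟩
              · exact Or.inr ⟨rfl, i, h, by lia, hle⟩
              · exact Or.inr ⟨rfl, x, hx, by lia, h⟩
            · exact Or.inl h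
            · exact Or.inr ⟨rfl, x, hx, by lia, h⟩
          · rintro (h | ⟨rfl, -⟩)
            · exact Or.inr (Or.inl h)
            · exact Or.inl rfl
        · simp only [Mem.setArr_arr, Mem.setWreg_arr, Mem.setReg_arr, Mem.setWreg_reg,
            Mem.setReg_reg, hA, Finset.mem_insert, g1, g5, g8]
          by_cases ha : a = z <;> simp [ha]
      · replace hle : ¬ X i z = 1 := fun h => hle (by simp [g4, g5, hmi, hX, h])
        exact ⟨by simpa using hmi, by simp [g0, g1, g2, g8, g4, g5], hX, by simpa using hO, H,
          hsame fun h => hle h.2, by simpa using hA⟩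
    · have hiH : i ∉ H := by
        intro hiH
        simp [hmi, hA, hiH, g1] at hlt
      refine Run.weaken (Run.copy ?_) (by norm_num)
      exact ⟨by simpa using hmi, by simp [g0, g1, g2, g8, g4, g5], hX, by simpa using hO, H,
        hsame fun h => hiH ((hH i).2 (Or.inl h.1)), by simpa using hA⟩
  · exact ⟨by simp [h0, h1, h2, h8, hw4, ← hz, ← hO], by simpa using hX, by simpa using hO, H',
      by simp, by simpa using hout⟩
  · rintro m' ⟨⟨g0, g1, g2, g8, g4, g5⟩, hX', hO', H, hH, hA⟩
    refine ⟨⟨g0, g1, g2, g8, g4⟩, V, H, P, by rwa [hX', hO'], hback H H' (fun a => ?_) hcor, hA⟩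
    rw [hH]
    exact or_congr_right (and_congr_right fun _ => exists_congr fun x =>
      and_congr_right fun hx => and_iff_right (hH'n x hx))

theorem run_decide {n : ℕ} (hV₀ : V₀ ⊆ Finset.range n) : ∀ (k : ℕ) (m : Mem (OrderClass I)),
    Backward n V₀ P₀ k m →
      Run (.whilelt 1 2 .decideLast) (k * (n * 7 + 5) + 1) m (Backward n V₀ P₀ 0)
  | 0, m, hm => by
    refine Run.weaken (Run.while_false ?_ hm) (by lia)
    rw [hm.1.2.1, hm.1.2.2.1]
    exact lt_irrefl 0
  | k + 1, m, hm => by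
    refine Run.weaken (Run.while_true (t := n * 7 + 4) (u := k * (n * 7 + 5) + 1) ?_
      ((run_decideLast hV₀ m hm).mono le_rfl fun m' hm' => run_decide hV₀ k m' hm')) (by ring_nf; lia)
    rw [hm.1.2.1, hm.1.2.2.1]
    exact k.succ_pos

theorem run_init {n : ℕ} (P : Fin n → Fin n → OrderClass I) :
    Run .init (n * 4 + 4) (Mem.input n P) fun m =>
      Core n 0 (Finset.range n) (Finset.range n) m ∧ m.warr 0 = (Mem.input n P).warr 0 := by
  refine Run.weaken (t := 1 + (1 + (n * (2 + 2) + 2))) (Run.seq (Run.wone (Run.seq (Run.const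
    ?_)))) (by lia)
  refine Run.mono (Run.loop (n := n) (t := 2) (Inv := fun i m => (m.reg 0 = n ∧ m.reg 1 = 0 ∧
      m.reg 2 = 0 ∧ m.reg 8 = 1 ∧ m.wreg 3 = 0 ∧ m.wreg 4 = 1) ∧
      m.warr 0 = (Mem.input n P).warr 0 ∧ (∀ a, m.arr 0 a 0 = if a < i then 1 else 0) ∧
      ∀ a b, m.arr 1 a b = if a = b ∧ a < i then 1 else 0) ?_ ?_ ?_ _ ?_) le_rfl ?_
  · exact fun i m h => h.1.1
  · rintro i m v ⟨h, h'⟩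
    exact ⟨by simpa using h, h'⟩
  · rintro i m hi ⟨⟨g0, g1, g2, g8, g3, g4⟩, hX, h0, h1⟩ hmi
    refine Run.seq (t := 1) (u := 1) (Run.store (Run.store ⟨hmi, ⟨g0, g1, g2, g8, g3, g4⟩, hX, ?_,
      ?_⟩))
    · intro a
      simp only [Mem.setArr_arr, Mem.setArr_reg, hmi, g1, g8, h0]
      grind
    · intro a b
      simp only [Mem.setArr_arr, Mem.setArr_reg, hmi, g1, g8, h1]
      grind
  · simp [Mem.input]
  · rintro m ⟨⟨g0, g1, g2, g8, g3, g4⟩, hX, h0, h1⟩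
    refine ⟨⟨g0, g1, g2, g8, g3, g4, fun a ha b hb => ?_, fun a => ?_⟩, hX⟩
    · simp [h1, ha, hb]
    · simp [h0]

/-- After `n` rounds no vertex or no arc of nonzero weight remains, so `Correct.of_zero` declares
all remaining vertices charged. -/
theorem Forward.backward {n : ℕ} {m : Mem (OrderClass I)} (h : Forward n V₀ P₀ n m) :
    ∃ k ≤ n, Backward n V₀ P₀ k m := by
  obtain ⟨k, V, Γ, hcore, hΓ, hXΓ, hist, hcard, hk⟩ := h
  refine ⟨k, by lia, ⟨hcore.reg0, hcore.reg1, hcore.reg2, hcore.reg8, hcore.wreg4⟩, V, V, _, hist,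
    Correct.of_zero V ?_, hcore.out⟩
  rcases hk with hk | ⟨-, hk⟩
  · have : V = ∅ := Finset.card_eq_zero.1 (by lia)
    simp [this]
  · exact hk

theorem computesWithin_stability {n : ℕ} (hn : 0 < n) (p : Perturbation I (Fin n))
    (hp : p.Comparable) :
    Prog.stability.ComputesWithin p.classes (100 * n ^ 3) {x | p.Stable x} := by
  obtain ⟨Γ, hΓ, hpΓ⟩ := hp.exists_total
  set P₀ := (Mem.input n p.classes).warr 0 with hP₀
  have hentry : ∀ x y : Fin n, P₀ x y = p.classes x y := fun x y => by simp [hP₀, Mem.input]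
  have hrun : Run .stability (n * 4 + 4 + (n * (n * n * 25 + n * 16 + 13 + 2) + 2 +
      (n * (n * 7 + 5) + 1))) (Mem.input n p.classes) (Backward n (Finset.range n) P₀ 0) := by
    refine Run.seq ((run_init p.classes).mono le_rfl ?_)
    rintro m ⟨hcore, hX⟩
    refine Run.seq ((Run.loop (Inv := Forward n (Finset.range n) P₀) ?_ ?_ ?_ m ?_).mono le_rfl ?_)
    · rintro i m ⟨k, V, Γ, hcore, -⟩
      exact hcore.reg0
    · rintro i m v ⟨k, V, Γ, hcore, h⟩
      exact ⟨k, V, Γ, hcore.setReg (by simp) v, h⟩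
    · exact fun i m _ hm hmi => run_round p.pos subset_rfl m hm hmi
    · refine ⟨0, Finset.range n, Γ, hcore, hΓ, fun x hx y hy hxy => ?_, ?_, by simp, Or.inl rfl⟩
      · rw [Finset.mem_range] at hx hy
        have h := hpΓ ⟨x, hx⟩ ⟨y, hy⟩ fun h => hxy (congrArg Fin.val h)
        rwa [← hentry, hP₀, ← hX] at h
      · rw [hX]
        exact .zero
    · intro m' hm'
      obtain ⟨k, hk, hb⟩ := hm'.backward
      exact (run_decide subset_rfl k m' hb).weaken
        (Nat.add_le_add_right (Nat.mul_le_mul_right _ hk) 1)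
  obtain ⟨s, m, hexec, hs, -, V, H, P, hist, hcor, hout⟩ := hrun
  refine ⟨s, m, hexec, hs.trans ?_, fun i => ?_⟩
  -- The total is `25 * n ^ 3 + 23 * n ^ 2 + 24 * n + 7`, which is at most `79 * n ^ 3` for `n ≥ 1`.
  · have h1 : 1 ≤ n ^ 3 := Nat.one_le_pow _ _ hn
    have h2 : n ≤ n ^ 3 := Nat.le_self_pow (by norm_num) n
    have h3 : n ^ 2 ≤ n ^ 3 := Nat.pow_le_pow_right hn (by norm_num)
    ring_nf
    lia
  -- With no vertex left undecided, the digraph of the history is the input itself.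
  · cases hist
    have hrange : Finset.range n = Finset.univ.image (Fin.val : Fin n → ℕ) := by
      ext a
      simp only [Finset.mem_range, Finset.mem_image, Finset.mem_univ, true_and]
      exact ⟨fun h => ⟨⟨a, h⟩, rfl⟩, fun ⟨x, hx⟩ => hx ▸ x.2⟩
    rw [hrange] at hcor
    rw [hout, Set.mem_ofPred_eq, hcor.stable_iff Fin.val_injective fun x y _ => hentry x y]
    simp

end Program

end StochStab

theorem mainTheorem2 :
    (∀ (I : Set ℝ) (S : Type*) [Fintype S] [DecidableEq S] (p : StochStab.Perturbation I S),
      p.Comparable →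
        ∃ H : Finset S, StochStab.Hub p.classes H ∧ ∀ x : S, p.Stable x ↔ x ∈ H) ∧
    (∃ (c : StochStab.Prog) (C : ℕ),
      ∀ (n : ℕ), 0 < n → ∀ (I : Set ℝ) (p : StochStab.Perturbation I (Fin n)),
        p.Comparable → c.ComputesWithin p.classes (C * n ^ 3) {x | p.Stable x}) := by
  exact ⟨fun I S _ _ p hp => StochStab.exists_hub hp, StochStab.Prog.stability, 100,
    fun n hn I p hp => StochStab.computesWithin_stability hn p hp⟩
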